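/- There is a constant $q_0>0$ such that the following holds for every real $q\in(-1,1)$ with $|q|<q_0$, every real Hilbert space $\mathcal H_{\mathbb R}$ with $\dim\mathcal H_{\mathbb R}\ge 2$, every unit vector $e\in\mathcal H_{\mathbb R}$ and every free ultrafilter $\omega$ on $\mathbb N$. Let $\mathcal F_q(\mathcal H_{\mathbb R})$ be the $q$-Fock space, that is, the completion of $\bigoplus_{n\ge 0}\mathcal H^{\otimes n}$, where $\mathcal H=\mathcal H_{\mathbb R}\otimes_{\mathbb R}\mathbb C$ and $\mathcal H^{\otimes 0}=\mathbb C\Omega$, for the inner product $$\langle e_1\otimes\cdots\otimes e_n,f_1\otimes\cdots\otimes f_m\rangle_q=\delta_{n,m}\sum_{\sigma\in S_n}q^{|\sigma|}\prod_{i=1}^n\langle e_i,f_{\sigma(i)}\rangle ,$$ $|\sigma|$ being the number of inversions of $\sigma$. For $\xi\in\mathcal H_{\mathbb R}$ let $c(\xi)$ be the bounded operator with $c(\xi)\Omega=\xi$ and $c(\xi)(e_1\otimes\cdots\otimes e_n)=\xi\otimes e_1\otimes\cdots\otimes e_n$, and put $s(\xi)=c(\xi)+c(\xi)^*$. Let $M=\{s(\xi):\xi\in\mathcal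 H_{\mathbb R}\}''$ be the $q$-Gaussian algebra, with trace $\tau(x)=\langle \Omega,x\Omega\rangle$ (inner products being conjugate-linear in the first variable), and let $A=\{s(e)\}''\subset M$ be the generator masa. Write $\|x\|_2=\tau(x^*x)^{1/2}$. For $N\in\{M,A\}$ let $N^\omega$ be the tracial ultrapower, that is, the bounded sequences in $N$ modulo those with $\lim_{n\to\omega}\|x_n\|_2=0$, with trace $\tau_\omega((x_n)_n)=\lim_{n\to\omega}\tau(x_n)$; the symbols $\perp$ and $\ominus$ refer to the inner products $\tau(x^*y)$ and $\tau_\omega(x^*y)$. Then the inclusion $A\subset M$ has the strong asymptotic orthogonality property with respect to $\omega$: for every diffuse von Neumann subalgebra $C\subset A$ (with the same unit), all $a,b\in M\ominus A$ and every $x\in (M^\omega\ominus A^\omega)\cap C'$, one has $ax\perp xb$ in $M^\omega$. -/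

import Mathlib

namespace QGaussian

open scoped InnerProductSpace ComplexConjugate Topology

/-- The number `|σ|` of inversions of a permutation of `{0, …, n - 1}`. -/
def inversions {n : ℕ} (σ : Equiv.Perm (Fin n)) : ℕ :=
  (Finset.univ.filter fun p : Fin n × Fin n => p.1 < p.2 ∧ σ p.2 < σ p.1).card

section Words

variable {H : Type*} [NormedAddCommGroup H] [InnerProductSpace ℝ H]

/-- The `q`-deformed inner product
`⟨u₁ ⊗ ⋯ ⊗ uₙ, v₁ ⊗ ⋯ ⊗ vₙ⟩_q = ∑_σ q^|σ| ⟨u₁, v_σ(1)⟩ ⋯ ⟨uₙ, v_σ(n)⟩` of two simple tensors of the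
same length with entries in the real Hilbert space `H`. -/
noncomputable def wordInner (q : ℝ) {n : ℕ} (u v : Fin n → H) : ℝ :=
  ∑ σ : Equiv.Perm (Fin n), q ^ inversions σ * ∏ i, ⟪u i, v (σ i)⟫_ℝ

/-- The `q`-deformed inner product of two simple tensors of arbitrary lengths; tensors of different
lengths are orthogonal. -/
noncomputable def kernel (q : ℝ) (u v : (n : ℕ) × (Fin n → H)) : ℝ :=
  if h : u.1 = v.1 then wordInner q u.2 (fun i => v.2 (Fin.cast h i)) else 0

theorem inversions_inv {n : ℕ} (σ : Equiv.Perm (Fin n)) :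
    inversions σ⁻¹ = inversions σ := by
  unfold inversions
  refine Finset.card_bij' (fun p _ => (σ⁻¹ p.2, σ⁻¹ p.1)) (fun p _ => (σ p.2, σ p.1)) ?_ ?_ ?_ ?_
  all_goals simp +contextual

theorem wordInner_comm (q : ℝ) {n : ℕ} (u v : Fin n → H) :
    wordInner q u v = wordInner q v u := by
  unfold wordInner
  refine Fintype.sum_equiv (Equiv.inv _) _ _ fun σ => ?_
  simp only [Equiv.inv_apply, inversions_inv]
  congr 1
  refine Fintype.prod_equiv σ _ _ fun i => ?_
  simp [real_inner_comm]

theorem kernel_mk (q : ℝ) {n : ℕ} (u v : Fin n → H) :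
    kernel q ⟨n, u⟩ ⟨n, v⟩ = wordInner q u v := by
  simp [kernel]

theorem kernel_comm (q : ℝ) (u v : (n : ℕ) × (Fin n → H)) :
    kernel q u v = kernel q v u := by
  obtain ⟨n, u⟩ := u
  obtain ⟨m, v⟩ := v
  by_cases h : n = m
  · subst h
    rw [kernel_mk, kernel_mk, wordInner_comm]
  · simp [kernel, h, Ne.symm h]

/-- Positive semidefinite real kernels on a set `X`. -/
def PSD {X : Type*} (K : X → X → ℝ) : Prop :=
  (∀ x y, K x y = K y x) ∧
    ∀ (s : Finset X) (f : X → ℝ), 0 ≤ ∑ x ∈ s, ∑ y ∈ s, f x * f y * K x y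

theorem PSD.gram {X V : Type*} [NormedAddCommGroup V] [InnerProductSpace ℝ V] (v : X → V) :
    PSD fun x y => ⟪v x, v y⟫_ℝ := by
  refine ⟨fun x y => real_inner_comm _ _, fun s f => ?_⟩
  have : ∑ x ∈ s, ∑ y ∈ s, f x * f y * ⟪v x, v y⟫_ℝ
      = ⟪∑ x ∈ s, f x • v x, ∑ x ∈ s, f x • v x⟫_ℝ := by
    rw [sum_inner]
    refine Finset.sum_congr rfl fun x _ => ?_
    rw [inner_sum]
    refine Finset.sum_congr rfl fun y _ => ?_
    rw [real_inner_smul_left, real_inner_smul_right, mul_assoc]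
  rw [this]
  exact real_inner_self_nonneg

theorem PSD.rankOne {X : Type*} (g : X → ℝ) : PSD fun x y => g x * g y := by
  have h := PSD.gram g
  refine ⟨fun x y => mul_comm _ _, fun s f => ?_⟩
  simpa [mul_comm] using h.2 s f

theorem PSD.add {X : Type*} {K L : X → X → ℝ} (hK : PSD K) (hL : PSD L) :
    PSD fun x y => K x y + L x y := by
  refine ⟨fun x y => by simp only [hK.1 x y, hL.1 x y], fun s f => ?_⟩
  simp only [mul_add, Finset.sum_add_distrib]
  exact add_nonneg (hK.2 s f) (hL.2 s f)

theorem PSD.smul {X : Type*} {K : X → X → ℝ} (hK : PSD K) {c : ℝ} (hc : 0 ≤ c) :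
    PSD fun x y => c * K x y := by
  refine ⟨fun x y => by simp only [hK.1 x y], fun s f => ?_⟩
  simp only [mul_left_comm _ c, ← Finset.mul_sum]
  exact mul_nonneg hc (hK.2 s f)

theorem PSD.comp {X Y : Type*} {K : Y → Y → ℝ} (hK : PSD K) (g : X → Y) :
    PSD fun x y => K (g x) (g y) := by
  classical
  refine ⟨fun x y => hK.1 _ _, fun s f => ?_⟩
  have h := hK.2 (s.image g) fun z => ∑ x ∈ s with g x = z, f x
  convert h using 1
  rw [← Finset.sum_fiberwise_of_maps_to (t := s.image g)
    (fun x hx => Finset.mem_image_of_mem g hx)]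
  refine Finset.sum_congr rfl fun z _ => ?_
  have h2 : ∀ x, ∑ y ∈ s, f x * f y * K (g x) (g y) =
      ∑ w ∈ s.image g, ∑ y ∈ s with g y = w, f x * f y * K (g x) w := by
    intro x
    rw [← Finset.sum_fiberwise_of_maps_to (t := s.image g)
      (fun x hx => Finset.mem_image_of_mem g hx)]
    refine Finset.sum_congr rfl fun w _ => Finset.sum_congr rfl fun y hy => ?_
    rw [(Finset.mem_filter.1 hy).2]
  simp only [h2]
  rw [Finset.sum_comm]
  refine Finset.sum_congr rfl fun w _ => ?_
  rw [Finset.sum_mul_sum, Finset.sum_mul]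
  refine Finset.sum_congr rfl fun x hx => ?_
  rw [Finset.sum_mul, (Finset.mem_filter.1 hx).2]

theorem PSD.mul {X : Type*} {K L : X → X → ℝ} (hK : PSD K) (hL : PSD L) :
    PSD fun x y => K x y * L x y := by
  have aux {K : X → X → ℝ} (hK : PSD K) (s : Finset X) :
      (Matrix.of fun x y : s => K x y).PosSemidef := by
    rw [Matrix.posSemidef_iff_dotProduct_mulVec]
    refine ⟨?_, fun f => ?_⟩
    · ext x y
      simpa using hK.1 y x
    · have h := (hK.comp (Subtype.val : s → X)).2 Finset.univ f
      simpa [dotProduct, Matrix.mulVec, Finset.mul_sum, mul_assoc, mul_comm, mul_left_comm]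
        using h
  refine ⟨fun x y => by simp only [hK.1 x y, hL.1 x y], fun s f => ?_⟩
  have h := ((aux hK s).hadamard (aux hL s))
  rw [Matrix.posSemidef_iff_dotProduct_mulVec] at h
  have h := h.2 fun x => f x
  rw [← Finset.sum_coe_sort s]
  simp only [← Finset.sum_coe_sort s]
  simpa [dotProduct, Matrix.mulVec, Finset.mul_sum, mul_assoc, mul_comm, mul_left_comm]
    using h

theorem PSD.prod {X ι : Type*} (s : Finset ι) (A : ι → X → X → ℝ)
    (hA : ∀ i ∈ s, PSD (A i)) : PSD fun x y => ∏ i ∈ s, A i x y := by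
  classical
  induction s using Finset.induction_on with
  | empty => simpa using PSD.rankOne (fun _ : X => (1 : ℝ))
  | insert i s hi ih =>
    simpa [Finset.prod_insert hi] using (hA i (Finset.mem_insert_self i s)).mul
      (ih fun j hj => hA j (Finset.mem_insert_of_mem hj))

theorem PSD.agree {X : Type*} {q : ℝ} (hq : q ∈ Set.Icc (-1 : ℝ) 1) (b : X → Prop)
    [DecidablePred b] : PSD fun x y => if (b x ↔ b y) then (1 : ℝ) else q := by
  have h1 := (PSD.rankOne (fun _ : X => (1 : ℝ))).smul
    (show 0 ≤ (1 + q) / 2 by linarith [hq.1])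
  have h2 := (PSD.rankOne (fun x : X => if b x then (1 : ℝ) else -1)).smul
    (show 0 ≤ (1 - q) / 2 by linarith [hq.2])
  convert h1.add h2 using 3 with x y
  by_cases hx : b x <;> by_cases hy : b y <;> simp [hx, hy] <;> ring

theorem PSD.sum_fiber {X Y : Type*} [Fintype Y] {B : X × Y → X × Y → ℝ} (hB : PSD B) :
    PSD fun x x' => ∑ y, ∑ y', B (x, y) (x', y') := by
  classical
  refine ⟨fun x x' => ?_, fun s f => ?_⟩
  · dsimp only
    rw [Finset.sum_comm]
    exact Finset.sum_congr rfl fun y _ => Finset.sum_congr rfl fun y' _ => hB.1 _ _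
  · have h := hB.2 (s ×ˢ Finset.univ) fun p => f p.1
    convert h using 1
    rw [Finset.sum_product]
    refine Finset.sum_congr rfl fun x _ => ?_
    simp only [Finset.sum_product]
    rw [Finset.sum_comm]
    refine Finset.sum_congr rfl fun x' _ => ?_
    simp only [Finset.mul_sum]

theorem inversions_mul_inv {n : ℕ} (τ ρ : Equiv.Perm (Fin n)) :
    inversions (ρ * τ⁻¹) = ((Finset.univ.filter fun p : Fin n × Fin n => p.1 < p.2).filter
      fun p => ¬ (τ p.1 < τ p.2 ↔ ρ p.1 < ρ p.2)).card := by
  have key (a b : Fin n) (hab : a ≠ b) : ¬ (τ a < τ b ↔ ρ a < ρ b) ↔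
      (τ a < τ b ∧ ρ b < ρ a) ∨ (τ b < τ a ∧ ρ a < ρ b) := by
    have h1 : τ a ≠ τ b := by simpa using hab
    have h2 : ρ a ≠ ρ b := by simpa using hab
    rcases lt_or_gt_of_ne h1 with h1 | h1 <;> rcases lt_or_gt_of_ne h2 with h2 | h2 <;>
      simp [h1, h2, h1.not_gt, h2.not_gt]
  unfold inversions
  refine Finset.card_bij' (fun p _ => if τ⁻¹ p.1 < τ⁻¹ p.2 then (τ⁻¹ p.1, τ⁻¹ p.2)
      else (τ⁻¹ p.2, τ⁻¹ p.1))
    (fun p _ => if τ p.1 < τ p.2 then (τ p.1, τ p.2) else (τ p.2, τ p.1)) ?_ ?_ ?_ ?_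
  · rintro ⟨a, b⟩ h
    obtain ⟨a, rfl⟩ := τ.surjective a
    obtain ⟨b, rfl⟩ := τ.surjective b
    obtain ⟨-, h⟩ := Finset.mem_filter.1 h
    simp only [Equiv.Perm.mul_apply, Equiv.Perm.coe_inv, Equiv.symm_apply_apply] at h ⊢
    have hne : a ≠ b := by rintro rfl; exact h.1.ne rfl
    split_ifs with h'
    · simp only [Finset.mem_filter, Finset.mem_univ, true_and]
      exact ⟨h', (key a b hne).2 (Or.inl h)⟩
    · simp only [Finset.mem_filter, Finset.mem_univ, true_and]
      exact ⟨lt_of_le_of_ne (not_lt.1 h') hne.symm, (key b a hne.symm).2 (Or.inr h)⟩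
  · rintro ⟨a, b⟩ h
    simp only [Finset.mem_filter, Finset.mem_univ, true_and] at h
    refine Finset.mem_filter.2 ⟨Finset.mem_univ _, ?_⟩
    rcases (key a b h.1.ne).1 h.2 with h' | h'
    · simp [h'.1, h'.2]
    · simp [h'.1, h'.2, h'.1.not_gt]
  · rintro ⟨a, b⟩ h
    obtain ⟨-, h⟩ := Finset.mem_filter.1 h
    dsimp only at h ⊢
    split_ifs with h1 h2 h2 <;> simp_all [h.1.not_gt]
  · rintro ⟨a, b⟩ h
    simp only [Finset.mem_filter, Finset.mem_univ, true_and] at h ⊢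
    split_ifs with h1 h2 h2 <;> simp_all [h.1.not_gt]

theorem psd_wordInner {q : ℝ} (hq : q ∈ Set.Icc (-1 : ℝ) 1) (n : ℕ) :
    PSD fun u v : Fin n → H => wordInner q u v := by
  classical
  have h1 : PSD fun x y : (Fin n → H) × Equiv.Perm (Fin n) =>
      ∏ k, ⟪x.1 (x.2 k), y.1 (y.2 k)⟫_ℝ :=
    PSD.prod _ _ fun k _ => PSD.gram
      fun x : (Fin n → H) × Equiv.Perm (Fin n) => x.1 (x.2 k)
  have h2 : PSD fun x y : (Fin n → H) × Equiv.Perm (Fin n) =>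
      ∏ p ∈ Finset.univ.filter fun p : Fin n × Fin n => p.1 < p.2,
        if (x.2 p.1 < x.2 p.2 ↔ y.2 p.1 < y.2 p.2) then (1 : ℝ) else q :=
    PSD.prod _ _ fun p _ => PSD.agree hq
      fun x : (Fin n → H) × Equiv.Perm (Fin n) => x.2 p.1 < x.2 p.2
  have h3 := (h1.mul h2).sum_fiber.smul (show 0 ≤ ((n.factorial : ℝ))⁻¹ by positivity)
  convert h3 using 3 with u v
  rw [eq_inv_mul_iff_mul_eq₀ (by positivity)]
  have : ∀ τ : Equiv.Perm (Fin n), wordInner q u v = ∑ ρ : Equiv.Perm (Fin n),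
      (∏ k, ⟪u (τ k), v (ρ k)⟫_ℝ) *
      ∏ p ∈ Finset.univ.filter fun p : Fin n × Fin n => p.1 < p.2,
        if (τ p.1 < τ p.2 ↔ ρ p.1 < ρ p.2) then (1 : ℝ) else q := by
    intro τ
    unfold wordInner
    refine Fintype.sum_equiv (Equiv.mulRight τ) _ _ fun σ => ?_
    rw [mul_comm]
    congr 1
    · refine (Fintype.prod_equiv τ _ _ fun i => ?_).symm
      simp
    · rw [Finset.prod_ite, Finset.prod_const_one, Finset.prod_const, one_mul,
        ← inversions_mul_inv]
      simp
  rw [← Finset.sum_congr rfl fun τ _ => this τ]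
  simp [Fintype.card_perm]

theorem psd_kernel {q : ℝ} (hq : q ∈ Set.Icc (-1 : ℝ) 1) :
    PSD fun u v : (n : ℕ) × (Fin n → H) => kernel q u v := by
  classical
  let pad (N : ℕ) (u : (n : ℕ) × (Fin n → H)) : Fin N → H :=
    fun i => if h : (i : ℕ) < u.1 then u.2 ⟨i, h⟩ else 0
  have hN (N : ℕ) : PSD fun u v : (n : ℕ) × (Fin n → H) =>
      (if u.1 = N then (1 : ℝ) else 0) * (if v.1 = N then 1 else 0) *
        wordInner q (pad N u) (pad N v) :=
    (PSD.rankOne fun u : (n : ℕ) × (Fin n → H) => if u.1 = N then (1 : ℝ) else 0).mul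
      ((psd_wordInner (H := H) hq N).comp (pad N))
  have key (u v : (n : ℕ) × (Fin n → H)) (N : ℕ) (hu : u.1 < N) : kernel q u v =
      ∑ k ∈ Finset.range N, (if u.1 = k then (1 : ℝ) else 0) * (if v.1 = k then 1 else 0) *
        wordInner q (pad k u) (pad k v) := by
    obtain ⟨n, u⟩ := u
    obtain ⟨m, v⟩ := v
    rw [Finset.sum_eq_single_of_mem n (by simpa using hu) (by
      intro b _ hb; simp [Ne.symm hb])]
    by_cases h : n = m
    · subst h
      simp [kernel_mk, pad]
    · simp [kernel, h, Ne.symm h]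
  refine ⟨kernel_comm q, fun s f => ?_⟩
  dsimp only
  have : ∑ u ∈ s, ∑ v ∈ s, f u * f v * kernel q u v =
      ∑ N ∈ Finset.range (s.sup (fun u => u.1) + 1), ∑ u ∈ s, ∑ v ∈ s, f u * f v *
        ((if u.1 = N then (1 : ℝ) else 0) * (if v.1 = N then 1 else 0) *
          wordInner q (pad N u) (pad N v)) := by
    symm
    rw [Finset.sum_comm]
    refine Finset.sum_congr rfl fun u hu => ?_
    rw [Finset.sum_comm]
    refine Finset.sum_congr rfl fun v _ => ?_
    rw [key u v _ (Nat.lt_succ_of_le (Finset.le_sup (f := fun u => u.1) hu)), Finset.mul_sum]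
  rw [this]
  refine Finset.sum_nonneg fun N _ => ?_
  exact (hN N).2 s f

/-- The permutation sending `0` to `i` and inducing `σ` on the remaining positions. -/
def consPerm {n : ℕ} (i : Fin (n + 1)) (σ : Equiv.Perm (Fin n)) : Equiv.Perm (Fin (n + 1)) :=
  (finSuccEquiv' 0).trans ((Equiv.optionCongr σ).trans (finSuccEquiv' i).symm)

theorem consPerm_zero {n : ℕ} (i : Fin (n + 1)) (σ : Equiv.Perm (Fin n)) :
    consPerm i σ 0 = i := by
  simp [consPerm]

theorem consPerm_succ {n : ℕ} (i : Fin (n + 1)) (σ : Equiv.Perm (Fin n)) (k : Fin n) :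
    consPerm i σ k.succ = i.succAbove (σ k) := by
  have : finSuccEquiv' (0 : Fin (n + 1)) k.succ = some k := by
    simp
  simp [consPerm, this]

theorem consPerm_bijective (n : ℕ) :
    Function.Bijective fun p : Fin (n + 1) × Equiv.Perm (Fin n) => consPerm p.1 p.2 := by
  rw [Fintype.bijective_iff_injective_and_card]
  refine ⟨?_, by simp [Fintype.card_perm, Nat.factorial_succ]⟩
  rintro ⟨i, σ⟩ ⟨j, τ⟩ h
  dsimp only at h
  have h0 : i = j := by rw [← consPerm_zero i σ, h, consPerm_zero]
  subst h0
  congr 1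
  ext1 k
  have := congrArg (fun ρ : Equiv.Perm (Fin (n + 1)) => ρ k.succ) h
  simpa [consPerm_succ] using this

theorem inversions_eq_sum {n : ℕ} (σ : Equiv.Perm (Fin n)) :
    inversions σ = ∑ a, ∑ b, if a < b ∧ σ b < σ a then 1 else 0 := by
  unfold inversions
  rw [Finset.card_filter, ← Finset.univ_product_univ, Finset.sum_product]

theorem inversions_consPerm {n : ℕ} (i : Fin (n + 1)) (σ : Equiv.Perm (Fin n)) :
    inversions (consPerm i σ) = i + inversions σ := by
  rw [inversions_eq_sum, inversions_eq_sum, Fin.sum_univ_succ]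
  congr 1
  · rw [Fin.sum_univ_succ]
    simp only [consPerm_zero, consPerm_succ, Fin.succ_pos, true_and, lt_irrefl, false_and,
      if_false, zero_add]
    rw [Equiv.sum_comp σ fun j => if i.succAbove j < i then 1 else 0]
    simp only [Fin.succAbove_lt_iff_castSucc_lt]
    rw [← Finset.card_filter]
    have := Fin.card_filter_val_lt (n := n) (m := i)
    rw [min_eq_right (Nat.lt_succ_iff.1 i.2)] at this
    simpa [Fin.lt_def] using this
  · refine Finset.sum_congr rfl fun a _ => ?_
    rw [Fin.sum_univ_succ]
    simp [consPerm_succ, consPerm_zero, Fin.succAbove_lt_succAbove_iff]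

theorem wordInner_cons (q : ℝ) {n : ℕ} (e : H) (u : Fin n → H) (v : Fin (n + 1) → H) :
    wordInner q (Fin.cons e u : Fin (n + 1) → H) v =
      ∑ i : Fin (n + 1), q ^ (i : ℕ) * ⟪e, v i⟫_ℝ * wordInner q u (i.removeNth v) := by
  unfold wordInner
  rw [← (Equiv.ofBijective _ (consPerm_bijective n)).sum_comp, Fintype.sum_prod_type]
  refine Finset.sum_congr rfl fun i _ => ?_
  rw [Finset.mul_sum]
  refine Finset.sum_congr rfl fun σ _ => ?_
  simp only [Equiv.ofBijective_apply, inversions_consPerm, Fin.prod_univ_succ, consPerm_zero,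
    consPerm_succ, Fin.cons_zero, Fin.cons_succ, Fin.removeNth_apply, pow_add]
  ring

/-- The sesquilinear extension of the `q`-deformed inner product to formal complex linear
combinations of simple tensors (conjugate-linear in the first variable). -/
noncomputable def preInner (q : ℝ) (x y : ((n : ℕ) × (Fin n → H)) →₀ ℂ) : ℂ :=
  x.sum fun u a => y.sum fun v b => conj a * b * (kernel q u v : ℂ)

theorem preInner_self_nonneg {q : ℝ} (hq : q ∈ Set.Icc (-1 : ℝ) 1)
    (x : ((n : ℕ) × (Fin n → H)) →₀ ℂ) : 0 ≤ (preInner q x x).re := by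
  have h := psd_kernel (H := H) hq
  have h3 := add_nonneg (h.2 x.support fun u => (x u).re) (h.2 x.support fun u => (x u).im)
  simp only [← Finset.sum_add_distrib] at h3
  refine h3.trans_eq ?_
  simp only [preInner, Finsupp.sum, Complex.re_sum]
  refine Finset.sum_congr rfl fun u _ => Finset.sum_congr rfl fun v _ => ?_
  simp
  ring

theorem conj_preInner (q : ℝ) (x y : ((n : ℕ) × (Fin n → H)) →₀ ℂ) :
    conj (preInner q y x) = preInner q x y := by
  simp only [preInner, Finsupp.sum, map_sum, map_mul, Complex.conj_conj, Complex.conj_ofReal]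
  rw [Finset.sum_comm]
  refine Finset.sum_congr rfl fun u _ => Finset.sum_congr rfl fun v _ => ?_
  rw [kernel_comm]
  ring

theorem preInner_add_left (q : ℝ) (x y z : ((n : ℕ) × (Fin n → H)) →₀ ℂ) :
    preInner q (x + y) z = preInner q x z + preInner q y z := by
  unfold preInner
  refine Finsupp.sum_add_index' (by simp) fun u a b => ?_
  rw [← Finsupp.sum_add]
  simp only [map_add, add_mul]

theorem preInner_smul_left (q : ℝ) (r : ℂ) (x y : ((n : ℕ) × (Fin n → H)) →₀ ℂ) :
    preInner q (r • x) y = conj r * preInner q x y := by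
  unfold preInner
  rw [Finsupp.sum_smul_index (by simp)]
  simp only [Finsupp.mul_sum, map_mul, mul_assoc]

end Words

section Fock

variable (q : Set.Ioo (-1 : ℝ) 1) (H : Type*)

/-- Formal complex linear combinations of words (simple tensors) with letters in `H`, to be equipped
with the `q`-deformed inner product. Words with letters in the real Hilbert space span the algebraic
tensor powers of its complexification, and the multilinearity relations between simple tensors hold
up to vectors of seminorm zero, so the Hausdorff completion is the `q`-Fock space. -/
def PreFock (_ : Set.Ioo (-1 : ℝ) 1) (H : Type*) : Type _ := ((n : ℕ) × (Fin n → H)) →₀ ℂ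

noncomputable instance : AddCommGroup (PreFock q H) :=
  inferInstanceAs (AddCommGroup (((n : ℕ) × (Fin n → H)) →₀ ℂ))

noncomputable instance : Module ℂ (PreFock q H) :=
  inferInstanceAs (Module ℂ (((n : ℕ) × (Fin n → H)) →₀ ℂ))

variable {H}

/-- The simple tensor `w₁ ⊗ ⋯ ⊗ wₙ`; for `n = 0` it is the vacuum. -/
noncomputable def word {n : ℕ} (w : Fin n → H) : PreFock q H := Finsupp.single ⟨n, w⟩ 1

variable {q} in
theorem PreFock.induction {p : PreFock q H → Prop} (x : PreFock q H) (h0 : p 0)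
    (hadd : ∀ x y, p x → p y → p (x + y))
    (hword : ∀ (n : ℕ) (w : Fin n → H) (a : ℂ), p (a • word q w)) : p x := by
  refine Finsupp.induction_linear (motive := p) x h0 hadd fun u a => ?_
  have := hword u.1 u.2 a
  have h2 : a • word q u.2 = (Finsupp.single u a : ((n : ℕ) × (Fin n → H)) →₀ ℂ) := by
    refine (Finsupp.smul_single _ _ _).trans ?_
    simp
  rwa [h2] at this

/-- The left creation operator `u₁ ⊗ ⋯ ⊗ uₙ ↦ e ⊗ u₁ ⊗ ⋯ ⊗ uₙ` on the span of the words. -/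
noncomputable def preCreation (e : H) : PreFock q H →ₗ[ℂ] PreFock q H :=
  Finsupp.lmapDomain ℂ ℂ fun u => ⟨u.1 + 1, Fin.cons e u.2⟩

theorem preCreation_word (e : H) {n : ℕ} (w : Fin n → H) :
    preCreation q e (word q w) = word q (Fin.cons e w : Fin (n + 1) → H) := by
  unfold preCreation word
  exact Finsupp.mapDomain_single

variable [NormedAddCommGroup H] [InnerProductSpace ℝ H]

/-- The `q`-deformed (semi-)inner product. -/
noncomputable abbrev fockCore : PreInnerProductSpace.Core ℂ (PreFock q H) where
  inner := preInner q
  conj_inner_symm x y := conj_preInner _ x y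
  re_inner_nonneg x := preInner_self_nonneg (Set.Ioo_subset_Icc_self q.2) x
  add_left x y z := preInner_add_left _ x y z
  smul_left x y r := preInner_smul_left _ r x y

noncomputable instance : SeminormedAddCommGroup (PreFock q H) :=
  InnerProductSpace.Core.toSeminormedAddCommGroup (c := fockCore q)

noncomputable instance : InnerProductSpace ℂ (PreFock q H) :=
  InnerProductSpace.ofCore (fockCore q)

theorem inner_word {n m : ℕ} (u : Fin n → H) (v : Fin m → H) :
    ⟪word q u, word q v⟫_ℂ = (kernel (q : ℝ) ⟨n, u⟩ ⟨m, v⟩ : ℂ) := by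
  change preInner q _ _ = _
  simp [preInner, word]

/-- The left annihilation operator
`u₁ ⊗ ⋯ ⊗ uₙ ↦ ∑_i q^(i-1) ⟨e, u_i⟩ u₁ ⊗ ⋯ û_i ⋯ ⊗ uₙ` on the span of the words. -/
noncomputable def preAnnihilation (e : H) : PreFock q H →ₗ[ℂ] PreFock q H :=
  Finsupp.linearCombination ℂ fun u : (n : ℕ) × (Fin n → H) =>
    match u with
    | ⟨0, _⟩ => (0 : PreFock q H)
    | ⟨n + 1, w⟩ => ∑ i : Fin (n + 1), (((q : ℝ) ^ (i : ℕ) * ⟪e, w i⟫_ℝ : ℝ) : ℂ) • word q (i.removeNth w)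

theorem preAnnihilation_word_zero (e : H) (w : Fin 0 → H) :
    preAnnihilation q e (word q w) = 0 := by
  unfold preAnnihilation word
  exact (Finsupp.linearCombination_single ..).trans (one_smul _ _)

theorem preAnnihilation_word_succ (e : H) {n : ℕ} (w : Fin (n + 1) → H) :
    preAnnihilation q e (word q w) =
      ∑ i : Fin (n + 1), (((q : ℝ) ^ (i : ℕ) * ⟪e, w i⟫_ℝ : ℝ) : ℂ) • word q (i.removeNth w) := by
  unfold preAnnihilation word
  exact (Finsupp.linearCombination_single ..).trans (one_smul _ _)

theorem inner_preCreation (e : H) (x y : PreFock q H) :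
    ⟪preCreation q e x, y⟫_ℂ = ⟪x, preAnnihilation q e y⟫_ℂ := by
  induction x using PreFock.induction with
  | h0 => simp
  | hadd x x' hx hx' => simp only [map_add, inner_add_left, hx, hx']
  | hword n u a =>
    induction y using PreFock.induction with
    | h0 => simp
    | hadd y y' hy hy' => simp only [map_add, inner_add_right, hy, hy']
    | hword m v b =>
      simp only [map_smul, inner_smul_left, inner_smul_right, preCreation_word]
      congr 2
      cases m with
      | zero => simp [inner_word, preAnnihilation_word_zero, kernel]
      | succ m =>
        simp only [preAnnihilation_word_succ, inner_sum, inner_smul_right, inner_word]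
        by_cases h : n = m
        · subst h
          simp only [kernel_mk, wordInner_cons]
          push_cast
          rfl
        · simp [kernel, h]

theorem preAnnihilation_preCreation (e : H) (x : PreFock q H) :
    preAnnihilation q e (preCreation q e x) =
      ((q : ℝ) : ℂ) • preCreation q e (preAnnihilation q e x) + ((‖e‖ ^ 2 : ℝ) : ℂ) • x := by
  induction x using PreFock.induction with
  | h0 => simp
  | hadd x y hx hy => simp only [map_add, hx, hy, smul_add]; abel
  | hword n w a =>
    simp only [map_smul, preCreation_word, preAnnihilation_word_succ]
    rw [smul_comm _ a, smul_comm _ a, ← smul_add]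
    congr 1
    rw [Fin.sum_univ_succ, add_comm]
    congr 1
    · cases n with
      | zero => simp [preAnnihilation_word_zero]
      | succ n =>
        simp only [preAnnihilation_word_succ, map_sum, map_smul, Finset.smul_sum, smul_smul,
          preCreation_word]
        refine Finset.sum_congr rfl fun i _ => ?_
        congr 1
        · simp [pow_succ]; ring
        · congr 1
          ext k
          refine Fin.cases ?_ (fun k => ?_) k <;> simp [Fin.removeNth_apply]
    · simp

theorem norm_preCreation_sq (e : H) (x : PreFock q H) :
    ‖preCreation q e x‖ ^ 2 = (q : ℝ) * ‖preAnnihilation q e x‖ ^ 2 + ‖e‖ ^ 2 * ‖x‖ ^ 2 := by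
  have h : ⟪preCreation q e x, preCreation q e x⟫_ℂ =
      ((q : ℝ) : ℂ) * ⟪preAnnihilation q e x, preAnnihilation q e x⟫_ℂ +
        ((‖e‖ ^ 2 : ℝ) : ℂ) * ⟪x, x⟫_ℂ := by
    rw [inner_preCreation, preAnnihilation_preCreation, inner_add_right, inner_smul_right,
      inner_smul_right, ← inner_conj_symm x (preCreation q e _), inner_preCreation,
      inner_conj_symm]
  simp only [inner_self_eq_norm_sq_to_K] at h
  refine Complex.ofReal_injective ?_
  push_cast
  simpa using h

theorem preAnnihilation_mem_span (e : H) (n : ℕ) {x : PreFock q H}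
    (hx : x ∈ Submodule.span ℂ {x | ∃ m < n + 1, ∃ w : Fin m → H, word q w = x}) :
    preAnnihilation q e x ∈ Submodule.span ℂ {x | ∃ m < n, ∃ w : Fin m → H, word q w = x} := by
  induction hx using Submodule.span_induction with
  | zero => simp
  | add x y _ _ hx hy => rw [map_add]; exact add_mem hx hy
  | smul a x _ hx => rw [map_smul]; exact Submodule.smul_mem _ _ hx
  | mem x hx =>
    obtain ⟨m, hm, w, rfl⟩ := hx
    cases m with
    | zero => simp [preAnnihilation_word_zero]
    | succ m =>
      rw [preAnnihilation_word_succ]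
      exact sum_mem fun i _ => Submodule.smul_mem _ _
        (Submodule.subset_span ⟨m, by omega, _, rfl⟩)

theorem norm_preCreation_sq_le (e : H) (x : PreFock q H) :
    ‖preCreation q e x‖ ^ 2 ≤ ‖e‖ ^ 2 / (1 - |(q : ℝ)|) * ‖x‖ ^ 2 := by
  have hq : 0 < 1 - |(q : ℝ)| := by
    have := abs_lt.2 q.2
    linarith
  set C := ‖e‖ ^ 2 / (1 - |(q : ℝ)|) with hC
  have hC0 : 0 ≤ C := by positivity
  have hCe : ‖e‖ ^ 2 = C * (1 - |(q : ℝ)|) := by rw [hC]; field_simp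
  rcases le_or_gt (q : ℝ) 0 with h0 | h0
  · rw [norm_preCreation_sq, hCe, abs_of_nonpos h0]
    have h1 : 0 ≤ C * ‖x‖ ^ 2 := by positivity
    have h2 : (q : ℝ) * ‖preAnnihilation q e x‖ ^ 2 ≤ 0 :=
      mul_nonpos_of_nonpos_of_nonneg h0 (by positivity)
    nlinarith
  · have key : ∀ (n : ℕ) (x : PreFock q H),
        x ∈ Submodule.span ℂ {x | ∃ m < n, ∃ w : Fin m → H, word q w = x} →
        ‖preCreation q e x‖ ^ 2 ≤ C * ‖x‖ ^ 2 := by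
      intro n
      induction n with
      | zero =>
        intro x hx
        have : x = 0 := by simpa using hx
        simp [this]
      | succ n ih =>
        intro x hx
        have h1 := ih _ (preAnnihilation_mem_span q e n hx)
        set y := preAnnihilation q e x with hy
        have h2 : ‖y‖ ^ 2 ≤ ‖preCreation q e y‖ * ‖x‖ := by
          have h3 : ⟪preCreation q e y, x⟫_ℂ = ⟪y, y⟫_ℂ := by rw [inner_preCreation]
          have h4 := norm_inner_le_norm (𝕜 := ℂ) (preCreation q e y) x
          rw [h3] at h4
          simpa [inner_self_eq_norm_sq_to_K] using h4
        have h5 : ‖y‖ ^ 2 ≤ C * ‖x‖ ^ 2 := by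
          have h6 : (‖y‖ ^ 2) ^ 2 ≤ (C * ‖y‖ ^ 2) * ‖x‖ ^ 2 := by
            calc (‖y‖ ^ 2) ^ 2 ≤ (‖preCreation q e y‖ * ‖x‖) ^ 2 := by gcongr
              _ = ‖preCreation q e y‖ ^ 2 * ‖x‖ ^ 2 := by ring
              _ ≤ _ := by gcongr
          rcases (sq_nonneg ‖y‖).eq_or_lt with h7 | h7
          · rw [← h7]; positivity
          · refine le_of_mul_le_mul_left ?_ h7
            nlinarith
        rw [norm_preCreation_sq, hCe, abs_of_pos h0]
        nlinarith
    have hx : ∃ n, x ∈ Submodule.span ℂ {x | ∃ m < n, ∃ w : Fin m → H, word q w = x} := by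
      induction x using PreFock.induction with
      | h0 => exact ⟨0, zero_mem _⟩
      | hadd x y hx hy =>
        obtain ⟨n, hn⟩ := hx
        obtain ⟨m, hm⟩ := hy
        refine ⟨max n m, add_mem ?_ ?_⟩
        · refine Submodule.span_mono ?_ hn
          rintro _ ⟨k, hk, w, rfl⟩
          exact ⟨k, by omega, w, rfl⟩
        · refine Submodule.span_mono ?_ hm
          rintro _ ⟨k, hk, w, rfl⟩
          exact ⟨k, by omega, w, rfl⟩
      | hword n w a =>
        exact ⟨n + 1, Submodule.smul_mem _ _ (Submodule.subset_span ⟨n, by omega, w, rfl⟩)⟩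
    obtain ⟨n, hn⟩ := hx
    exact key n x hn

theorem norm_preCreation_le (e : H) (x : PreFock q H) :
    ‖preCreation q e x‖ ≤ √(‖e‖ ^ 2 / (1 - |(q : ℝ)|)) * ‖x‖ := by
  have hq : 0 < 1 - |(q : ℝ)| := by
    have := abs_lt.2 q.2
    linarith
  refine le_of_sq_le_sq ?_ (by positivity)
  rw [mul_pow, Real.sq_sqrt (by positivity)]
  exact norm_preCreation_sq_le q e x

variable (H) in
/-- The `q`-deformed Fock space of the real Hilbert space `H`. -/
abbrev FockSpace : Type _ := UniformSpace.Completion (PreFock q H)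

variable (H) in
/-- The vacuum vector `Ω`; the trace of the `q`-Gaussian algebra is `x ↦ ⟨Ω, x Ω⟩`, so
that `‖x‖₂ = ‖x Ω‖` and `⟨x, y⟩ = τ(x* y) = ⟨x Ω, y Ω⟩`. -/
noncomputable def vacuum : FockSpace q H := (word q (Fin.elim0 : Fin 0 → H) : PreFock q H)

/-- The left creation operator `c(e)`, extended by continuity to the `q`-Fock space. -/
noncomputable def creation (e : H) : FockSpace q H →L[ℂ] FockSpace q H :=
  ((preCreation q e).mkContinuous _ (norm_preCreation_le q e)).completion

/-- The left annihilation operator `a(e) = c(e)*`. -/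
noncomputable def annihilation (e : H) : FockSpace q H →L[ℂ] FockSpace q H :=
  ContinuousLinearMap.adjoint (creation q e)

/-- The `q`-Gaussian element `s(e) = c(e) + a(e)`. -/
noncomputable def gaussian (e : H) : FockSpace q H →L[ℂ] FockSpace q H :=
  creation q e + annihilation q e

end Fock

section VonNeumann

variable {K : Type*} [NormedAddCommGroup K] [InnerProductSpace ℂ K] [CompleteSpace K]

/-- The commutant of `S ∪ S*`, as a von Neumann algebra. -/
noncomputable def commutantOf (S : Set (K →L[ℂ] K)) : VonNeumannAlgebra K where
  toStarSubalgebra := StarSubalgebra.centralizer ℂ S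
  centralizer_centralizer' := by simp

/-- The von Neumann algebra `(S ∪ S*)''` generated by a set `S` of operators. -/
noncomputable def generatedBy (S : Set (K →L[ℂ] K)) : VonNeumannAlgebra K :=
  (commutantOf S).commutant

/-- A von Neumann algebra is diffuse if it has no minimal projections: every nonzero projection `p`
in it has a subprojection in it other than `0` and `p`. -/
def IsDiffuse (C : VonNeumannAlgebra K) : Prop :=
  ∀ p ∈ C, IsStarProjection p → p ≠ 0 →
    ∃ r ∈ C, IsStarProjection r ∧ p * r = r ∧ r ≠ 0 ∧ r ≠ p

/-- `N ⊖ B`: the elements of `N` that are orthogonal to `B` for the inner product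
`⟨x, y⟩ = τ(x* y) = ⟨x Ω, y Ω⟩` given by the trace vector `Ω`. -/
def orthogonalIn (Ω : K) (N B : VonNeumannAlgebra K) : Set (K →L[ℂ] K) :=
  {a | a ∈ N ∧ ∀ b ∈ B, ⟪b Ω, a Ω⟫_ℂ = 0}

/-- The operator-norm bounded sequences in `N`. The tracial ultrapower `N^ω` is the quotient of this
*-algebra by the sequences with `lim_ω ‖x_n‖₂ = 0`; an element of `N^ω` is given by a bounded
sequence representing it. -/
def boundedSeq (N : VonNeumannAlgebra K) : Set (ℕ → K →L[ℂ] K) :=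
  {x | (∀ n, x n ∈ N) ∧ ∃ R : ℝ, ∀ n, ‖x n‖ ≤ R}

/-- Two sequences represent the same element of the ultrapower: `lim_ω ‖x_n - y_n‖₂ = 0`. -/
def UltraEq (ω : Ultrafilter ℕ) (Ω : K) (x y : ℕ → K →L[ℂ] K) : Prop :=
  Filter.Tendsto (fun n => ‖(x n - y n) Ω‖) ω (𝓝 0)

/-- Orthogonality in the ultrapower: `τ_ω(x* y) = lim_ω τ(x_n* y_n) = 0`. -/
def UltraOrthogonal (ω : Ultrafilter ℕ) (Ω : K) (x y : ℕ → K →L[ℂ] K) : Prop :=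
  Filter.Tendsto (fun n => ⟪x n Ω, y n Ω⟫_ℂ) ω (𝓝 0)

/-- `N^ω ⊖ B^ω`, in terms of representing sequences. -/
def ultraOrthogonalIn (ω : Ultrafilter ℕ) (Ω : K) (N B : VonNeumannAlgebra K) :
    Set (ℕ → K →L[ℂ] K) :=
  {x | x ∈ boundedSeq N ∧ ∀ y ∈ boundedSeq B, UltraOrthogonal ω Ω y x}

/-- `N^ω ∩ C'`, in terms of representing sequences: `c x = x c` in `N^ω` for every `c ∈ C`. -/
def ultraRelativeCommutant (ω : Ultrafilter ℕ) (Ω : K) (N C : VonNeumannAlgebra K) :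
    Set (ℕ → K →L[ℂ] K) :=
  {x | x ∈ boundedSeq N ∧ ∀ c ∈ C, UltraEq ω Ω (fun n => c * x n) (fun n => x n * c)}

/-- The strong asymptotic orthogonality property of an inclusion `B ⊆ N` of finite von Neumann
algebras, the trace of `N` being the vector state of `Ω`: for every diffuse von Neumann subalgebra
`C` of `B`, all `a, b ∈ N ⊖ B` and all `x ∈ (N^ω ⊖ B^ω) ∩ C'` one has `a x ⊥ x b`. -/
def StrongAOP (ω : Ultrafilter ℕ) (Ω : K) (N B : VonNeumannAlgebra K) : Prop :=
  ∀ C : VonNeumannAlgebra K, C ≤ B → IsDiffuse C →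
    ∀ a ∈ orthogonalIn Ω N B, ∀ b ∈ orthogonalIn Ω N B,
      ∀ x ∈ ultraOrthogonalIn ω Ω N B ∩ ultraRelativeCommutant ω Ω N C,
        UltraOrthogonal ω Ω (fun n => a * x n) (fun n => x n * b)

end VonNeumann

section Algebra

variable (q : Set.Ioo (-1 : ℝ) 1) {H : Type*} [NormedAddCommGroup H] [InnerProductSpace ℝ H]

/-- The von Neumann algebra `Γ_q(V)` on the `q`-Fock space of `H` generated by the `s(ξ)` with `ξ` in
the subspace `V` of `H`. For `V = ⊤` it is the `q`-Gaussian algebra of `H`, and for `V = ℝ e` it is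
the generator subalgebra. -/
noncomputable def gaussianAlgebra (V : Submodule ℝ H) : VonNeumannAlgebra (FockSpace q H) :=
  generatedBy (gaussian q '' (V : Set H))

end Algebra

end QGaussian

/-!
Write `c(h)`, `a(h)` for creation and annihilation by `h`, put `c = c(e)`, `a = a(e)`, and let
`ξ n = x n Ω` for a bounded sequence `x` in `M` which is orthogonal to `A` and asymptotically
commutes with `C`.  The argument runs through the position of the letters `e` in `ξ n`.

*Tensors which start with a letter orthogonal to `e`.*  Let `X` be their closed span and `Q` the
projection onto it.  For an orthonormal family `f`, the row `(c (f i))` is bounded above and below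
by absolute constants when `|q|` is small (`norm_row_sq_le`, `sum_norm_sq_le_norm_row_sq`); since
`a c(f i) = q c(f i) a`, the operator `a` maps `X` into itself with norm `O(|q|)`.  Expanding
`u ∈ A` in the Wick words of `e`, the compression of `u` to `X` is therefore bounded by a multiple
of the *2-norm* of `u`, not just by its operator norm (`norm_inner_le_of_mem_gaussianAlgebra`).

*Diffuseness.*  In a diffuse algebra the unit is a finite sum of projections `p i` of small
2-norm.  If `x n` asymptotically commutes with them, then `‖Q (ξ n)‖² = ∑ i, ‖Q x n p i Ω‖²` up to
a null sequence is `∑ i, ‖Q p i ξ n‖²`, which the compression bound makes small.  Hence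
`Q ξ n → 0` (`tendsto_startProj`).  Applied to the sequences `s(e) ^ j * x n`, this yields
`Q (a ^ j ξ n) → 0` for all `j`, so that together with the orthogonality to `A` the sequence `ξ` is
*deep* (`IsDeep`, `isDeep_of_commute`): up to null sequences, `ξ n` consists of tensors which start
with any prescribed number of letters `e`.

*Deep sequences.* The operator `K = q ^ N`, with `N` the length of tensors, satisfies
`a K = q K a`, so it tends to zero along a deep sequence (`IsDeep.numberOp`). It is also the commutator of
`a(g)` and the right-handed `q`-Gaussian element of `h`, up to the factor `⟪g, h⟫`
(`annihilation_mul_rightGaussian`). Hence deep sequences are preserved by the polynomials in the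
right-handed `q`-Gaussians (`IsDeep.flipConj`), which commute with `M`. A Wick word with a letter
orthogonal to `e` is a combination of normally ordered products of creators and annihilators. Such
a product has either an annihilator by a letter orthogonal to `e`, which sees only `Q (a ^ j ξ n)`,
or a creator by such a letter, whose adjoint does the same on the other side of the inner product.
Therefore `⟪V ξ n, R ξ n⟫ → 0` for such a Wick word `V` and a polynomial `R` in the right-handed
`q`-Gaussians (`IsDeep.inner_wick`).

*Conclusion.*  The vectors of `M ⊖ A` are limits of combinations of Wick words of this kind
(`mem_closure_mixed`).  Since the vacuum is tracial, `‖y x Ω‖ ≤ ‖x‖ ‖y Ω‖` for `x, y ∈ M`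
(`norm_mul_vacuum_le`), and the convergence extends from the Wick words to all `a, b ∈ M ⊖ A`.
-/

namespace QGaussian

open scoped InnerProductSpace ComplexConjugate Topology

open Filter

/-! ### Creation and annihilation operators on the completed Fock space -/

section Operators

variable (q : Set.Ioo (-1 : ℝ) 1) {H : Type*} [NormedAddCommGroup H] [InnerProductSpace ℝ H]

theorem creation_coe (h : H) (x : PreFock q H) :
    creation q h (x : FockSpace q H) = (preCreation q h x : PreFock q H) :=
  ContinuousLinearMap.completion_apply_coe _ _

theorem inner_creation_left (h : H) (x y : FockSpace q H) :
    ⟪creation q h x, y⟫_ℂ = ⟪x, annihilation q h y⟫_ℂ := by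
  rw [annihilation, ContinuousLinearMap.adjoint_inner_right]

theorem inner_annihilation_left (h : H) (x y : FockSpace q H) :
    ⟪annihilation q h x, y⟫_ℂ = ⟪x, creation q h y⟫_ℂ := by
  rw [annihilation, ContinuousLinearMap.adjoint_inner_left]

theorem star_creation (h : H) : star (creation q h) = annihilation q h := rfl

theorem star_annihilation (h : H) : star (annihilation q h) = creation q h := by
  rw [← star_creation, star_star]

theorem star_gaussian (h : H) : star (gaussian q h) = gaussian q h := by
  rw [gaussian, star_add, star_creation, star_annihilation, add_comm]

variable {q} in
theorem FockSpace.ext_inner {x y : FockSpace q H}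
    (h : ∀ z : PreFock q H, ⟪(z : FockSpace q H), x⟫_ℂ = ⟪(z : FockSpace q H), y⟫_ℂ) : x = y := by
  refine ext_inner_left ℂ fun z => ?_
  induction z using UniformSpace.Completion.induction_on with
  | hp => exact isClosed_eq (by fun_prop) (by fun_prop)
  | ih z => exact h z

variable {q} in
theorem FockSpace.ext_coe {S T : FockSpace q H →L[ℂ] FockSpace q H}
    (h : ∀ x : PreFock q H, S (x : FockSpace q H) = T (x : FockSpace q H)) : S = T :=
  ContinuousLinearMap.coeFn_injective
    (UniformSpace.Completion.ext S.continuous T.continuous h)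

theorem annihilation_coe (h : H) (x : PreFock q H) :
    annihilation q h (x : FockSpace q H) = (preAnnihilation q h x : PreFock q H) := by
  refine FockSpace.ext_inner fun z => ?_
  rw [← inner_creation_left, creation_coe, UniformSpace.Completion.inner_coe,
    UniformSpace.Completion.inner_coe, inner_preCreation]

/-- The `q`-canonical commutation relation on the algebraic Fock space: the annihilation operator
either contracts with the new first letter or passes it, which costs one inversion. -/
theorem preAnnihilation_preCreation_apply (g e : H) (x : PreFock q H) :
    preAnnihilation q g (preCreation q e x) =
      ((q : ℝ) : ℂ) • preCreation q e (preAnnihilation q g x) + (⟪g, e⟫_ℝ : ℂ) • x := by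
  induction x using PreFock.induction with
  | h0 => simp
  | hadd x y hx hy => simp only [map_add, hx, hy, smul_add]; abel
  | hword n w a =>
    simp only [map_smul, preCreation_word, preAnnihilation_word_succ]
    rw [smul_comm _ a, smul_comm _ a, ← smul_add]
    congr 1
    rw [Fin.sum_univ_succ, add_comm]
    congr 1
    · cases n with
      | zero => simp [preAnnihilation_word_zero]
      | succ n =>
        simp only [preAnnihilation_word_succ, map_sum, map_smul, Finset.smul_sum, smul_smul,
          preCreation_word]
        refine Finset.sum_congr rfl fun i _ => ?_
        congr 1
        · simp [pow_succ]; ring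
        · congr 1
          ext k
          refine Fin.cases ?_ (fun k => ?_) k <;> simp [Fin.removeNth_apply]
    · simp

/-- The `q`-canonical commutation relation. -/
theorem annihilation_mul_creation (g h : H) :
    annihilation q g * creation q h =
      ((q : ℝ) : ℂ) • (creation q h * annihilation q g) +
        ((⟪g, h⟫_ℝ : ℝ) : ℂ) • (1 : FockSpace q H →L[ℂ] FockSpace q H) := by
  refine FockSpace.ext_coe fun x => ?_
  simp only [mul_apply_eq_comp, add_apply, smul_apply, one_apply_eq_self, creation_coe,
    annihilation_coe, preAnnihilation_preCreation_apply, UniformSpace.Completion.coe_add,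
    UniformSpace.Completion.coe_smul]

theorem annihilation_creation_apply (g h : H) (x : FockSpace q H) :
    annihilation q g (creation q h x) =
      ((q : ℝ) : ℂ) • creation q h (annihilation q g x) + ((⟪g, h⟫_ℝ : ℝ) : ℂ) • x :=
  congrArg (fun T : FockSpace q H →L[ℂ] FockSpace q H => T x) (annihilation_mul_creation q g h)

theorem annihilation_vacuum (h : H) : annihilation q h (vacuum q H) = 0 := by
  rw [vacuum, annihilation_coe, preAnnihilation_word_zero, UniformSpace.Completion.coe_zero]

theorem norm_vacuum : ‖vacuum q H‖ = 1 := by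
  have h : ⟪vacuum q H, vacuum q H⟫_ℂ = 1 := by
    rw [vacuum, UniformSpace.Completion.inner_coe, inner_word, kernel_mk]
    simp [wordInner, inversions]
  have h2 : ‖vacuum q H‖ ^ 2 = 1 := by
    rw [@norm_sq_eq_re_inner ℂ, h]; simp
  nlinarith [norm_nonneg (vacuum q H)]

theorem norm_creation_le (h : H) : ‖creation q h‖ ≤ √(‖h‖ ^ 2 / (1 - |(q : ℝ)|)) := by
  refine ContinuousLinearMap.opNorm_le_bound _ (by positivity) fun x => ?_
  induction x using UniformSpace.Completion.induction_on with
  | hp => exact isClosed_le (by fun_prop) (by fun_prop)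
  | ih x =>
    rw [creation_coe, UniformSpace.Completion.norm_coe, UniformSpace.Completion.norm_coe]
    exact norm_preCreation_le q h x

theorem norm_annihilation (h : H) : ‖annihilation q h‖ = ‖creation q h‖ := by
  exact LinearIsometryEquiv.norm_map ContinuousLinearMap.adjoint (creation q h)

theorem preAnnihilation_add (g h : H) (x : PreFock q H) :
    preAnnihilation q (g + h) x = preAnnihilation q g x + preAnnihilation q h x := by
  induction x using PreFock.induction with
  | h0 => simp
  | hadd x y hx hy => simp only [map_add, hx, hy]; abel
  | hword n w a =>
    simp only [map_smul, ← smul_add]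
    congr 1
    cases n with
    | zero => simp [preAnnihilation_word_zero]
    | succ n =>
      simp only [preAnnihilation_word_succ, ← Finset.sum_add_distrib, ← add_smul]
      refine Finset.sum_congr rfl fun i _ => ?_
      rw [inner_add_left, mul_add]; push_cast; rfl

theorem preAnnihilation_smul (r : ℝ) (h : H) (x : PreFock q H) :
    preAnnihilation q (r • h) x = (r : ℂ) • preAnnihilation q h x := by
  induction x using PreFock.induction with
  | h0 => simp
  | hadd x y hx hy => simp only [map_add, hx, hy, smul_add]
  | hword n w a =>
    simp only [map_smul]
    rw [smul_comm _ a]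
    congr 1
    cases n with
    | zero => simp [preAnnihilation_word_zero]
    | succ n =>
      simp only [preAnnihilation_word_succ, Finset.smul_sum, smul_smul]
      refine Finset.sum_congr rfl fun i _ => ?_
      rw [real_inner_smul_left]
      congr 1
      push_cast; ring

theorem annihilation_add (g h : H) :
    annihilation q (g + h) = annihilation q g + annihilation q h := by
  refine FockSpace.ext_coe fun x => ?_
  simp only [add_apply, annihilation_coe, preAnnihilation_add, UniformSpace.Completion.coe_add]

theorem annihilation_smul (r : ℝ) (h : H) :
    annihilation q (r • h) = (r : ℂ) • annihilation q h := by
  refine FockSpace.ext_coe fun x => ?_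
  simp only [smul_apply, annihilation_coe, preAnnihilation_smul, UniformSpace.Completion.coe_smul]

theorem creation_add (g h : H) : creation q (g + h) = creation q g + creation q h := by
  rw [← star_annihilation, annihilation_add, star_add, star_annihilation, star_annihilation]

theorem creation_smul (r : ℝ) (h : H) : creation q (r • h) = (r : ℂ) • creation q h := by
  rw [← star_annihilation, annihilation_smul, star_smul, star_annihilation]
  simp

theorem gaussian_smul (r : ℝ) (h : H) : gaussian q (r • h) = (r : ℂ) • gaussian q h := by
  rw [gaussian, gaussian, creation_smul, annihilation_smul, smul_add]

theorem gaussian_vacuum (h : H) : gaussian q h (vacuum q H) = creation q h (vacuum q H) := by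
  simp [gaussian, annihilation_vacuum]

/-- The product `c(h₁) ⋯ c(hₙ)`. -/
noncomputable def creationProd (l : List H) : FockSpace q H →L[ℂ] FockSpace q H :=
  (l.map (creation q)).prod

/-- The product `a(h₁) ⋯ a(hₙ)`. -/
noncomputable def annihilationProd (l : List H) : FockSpace q H →L[ℂ] FockSpace q H :=
  (l.map (annihilation q)).prod

@[simp] theorem creationProd_nil : creationProd q ([] : List H) = 1 := rfl

@[simp] theorem creationProd_cons (h : H) (l : List H) :
    creationProd q (h :: l) = creation q h * creationProd q l := by
  simp [creationProd]

@[simp] theorem annihilationProd_nil : annihilationProd q ([] : List H) = 1 := rfl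

@[simp] theorem annihilationProd_cons (h : H) (l : List H) :
    annihilationProd q (h :: l) = annihilation q h * annihilationProd q l := by
  simp [annihilationProd]

/-- The simple tensor `h₁ ⊗ ⋯ ⊗ hₙ`, as a vector of the completed Fock space. -/
noncomputable def tensor (l : List H) : FockSpace q H := creationProd q l (vacuum q H)

@[simp] theorem tensor_nil : tensor q ([] : List H) = vacuum q H := by simp [tensor]

@[simp] theorem tensor_cons (h : H) (l : List H) :
    tensor q (h :: l) = creation q h (tensor q l) := by simp [tensor]

theorem coe_word {n : ℕ} (w : Fin n → H) :
    ((word q w : PreFock q H) : FockSpace q H) = tensor q (List.ofFn w) := by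
  induction n with
  | zero => rw [List.ofFn_zero, tensor_nil, vacuum, Subsingleton.elim w]
  | succ n ih =>
    rw [List.ofFn_succ, tensor_cons, ← ih, creation_coe, preCreation_word]
    congr 2
    exact (Fin.cons_self_tail w).symm

/-- A closed subspace which contains all simple tensors is everything. -/
theorem mem_of_tensor_mem {S : Submodule ℂ (FockSpace q H)} (hS : IsClosed (S : Set (FockSpace q H)))
    (h : ∀ l, tensor q l ∈ S) (x : FockSpace q H) : x ∈ S := by
  induction x using UniformSpace.Completion.induction_on with
  | hp => exact hS
  | ih x =>
    induction x using PreFock.induction with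
    | h0 => rw [UniformSpace.Completion.coe_zero]; exact S.zero_mem
    | hadd x y hx hy => rw [UniformSpace.Completion.coe_add]; exact S.add_mem hx hy
    | hword n w a =>
      rw [UniformSpace.Completion.coe_smul, coe_word]
      exact S.smul_mem _ (h _)

theorem dense_span_tensor :
    Dense (Submodule.span ℂ (Set.range (tensor q : List H → FockSpace q H)) :
      Set (FockSpace q H)) := by
  rw [Submodule.dense_iff_topologicalClosure_eq_top, eq_top_iff]
  intro x _
  refine mem_of_tensor_mem q (Submodule.isClosed_topologicalClosure _) (fun l => ?_) x
  exact Submodule.le_topologicalClosure _ (Submodule.subset_span (Set.mem_range_self l))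

theorem ext_tensor {S T : FockSpace q H →L[ℂ] FockSpace q H}
    (h : ∀ l, S (tensor q l) = T (tensor q l)) : S = T := by
  ext x
  have := mem_of_tensor_mem q (S := LinearMap.ker ((S - T : FockSpace q H →L[ℂ] FockSpace q H) :
    FockSpace q H →ₗ[ℂ] FockSpace q H)) (ContinuousLinearMap.isClosed_ker (S - T))
    (fun l => by simp [h l]) x
  simpa [sub_eq_zero] using this

/-- An operator which kills the vacuum and commutes with the creation operators up to a scalar
vanishes. -/
theorem eq_zero_of_mul_creation {T : FockSpace q H →L[ℂ] FockSpace q H} (r : ℂ)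
    (hT : ∀ k : H, T * creation q k = r • (creation q k * T)) (h0 : T (vacuum q H) = 0) : T = 0 := by
  refine ext_tensor q fun l => ?_
  induction l with
  | nil => simpa using h0
  | cons k l ih =>
    rw [tensor_cons, ← mul_apply_eq_comp, hT]
    simp at ih
    simp [ih]

end Operators

/-! ### The right-handed operators -/

section Flip

section Reversal

variable (q : Set.Ioo (-1 : ℝ) 1) {H : Type*}

theorem reverse_ofFn {n : ℕ} (w : Fin n → H) :
    List.ofFn (fun i => w i.rev) = (List.ofFn w).reverse := by
  apply List.ext_getElem
  · simp
  · intro i h1 h2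
    simp only [List.getElem_ofFn, List.getElem_reverse]
    congr 1
    ext
    simp [Fin.rev]; omega

/-- The reversal of words, on the span of the words. -/
noncomputable def preFlip : PreFock q H →ₗ[ℂ] PreFock q H :=
  Finsupp.lmapDomain ℂ ℂ fun u => ⟨u.1, fun i => u.2 i.rev⟩

theorem preFlip_word {n : ℕ} (w : Fin n → H) :
    preFlip q (word q w) = word q (fun i => w i.rev) := by
  unfold preFlip word
  exact Finsupp.mapDomain_single

end Reversal

variable (q : Set.Ioo (-1 : ℝ) 1) {H : Type*} [NormedAddCommGroup H] [InnerProductSpace ℝ H]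

theorem inversions_rev {n : ℕ} (σ : Equiv.Perm (Fin n)) :
    inversions (Fin.revPerm * σ * Fin.revPerm) = inversions σ := by
  unfold inversions
  refine Finset.card_bij' (fun p _ => (p.2.rev, p.1.rev)) (fun p _ => (p.2.rev, p.1.rev))
    ?_ ?_ ?_ ?_
  all_goals simp +contextual

theorem wordInner_rev (q : ℝ) {n : ℕ} (u v : Fin n → H) :
    wordInner q (fun i => u i.rev) (fun i => v i.rev) = wordInner q u v := by
  unfold wordInner
  refine Fintype.sum_equiv ((Equiv.mulLeft Fin.revPerm).trans (Equiv.mulRight Fin.revPerm)) _ _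
    fun σ => ?_
  simp only [Equiv.trans_apply, Equiv.coe_mulLeft, Equiv.coe_mulRight, inversions_rev]
  congr 1
  exact Fintype.prod_equiv Fin.revPerm _ _ fun i => by simp

theorem kernel_rev (q : ℝ) (u v : (n : ℕ) × (Fin n → H)) :
    kernel q ⟨u.1, fun i => u.2 i.rev⟩ ⟨v.1, fun i => v.2 i.rev⟩ = kernel q u v := by
  obtain ⟨n, u⟩ := u
  obtain ⟨m, v⟩ := v
  by_cases h : n = m
  · subst h
    rw [kernel_mk, kernel_mk, wordInner_rev]
  · simp [kernel, h]

theorem inner_preFlip (x y : PreFock q H) : ⟪preFlip q x, preFlip q y⟫_ℂ = ⟪x, y⟫_ℂ := by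
  induction x using PreFock.induction with
  | h0 => simp
  | hadd x x' hx hx' => simp only [map_add, inner_add_left, hx, hx']
  | hword n u a =>
    induction y using PreFock.induction with
    | h0 => simp
    | hadd y y' hy hy' => simp only [map_add, inner_add_right, hy, hy']
    | hword m v b =>
      simp only [map_smul, inner_smul_left, inner_smul_right, preFlip_word, inner_word]
      rw [kernel_rev (q : ℝ) ⟨n, u⟩ ⟨m, v⟩]

theorem norm_preFlip_le (x : PreFock q H) : ‖preFlip q x‖ ≤ 1 * ‖x‖ := by
  rw [one_mul, @norm_eq_sqrt_re_inner ℂ, @norm_eq_sqrt_re_inner ℂ _ _ _ _ x, inner_preFlip]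

variable (H) in
/-- The unitary on the `q`-Fock space which reverses the order of the letters of a simple tensor. -/
noncomputable def flip : FockSpace q H →L[ℂ] FockSpace q H :=
  ((preFlip q).mkContinuous _ (norm_preFlip_le q)).completion

theorem flip_coe (x : PreFock q H) :
    flip q H (x : FockSpace q H) = (preFlip q x : PreFock q H) :=
  ContinuousLinearMap.completion_apply_coe _ _

theorem flip_tensor (l : List H) : flip q H (tensor q l) = tensor q l.reverse := by
  rw [← List.ofFn_get l, ← coe_word, flip_coe, preFlip_word, coe_word, reverse_ofFn]

theorem flip_mul_flip : flip q H * flip q H = 1 :=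
  ext_tensor q fun l => by simp [flip_tensor]

theorem flip_flip (x : FockSpace q H) : flip q H (flip q H x) = x :=
  congrArg (fun T : FockSpace q H →L[ℂ] FockSpace q H => T x) (flip_mul_flip q)

theorem inner_flip_flip (x y : FockSpace q H) : ⟪flip q H x, flip q H y⟫_ℂ = ⟪x, y⟫_ℂ := by
  induction x using UniformSpace.Completion.induction_on with
  | hp => exact isClosed_eq (by fun_prop) (by fun_prop)
  | ih x =>
    induction y using UniformSpace.Completion.induction_on with
    | hp => exact isClosed_eq (by fun_prop) (by fun_prop)
    | ih y =>
      rw [flip_coe, flip_coe, UniformSpace.Completion.inner_coe,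
        UniformSpace.Completion.inner_coe, inner_preFlip]

theorem star_flip : star (flip q H) = flip q H := by
  rw [ContinuousLinearMap.star_eq_adjoint, eq_comm, ContinuousLinearMap.eq_adjoint_iff]
  intro x y
  rw [← inner_flip_flip, flip_flip]

theorem flip_vacuum : flip q H (vacuum q H) = vacuum q H := by
  simpa using flip_tensor q ([] : List H)

variable (H) in
/-- Conjugation by the flip, which turns operators acting from the left into operators acting from
the right. -/
noncomputable def flipConj :
    (FockSpace q H →L[ℂ] FockSpace q H) →ₐ[ℂ] (FockSpace q H →L[ℂ] FockSpace q H) where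
  toFun T := flip q H * T * flip q H
  map_one' := by rw [mul_one, flip_mul_flip]
  map_mul' S T := by
    calc flip q H * (S * T) * flip q H = flip q H * S * 1 * T * flip q H := by
          simp only [mul_assoc, one_mul]
      _ = _ := by rw [← flip_mul_flip]; simp only [mul_assoc]
  map_zero' := by simp
  map_add' S T := by simp [mul_add, add_mul]
  commutes' r := by
    rw [← Algebra.commutes, mul_assoc, flip_mul_flip, mul_one]

theorem flipConj_apply (T : FockSpace q H →L[ℂ] FockSpace q H) :
    flipConj q H T = flip q H * T * flip q H := rfl

theorem star_flipConj (T : FockSpace q H →L[ℂ] FockSpace q H) :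
    star (flipConj q H T) = flipConj q H (star T) := by
  simp only [flipConj_apply, star_mul, star_flip, mul_assoc]

theorem flipConj_vacuum (T : FockSpace q H →L[ℂ] FockSpace q H) :
    flipConj q H T (vacuum q H) = flip q H (T (vacuum q H)) := by
  simp [flipConj_apply, flip_vacuum]

/-- The right creation operator. -/
noncomputable def rightCreation (h : H) : FockSpace q H →L[ℂ] FockSpace q H :=
  flipConj q H (creation q h)

/-- The right annihilation operator. -/
noncomputable def rightAnnihilation (h : H) : FockSpace q H →L[ℂ] FockSpace q H :=
  flipConj q H (annihilation q h)

/-- The right `q`-Gaussian element. -/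
noncomputable def rightGaussian (h : H) : FockSpace q H →L[ℂ] FockSpace q H :=
  flipConj q H (gaussian q h)

theorem rightGaussian_eq (h : H) :
    rightGaussian q h = rightCreation q h + rightAnnihilation q h := by
  simp only [rightGaussian, gaussian, rightCreation, rightAnnihilation, flipConj_apply, mul_add,
    add_mul]

theorem star_rightGaussian (h : H) : star (rightGaussian q h) = rightGaussian q h := by
  rw [rightGaussian, star_flipConj, star_gaussian]

theorem star_rightCreation (h : H) : star (rightCreation q h) = rightAnnihilation q h := by
  rw [rightCreation, star_flipConj, star_creation, rightAnnihilation]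

theorem rightCreation_tensor (h : H) (l : List H) :
    rightCreation q h (tensor q l) = tensor q (l ++ [h]) := by
  simp only [rightCreation, flipConj_apply, mul_apply_eq_comp, flip_tensor]
  rw [← tensor_cons, flip_tensor]
  simp

theorem rightAnnihilation_vacuum (h : H) : rightAnnihilation q h (vacuum q H) = 0 := by
  rw [rightAnnihilation, flipConj_vacuum, annihilation_vacuum, map_zero]

theorem rightCreation_vacuum (h : H) :
    rightCreation q h (vacuum q H) = creation q h (vacuum q H) := by
  have := rightCreation_tensor q h ([] : List H)
  simpa using this

theorem rightGaussian_vacuum (h : H) :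
    rightGaussian q h (vacuum q H) = gaussian q h (vacuum q H) := by
  rw [rightGaussian_eq, add_apply, rightAnnihilation_vacuum,
    rightCreation_vacuum, gaussian_vacuum, add_zero]

theorem creation_mul_rightCreation (g h : H) :
    creation q g * rightCreation q h = rightCreation q h * creation q g :=
  ext_tensor q fun l => by
    rw [mul_apply_eq_comp, mul_apply_eq_comp, rightCreation_tensor,
      ← tensor_cons, ← tensor_cons, rightCreation_tensor, List.cons_append]

theorem annihilation_mul_rightAnnihilation (g h : H) :
    annihilation q g * rightAnnihilation q h = rightAnnihilation q h * annihilation q g := by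
  rw [← star_creation, ← star_rightCreation, ← star_mul, ← star_mul, creation_mul_rightCreation]

/-- The commutator of the annihilation operator of `e` with the right creation operator of `e`. For
a unit vector `e` it multiplies tensors of length `n` by `q ^ n`. -/
noncomputable def numberOp (e : H) : FockSpace q H →L[ℂ] FockSpace q H :=
  annihilation q e * rightCreation q e - rightCreation q e * annihilation q e

/-- The operator `[a(g), r(h)]`, with `r(h)` the right creation operator, commutes with the creation
operators up to the factor `q`. This determines it by its value on the vacuum. -/
theorem commutator_mul_creation (g h k : H) :
    (annihilation q g * rightCreation q h - rightCreation q h * annihilation q g) * creation q k =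
      ((q : ℝ) : ℂ) • (creation q k *
        (annihilation q g * rightCreation q h - rightCreation q h * annihilation q g)) := by
  have h1 := annihilation_mul_creation q g k
  have h2 := creation_mul_rightCreation q k h
  calc _ = (annihilation q g * creation q k) * rightCreation q h
        - rightCreation q h * (annihilation q g * creation q k) := by
        rw [sub_mul, mul_assoc, ← h2, mul_assoc, mul_assoc]
    _ = _ := by
        rw [h1]
        simp only [add_mul, mul_add, smul_mul_assoc, mul_smul_comm, one_mul, mul_one, mul_sub,
          smul_sub]
        rw [← mul_assoc (rightCreation q h), ← h2]
        simp only [mul_assoc]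
        abel

theorem commutator_vacuum (g h : H) :
    (annihilation q g * rightCreation q h - rightCreation q h * annihilation q g) (vacuum q H) =
      ((⟪g, h⟫_ℝ : ℝ) : ℂ) • vacuum q H := by
  simp [rightCreation_vacuum, annihilation_creation_apply, annihilation_vacuum]

variable {q} {e : H}

theorem numberOp_mul_creation (e k : H) :
    numberOp q e * creation q k = ((q : ℝ) : ℂ) • (creation q k * numberOp q e) :=
  commutator_mul_creation q e e k

theorem numberOp_vacuum (he : ‖e‖ = 1) : numberOp q e (vacuum q H) = vacuum q H := by
  rw [numberOp, commutator_vacuum]; simp [he]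

theorem commutator_eq (he : ‖e‖ = 1) (g h : H) :
    annihilation q g * rightCreation q h - rightCreation q h * annihilation q g =
      ((⟪g, h⟫_ℝ : ℝ) : ℂ) • numberOp q e := by
  rw [← sub_eq_zero]
  refine eq_zero_of_mul_creation q ((q : ℝ) : ℂ) (fun k => ?_) ?_
  · rw [sub_mul, commutator_mul_creation, smul_mul_assoc, numberOp_mul_creation,
      mul_sub (creation q k) (_ - _), smul_sub _ (_ * (_ - _)), mul_smul_comm, smul_comm]
  · rw [sub_apply, commutator_vacuum, smul_apply,
      numberOp_vacuum he, sub_self]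

theorem annihilation_mul_numberOp (he : ‖e‖ = 1) (k : H) :
    annihilation q k * numberOp q e = ((q : ℝ) : ℂ) • (numberOp q e * annihilation q k) := by
  rw [← sub_eq_zero]
  refine eq_zero_of_mul_creation q (((q : ℝ) : ℂ) ^ 2) (fun h => ?_) ?_
  · have h1 := numberOp_mul_creation (q := q) e h
    have h2 := annihilation_mul_creation q k h
    calc _ = annihilation q k * (numberOp q e * creation q h)
          - ((q : ℝ) : ℂ) • (numberOp q e * (annihilation q k * creation q h)) := by
          rw [sub_mul, smul_mul_assoc, mul_assoc, mul_assoc]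
      _ = ((q : ℝ) : ℂ) • ((annihilation q k * creation q h) * numberOp q e)
          - ((q : ℝ) : ℂ) • (numberOp q e * (annihilation q k * creation q h)) := by
          rw [h1, mul_smul_comm, mul_assoc]
      _ = ((q : ℝ) : ℂ) • (((q : ℝ) : ℂ) • (creation q h * (annihilation q k * numberOp q e)))
          - ((q : ℝ) : ℂ) • (((q : ℝ) : ℂ) • ((numberOp q e * creation q h) *
            annihilation q k)) := by
          rw [h2]
          simp only [add_mul, mul_add, smul_mul_assoc, mul_smul_comm, one_mul, mul_one, mul_assoc,
            smul_add]
          abel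
      _ = _ := by
          rw [h1]
          simp only [smul_mul_assoc, mul_sub, smul_sub, mul_smul_comm, smul_smul, mul_assoc]
          ring_nf
  · simp [numberOp_vacuum he, annihilation_vacuum]

theorem star_numberOp (he : ‖e‖ = 1) : star (numberOp q e) = numberOp q e := by
  rw [← sub_eq_zero]
  refine eq_zero_of_mul_creation q ((q : ℝ) : ℂ) (fun k => ?_) ?_
  · have h1 := congrArg star (annihilation_mul_numberOp (q := q) he k)
    rw [star_mul, star_smul, star_mul, star_annihilation] at h1
    rw [sub_mul, h1, numberOp_mul_creation, mul_sub, smul_sub]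
    simp
  · rw [sub_apply, numberOp_vacuum he, numberOp, star_sub, star_mul, star_mul,
      star_rightCreation, star_annihilation]
    simp [rightAnnihilation_vacuum]
    rw [← rightCreation_vacuum, rightAnnihilation, rightCreation, ← mul_apply_eq_comp,
      ← map_mul, flipConj_vacuum]
    simp [annihilation_creation_apply, annihilation_vacuum, he, flip_vacuum]

theorem annihilation_mul_rightGaussian (he : ‖e‖ = 1) (g h : H) :
    annihilation q g * rightGaussian q h =
      rightGaussian q h * annihilation q g + ((⟪g, h⟫_ℝ : ℝ) : ℂ) • numberOp q e := by
  rw [← commutator_eq he, rightGaussian_eq, mul_add, add_mul, annihilation_mul_rightAnnihilation]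
  abel

theorem rightGaussian_mul_creation (he : ‖e‖ = 1) (g h : H) :
    rightGaussian q h * creation q g =
      creation q g * rightGaussian q h + ((⟪g, h⟫_ℝ : ℝ) : ℂ) • numberOp q e := by
  have h1 := congrArg star (annihilation_mul_rightGaussian (q := q) he g h)
  rw [star_mul, star_add, star_mul, star_smul, star_numberOp he, star_annihilation,
    star_rightGaussian] at h1
  simpa using h1

/-- The left and the right `q`-Gaussian elements commute. -/
theorem gaussian_mul_rightGaussian (he : ‖e‖ = 1) (g h : H) :
    gaussian q g * rightGaussian q h = rightGaussian q h * gaussian q g := by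
  rw [gaussian, mul_add, add_mul, rightGaussian_mul_creation he,
    annihilation_mul_rightGaussian he]
  abel

end Flip

/-! ### Wick words -/

section Wick

variable {H : Type*} {E : Type*} [AddCommGroup E] [Module ℂ E]

/-- The sum of `q ^ inv(I, J) • Φ I J` over all ways to split a word into two complementary
subwords `I` and `J`, where `inv(I, J)` is the number of letters of `I` standing to the right of a
letter of `J`, counted for all letters of `J`. -/
noncomputable def wickSum (q : ℝ) : List H → (List H → List H → E) → E
  | [], Φ => Φ [] []
  | h :: w, Φ => wickSum q w fun I J => Φ (h :: I) J + (q : ℂ) ^ I.length • Φ I (h :: J)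

theorem wickSum_add (q : ℝ) (w : List H) (Φ Ψ : List H → List H → E) :
    wickSum q w (fun I J => Φ I J + Ψ I J) = wickSum q w Φ + wickSum q w Ψ := by
  induction w generalizing Φ Ψ with
  | nil => rfl
  | cons h w ih =>
    simp only [wickSum]
    rw [← ih]
    congr 1
    ext I J
    rw [smul_add]
    abel

theorem wickSum_map {E' : Type*} [AddCommGroup E'] [Module ℂ E'] (q : ℝ) (T : E →ₗ[ℂ] E')
    (w : List H) (Φ : List H → List H → E) :
    T (wickSum q w Φ) = wickSum q w fun I J => T (Φ I J) := by
  induction w generalizing Φ with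
  | nil => rfl
  | cons h w ih => simp only [wickSum, ih, map_add, map_smul]

theorem wickSum_eq_of_right_nil (q : ℝ) (w : List H) (Φ : List H → List H → E)
    (hΦ : ∀ I J, J ≠ [] → Φ I J = 0) : wickSum q w Φ = Φ w [] := by
  induction w generalizing Φ with
  | nil => rfl
  | cons h w ih =>
    rw [wickSum, ih]
    · simp [hΦ]
    · intro I J hJ
      simp [hΦ _ _ hJ, hΦ]

theorem norm_wickSum_le {E : Type*} [NormedAddCommGroup E] [NormedSpace ℂ E] {q : ℝ} (hq : |q| ≤ 1)
    (w : List H) (Φ : List H → List H → E) {B : ℝ}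
    (hΦ : ∀ I J, (∀ k ∈ I, k ∈ w) → (∀ k ∈ J, k ∈ w) → I.length + J.length = w.length →
      ‖Φ I J‖ ≤ B) : ‖wickSum q w Φ‖ ≤ 2 ^ w.length * B := by
  induction w generalizing Φ B with
  | nil => simpa [wickSum] using hΦ [] [] (by simp) (by simp) rfl
  | cons h w ih =>
    rw [wickSum, List.length_cons, pow_succ, mul_assoc]
    refine ih _ fun I J hI hJ hl => ?_
    have h1 : ‖Φ (h :: I) J‖ ≤ B := by
      refine hΦ _ _ ?_ (fun k hk => List.mem_cons_of_mem _ (hJ k hk)) (by simp; omega)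
      rintro k hk
      rcases List.mem_cons.1 hk with rfl | hk
      · simp
      · exact List.mem_cons_of_mem _ (hI k hk)
    have h2 : ‖Φ I (h :: J)‖ ≤ B := by
      refine hΦ _ _ (fun k hk => List.mem_cons_of_mem _ (hI k hk)) ?_ (by simp; omega)
      rintro k hk
      rcases List.mem_cons.1 hk with rfl | hk
      · simp
      · exact List.mem_cons_of_mem _ (hJ k hk)
    have h3 : ‖(q : ℂ) ^ I.length • Φ I (h :: J)‖ ≤ ‖Φ I (h :: J)‖ := by
      rw [norm_smul, norm_pow, Complex.norm_real, Real.norm_eq_abs]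
      exact mul_le_of_le_one_left (norm_nonneg _) (pow_le_one₀ (abs_nonneg q) hq)
    linarith [norm_add_le (Φ (h :: I) J) ((q : ℂ) ^ I.length • Φ I (h :: J))]

theorem tendsto_wickSum {ι : Type*} {l : Filter ι} {E : Type*} [NormedAddCommGroup E]
    [NormedSpace ℂ E] (q : ℝ) (w : List H) (Φ : ι → List H → List H → E)
    (hΦ : ∀ I J, (∀ k, k ∈ w ↔ k ∈ I ∨ k ∈ J) → Tendsto (fun i => Φ i I J) l (𝓝 0)) :
    Tendsto (fun i => wickSum q w (Φ i)) l (𝓝 0) := by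
  induction w generalizing Φ with
  | nil => exact hΦ [] [] (by simp)
  | cons h w ih =>
    refine ih _ fun I J hIJ => ?_
    have h1 := hΦ (h :: I) J (by intro k; simp [hIJ k, or_assoc])
    have h2 := (hΦ I (h :: J) (by intro k; simp [hIJ k]; tauto)).const_smul ((q : ℂ) ^ I.length)
    simpa using h1.add h2

variable [NormedAddCommGroup H] [InnerProductSpace ℝ H]

/-- The sum of `q ^ (k - 1) ⟨g, w_k⟩ • Ψ (w_1 ⋯ ŵ_k ⋯ w_n)` over the positions `k` of the word
`w`. -/
noncomputable def contraction (q : ℝ) (g : H) : (List H → E) → List H → E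
  | _, [] => 0
  | Ψ, k :: w => ((⟪g, k⟫_ℝ : ℝ) : ℂ) • Ψ w + (q : ℂ) • contraction q g (fun v => Ψ (k :: v)) w

theorem contraction_add (q : ℝ) (g : H) (w : List H) (Φ Ψ : List H → E) :
    contraction q g (fun v => Φ v + Ψ v) w = contraction q g Φ w + contraction q g Ψ w := by
  induction w generalizing Φ Ψ with
  | nil => simp [contraction]
  | cons h w ih =>
    simp only [contraction, ih, smul_add]
    abel

theorem contraction_map {E' : Type*} [AddCommGroup E'] [Module ℂ E'] (q : ℝ) (T : E →ₗ[ℂ] E')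
    (g : H) (w : List H) (Ψ : List H → E) :
    T (contraction q g Ψ w) = contraction q g (fun v => T (Ψ v)) w := by
  induction w generalizing Ψ with
  | nil => simp [contraction]
  | cons h w ih => simp only [contraction, ih, map_add, map_smul]

/-- A letter which is contracted leaves a word that is shorter by one, so that the weight `q` of each
letter of the remaining word can be taken out of the sum. -/
theorem smul_contraction (q : ℝ) (g : H) (w : List H) (Ψ : List H → E) :
    (q : ℂ) • contraction q g (fun v => (q : ℂ) ^ v.length • Ψ v) w =
      (q : ℂ) ^ w.length • contraction q g Ψ w := by
  induction w generalizing Ψ with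
  | nil => simp [contraction]
  | cons k w ih =>
    have h1 : contraction q g (fun v => (q : ℂ) ^ (k :: v).length • Ψ (k :: v)) w =
        (q : ℂ) • contraction q g (fun v => (q : ℂ) ^ v.length • Ψ (k :: v)) w := by
      rw [← LinearMap.lsmul_apply, contraction_map]
      simp only [LinearMap.lsmul_apply, smul_smul, List.length_cons, pow_succ']
    simp only [contraction]
    rw [h1, ih]
    simp only [smul_add, smul_smul, List.length_cons]
    congr 2
    · ring
    · ring

/-- The terms of a contraction only involve shorter words in the same letters. -/
theorem contraction_mem (q : ℝ) (g : H) (S : Submodule ℂ E) (w : List H) (Ψ : List H → E)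
    (hΨ : ∀ v : List H, v.length < w.length → (∀ k ∈ v, k ∈ w) → Ψ v ∈ S) :
    contraction q g Ψ w ∈ S := by
  induction w generalizing Ψ with
  | nil => exact S.zero_mem
  | cons k w ih =>
    refine S.add_mem (S.smul_mem _ (hΨ w (by simp) fun k hk => List.mem_cons_of_mem _ hk))
      (S.smul_mem _ (ih _ fun v hv hvw => hΨ _ (by simpa using hv) fun j hj => ?_))
    rcases List.mem_cons.1 hj with rfl | hj
    · simp
    · exact List.mem_cons_of_mem _ (hvw j hj)

/-- Contracting a letter of the left subword of a splitting is the same as contracting a letter of the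
whole word and splitting the rest: the weights agree. -/
theorem wickSum_contraction (q : ℝ) (g : H) (w : List H) (Φ : List H → List H → E) :
    wickSum q w (fun I J => contraction q g (fun I' => Φ I' J) I) =
      contraction q g (fun v => wickSum q v Φ) w := by
  induction w generalizing Φ with
  | nil => rfl
  | cons h w ih =>
    simp only [contraction, wickSum]
    rw [← ih, ← LinearMap.lsmul_apply, ← LinearMap.lsmul_apply, wickSum_map, wickSum_map,
      ← wickSum_add]
    congr 1
    ext I J
    simp only [LinearMap.lsmul_apply]
    rw [contraction_add, smul_add, smul_contraction]
    abel

variable (q : Set.Ioo (-1 : ℝ) 1)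

theorem annihilation_mul_creationProd (g : H) (w : List H) :
    annihilation q g * creationProd q w =
      ((q : ℝ) : ℂ) ^ w.length • (creationProd q w * annihilation q g) +
        contraction q g (creationProd q) w := by
  induction w with
  | nil => simp [contraction]
  | cons k w ih =>
    have h1 := contraction_map (q : ℝ) (LinearMap.mulLeft ℂ (creation q k)) g w (creationProd q)
    simp only [LinearMap.mulLeft_apply, ← creationProd_cons] at h1
    rw [contraction, ← h1, creationProd_cons, ← mul_assoc, annihilation_mul_creation, add_mul,
      smul_mul_assoc, smul_mul_assoc, one_mul, mul_assoc, ih, mul_add, mul_smul_comm, smul_add,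
      smul_smul, List.length_cons, pow_succ', mul_assoc]
    abel

/-- The Wick word of `h₁ ⊗ ⋯ ⊗ hₙ`: the polynomial in the `q`-Gaussian elements which maps the vacuum
to that tensor, written in normal order, with the creation operators on the left. -/
noncomputable def wick (w : List H) : FockSpace q H →L[ℂ] FockSpace q H :=
  wickSum (q : ℝ) w fun I J => creationProd q I * annihilationProd q J

theorem annihilationProd_vacuum {J : List H} (hJ : J ≠ []) :
    annihilationProd q J (vacuum q H) = 0 := by
  induction J with
  | nil => exact absurd rfl hJ
  | cons k J ih =>
    rw [annihilationProd_cons, mul_apply_eq_comp]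
    rcases eq_or_ne J [] with rfl | h
    · simp [annihilation_vacuum]
    · rw [ih h, map_zero]

theorem wick_apply (w : List H) (x : FockSpace q H) :
    wick q w x = wickSum (q : ℝ) w fun I J => creationProd q I (annihilationProd q J x) :=
  wickSum_map (q : ℝ) ((ContinuousLinearMap.apply ℂ (FockSpace q H) x).toLinearMap) w _

theorem wick_vacuum (w : List H) : wick q w (vacuum q H) = tensor q w := by
  rw [wick_apply, wickSum_eq_of_right_nil]
  · simp [tensor]
  · intro I J hJ
    rw [annihilationProd_vacuum q hJ, map_zero]

/-- The recursion for Wick words, by which they are polynomials in the `q`-Gaussian elements. -/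
theorem gaussian_mul_wick (g : H) (w : List H) :
    gaussian q g * wick q w = wick q (g :: w) + contraction q g (wick q) w := by
  have h1 := wickSum_contraction (q : ℝ) g w fun I J => creationProd q I * annihilationProd q J
  have h2 := wickSum_map (q : ℝ) (LinearMap.mulLeft ℂ (gaussian q g)) w
    fun I J => creationProd q I * annihilationProd q J
  change _ = contraction _ g (wick q) w at h1
  change gaussian q g * wick q w = _ at h2
  rw [h2, ← h1]
  rw [wick, wickSum, ← wickSum_add]
  congr 1
  ext1 I
  ext1 J
  have h3 := contraction_map (q : ℝ) (LinearMap.mulRight ℂ (annihilationProd q J)) g I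
    (creationProd q)
  simp only [LinearMap.mulRight_apply] at h3
  rw [LinearMap.mulLeft_apply, ← h3, gaussian, add_mul, creationProd_cons, mul_assoc,
    ← mul_assoc (annihilation q g), annihilation_mul_creationProd, annihilationProd_cons, add_mul,
    smul_mul_assoc, mul_assoc, add_assoc]

/-- The algebra of polynomials in the `s(h)`, `h ∈ V`. -/
noncomputable abbrev polynomials (V : Submodule ℝ H) :
    Subalgebra ℂ (FockSpace q H →L[ℂ] FockSpace q H) :=
  Algebra.adjoin ℂ (gaussian q '' (V : Set H))

theorem wick_mem_polynomials (V : Submodule ℝ H) (w : List H) (hw : ∀ k ∈ w, k ∈ V) :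
    wick q w ∈ polynomials q V := by
  induction hn : w.length using Nat.strong_induction_on generalizing w with
  | _ n ih =>
    cases w with
    | nil =>
      have : wick q ([] : List H) = 1 := by simp [wick, wickSum]
      rw [this]
      exact one_mem _
    | cons g w =>
      have h1 := gaussian_mul_wick q g w
      rw [← sub_eq_iff_eq_add] at h1
      rw [← h1]
      refine sub_mem (mul_mem (Algebra.subset_adjoin ⟨g, hw g (by simp), rfl⟩) ?_) ?_
      · exact ih w.length (by simp [← hn]) w (fun k hk => hw k (by simp [hk])) rfl
      · refine contraction_mem (q : ℝ) g (Subalgebra.toSubmodule (polynomials q V)) w _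
          fun v hv hvw => ?_
        refine ih v.length (by simp at hn; omega) v (fun k hk => hw k ?_) rfl
        exact List.mem_cons_of_mem _ (hvw k hk)

end Wick

/-! ### Commutants and the trace -/

section Trace

variable {K : Type*} [NormedAddCommGroup K] [InnerProductSpace ℂ K] [CompleteSpace K]

/-- The orthogonal projection onto a closed subspace commutes with the operators which, together with
their adjoints, leave the subspace invariant. -/
theorem starProjection_mul_comm (L : Submodule ℂ K) [L.HasOrthogonalProjection] (T : K →L[ℂ] K)
    (h1 : ∀ x ∈ L, T x ∈ L) (h2 : ∀ x ∈ L, star T x ∈ L) :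
    L.starProjection * T = T * L.starProjection := by
  ext x
  rw [mul_apply_eq_comp, mul_apply_eq_comp]
  refine (Submodule.eq_starProjection_of_mem_of_inner_eq_zero
    (h1 _ (Submodule.starProjection_apply_mem _ _)) fun w hw => ?_)
  rw [← map_sub, ← ContinuousLinearMap.adjoint_inner_right]
  exact Submodule.starProjection_inner_eq_zero _ _ (h2 w hw)

theorem mul_comm_of_mem_generatedBy {S : Set (K →L[ℂ] K)} {x T : K →L[ℂ] K}
    (hx : x ∈ generatedBy S) (h1 : ∀ s ∈ S, s * T = T * s) (h2 : ∀ s ∈ S, star s * T = T * star s) :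
    T * x = x * T := by
  refine VonNeumannAlgebra.mem_commutant_iff.1 hx T ?_
  exact (StarSubalgebra.mem_centralizer_iff ℂ).2 fun s hs => ⟨h1 s hs, h2 s hs⟩

theorem mem_generatedBy {S : Set (K →L[ℂ] K)} {x : K →L[ℂ] K} (hx : x ∈ S) : x ∈ generatedBy S := by
  refine VonNeumannAlgebra.mem_commutant_iff.2 fun T hT => ?_
  exact (((StarSubalgebra.mem_centralizer_iff ℂ).1 hT x hx).1).symm

variable {q : Set.Ioo (-1 : ℝ) 1} {H : Type*} [NormedAddCommGroup H] [InnerProductSpace ℝ H]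

theorem mul_comm_of_mem_gaussianAlgebra {V : Submodule ℝ H} {x T : FockSpace q H →L[ℂ] FockSpace q H}
    (hx : x ∈ gaussianAlgebra q V) (hT : ∀ h ∈ V, gaussian q h * T = T * gaussian q h) :
    T * x = x * T := by
  refine mul_comm_of_mem_generatedBy hx ?_ ?_
  · rintro _ ⟨h, hh, rfl⟩; exact hT h hh
  · rintro _ ⟨h, hh, rfl⟩; rw [star_gaussian]; exact hT h hh

theorem mem_gaussianAlgebra_of_mem_polynomials {V : Submodule ℝ H}
    {x : FockSpace q H →L[ℂ] FockSpace q H} (hx : x ∈ polynomials q V) :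
    x ∈ gaussianAlgebra q V := by
  have : polynomials q V ≤ (gaussianAlgebra q V).toStarSubalgebra.toSubalgebra := by
    refine Algebra.adjoin_le ?_
    exact fun x hx => mem_generatedBy hx
  exact this hx

theorem gaussianAlgebra_mono {V W : Submodule ℝ H} (hVW : V ≤ W) {x : FockSpace q H →L[ℂ] FockSpace q H}
    (hx : x ∈ gaussianAlgebra q V) : x ∈ gaussianAlgebra q W := by
  refine VonNeumannAlgebra.mem_commutant_iff.2 fun T hT => ?_
  refine mul_comm_of_mem_gaussianAlgebra hx fun h hh => ?_
  exact ((StarSubalgebra.mem_centralizer_iff ℂ).1 hT _ ⟨h, hVW hh, rfl⟩).1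

theorem gaussian_mul_comm_of_mem_span {e h k : H} (hh : h ∈ Submodule.span ℝ {e})
    (hk : k ∈ Submodule.span ℝ {e}) : gaussian q h * gaussian q k = gaussian q k * gaussian q h := by
  obtain ⟨r, rfl⟩ := Submodule.mem_span_singleton.1 hh
  obtain ⟨t, rfl⟩ := Submodule.mem_span_singleton.1 hk
  simp only [gaussian_smul, smul_mul_smul_comm, mul_comm (r : ℂ)]

theorem gaussianAlgebra_span_mul_comm {e : H} {x y : FockSpace q H →L[ℂ] FockSpace q H}
    (hx : x ∈ gaussianAlgebra q (Submodule.span ℝ {e}))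
    (hy : y ∈ gaussianAlgebra q (Submodule.span ℝ {e})) : x * y = y * x := by
  refine mul_comm_of_mem_gaussianAlgebra hy fun h hh => ?_
  exact mul_comm_of_mem_gaussianAlgebra hx fun k hk => gaussian_mul_comm_of_mem_span hk hh

variable {e : H}

theorem rightGaussian_mul_comm (he : ‖e‖ = 1) {x : FockSpace q H →L[ℂ] FockSpace q H}
    (hx : x ∈ gaussianAlgebra q (⊤ : Submodule ℝ H)) (h : H) :
    rightGaussian q h * x = x * rightGaussian q h :=
  mul_comm_of_mem_gaussianAlgebra hx fun k _ => gaussian_mul_rightGaussian he k h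

theorem flipConj_mul_comm (he : ‖e‖ = 1) {x L : FockSpace q H →L[ℂ] FockSpace q H}
    (hx : x ∈ gaussianAlgebra q (⊤ : Submodule ℝ H)) (hL : L ∈ polynomials q (⊤ : Submodule ℝ H)) :
    flipConj q H L * x = x * flipConj q H L := by
  induction hL using Algebra.adjoin_induction with
  | mem L hL => obtain ⟨h, -, rfl⟩ := hL; exact rightGaussian_mul_comm he hx h
  | algebraMap r => rw [AlgHom.commutes, Algebra.commutes]
  | add L M _ _ hL hM =>
    have h : flipConj q H (L + M) = flipConj q H L + flipConj q H M := by
      simp only [flipConj_apply, mul_add, add_mul]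
    rw [h, add_mul, mul_add, hL, hM]
  | mul L M _ _ hL hM => rw [map_mul, mul_assoc, hM, ← mul_assoc, hL, mul_assoc]

/-- The trace property, by moving a `q`-Gaussian element from the left of `x` to the right: on the
vacuum it agrees with its right-handed version, which commutes with `x`. -/
theorem inner_vacuum_mul_comm (he : ‖e‖ = 1) {x L : FockSpace q H →L[ℂ] FockSpace q H}
    (hx : x ∈ gaussianAlgebra q (⊤ : Submodule ℝ H)) (hL : L ∈ polynomials q (⊤ : Submodule ℝ H)) :
    ⟪vacuum q H, (L * x) (vacuum q H)⟫_ℂ = ⟪vacuum q H, (x * L) (vacuum q H)⟫_ℂ := by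
  induction hL using Algebra.adjoin_induction generalizing x with
  | mem L hL =>
    obtain ⟨h, -, rfl⟩ := hL
    rw [mul_apply_eq_comp, mul_apply_eq_comp, ← rightGaussian_vacuum, ← mul_apply_eq_comp x,
      ← rightGaussian_mul_comm he hx, mul_apply_eq_comp,
      ← ContinuousLinearMap.adjoint_inner_left (gaussian q h),
      ← ContinuousLinearMap.adjoint_inner_left (rightGaussian q h),
      ← ContinuousLinearMap.star_eq_adjoint, ← ContinuousLinearMap.star_eq_adjoint, star_gaussian,
      star_rightGaussian, rightGaussian_vacuum]
  | algebraMap r => rw [Algebra.commutes]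
  | add L M _ _ hL hM =>
    rw [add_mul, mul_add, add_apply, add_apply, inner_add_right, inner_add_right, hL hx, hM hx]
  | mul L M h1 h2 hL hM =>
    rw [mul_assoc, hL (mul_mem (mem_gaussianAlgebra_of_mem_polynomials h2) hx), mul_assoc,
      hM (mul_mem hx (mem_gaussianAlgebra_of_mem_polynomials h1)), mul_assoc]

theorem star_mem_polynomials {V : Submodule ℝ H} {L : FockSpace q H →L[ℂ] FockSpace q H}
    (hL : L ∈ polynomials q V) : star L ∈ polynomials q V := by
  induction hL using Algebra.adjoin_induction with
  | mem L hL =>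
    obtain ⟨h, hh, rfl⟩ := hL
    rw [star_gaussian]
    exact Algebra.subset_adjoin ⟨h, hh, rfl⟩
  | algebraMap r =>
    rw [Algebra.algebraMap_eq_smul_one, star_smul, star_one]
    exact Subalgebra.smul_mem _ (one_mem _) _
  | add L M _ _ hL hM => rw [star_add]; exact add_mem hL hM
  | mul L M _ _ hL hM => rw [star_mul]; exact mul_mem hM hL

theorem inner_star_vacuum (he : ‖e‖ = 1) {x L : FockSpace q H →L[ℂ] FockSpace q H}
    (hx : x ∈ gaussianAlgebra q (⊤ : Submodule ℝ H)) (hL : L ∈ polynomials q (⊤ : Submodule ℝ H)) :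
    ⟪star L (vacuum q H), x (vacuum q H)⟫_ℂ = ⟪star x (vacuum q H), L (vacuum q H)⟫_ℂ := by
  simp only [ContinuousLinearMap.star_eq_adjoint, ContinuousLinearMap.adjoint_inner_left]
  exact inner_vacuum_mul_comm he hx hL

theorem norm_star_vacuum_of_polynomial (he : ‖e‖ = 1) {L : FockSpace q H →L[ℂ] FockSpace q H}
    (hL : L ∈ polynomials q (⊤ : Submodule ℝ H)) :
    ‖star L (vacuum q H)‖ = ‖L (vacuum q H)‖ := by
  have h := inner_star_vacuum he
    (mem_gaussianAlgebra_of_mem_polynomials (star_mem_polynomials hL)) hL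
  rw [star_star] at h
  rw [@norm_eq_sqrt_re_inner ℂ, h, ← @norm_eq_sqrt_re_inner ℂ]

theorem mem_closure_polynomials_vacuum (x : FockSpace q H) :
    x ∈ closure {y | ∃ L ∈ polynomials q (⊤ : Submodule ℝ H), L (vacuum q H) = y} := by
  have h := mem_of_tensor_mem q
    (S := ((Subalgebra.toSubmodule (polynomials q (⊤ : Submodule ℝ H))).map
      (ContinuousLinearMap.apply ℂ (FockSpace q H) (vacuum q H)).toLinearMap).topologicalClosure)
    (Submodule.isClosed_topologicalClosure _) (fun l => ?_) x
  · exact h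
  · refine Submodule.le_topologicalClosure _ ⟨wick q l, ?_, wick_vacuum q l⟩
    exact wick_mem_polynomials q _ _ fun _ _ => Submodule.mem_top

theorem norm_star_vacuum_le (he : ‖e‖ = 1) {x : FockSpace q H →L[ℂ] FockSpace q H}
    (hx : x ∈ gaussianAlgebra q (⊤ : Submodule ℝ H)) :
    ‖star x (vacuum q H)‖ ≤ ‖x (vacuum q H)‖ := by
  have h : ∀ y : FockSpace q H,
      ‖⟪star x (vacuum q H), y⟫_ℂ‖ ≤ ‖x (vacuum q H)‖ * ‖y‖ := by
    intro y
    refine closure_minimal (s := {y | ∃ L ∈ polynomials q (⊤ : Submodule ℝ H), L (vacuum q H) = y})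
      (t := {y | ‖⟪star x (vacuum q H), y⟫_ℂ‖ ≤ ‖x (vacuum q H)‖ * ‖y‖}) ?_ ?_
      (mem_closure_polynomials_vacuum y)
    · rintro _ ⟨L, hL, rfl⟩
      change ‖⟪star x (vacuum q H), L (vacuum q H)⟫_ℂ‖ ≤ _
      rw [← inner_star_vacuum he hx hL, ← norm_star_vacuum_of_polynomial he hL, mul_comm]
      exact norm_inner_le_norm _ _
    · exact isClosed_le (by fun_prop) (by fun_prop)
  have h1 := h (star x (vacuum q H))
  rw [inner_self_eq_norm_sq_to_K] at h1
  simp only [norm_pow, Complex.coe_algebraMap, Complex.norm_real, norm_norm] at h1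
  rcases (norm_nonneg (star x (vacuum q H))).eq_or_lt with h2 | h2
  · rw [← h2]; exact norm_nonneg _
  · nlinarith

/-- The vacuum state is a trace on the `q`-Gaussian algebra. -/
theorem norm_star_vacuum (he : ‖e‖ = 1) {x : FockSpace q H →L[ℂ] FockSpace q H}
    (hx : x ∈ gaussianAlgebra q (⊤ : Submodule ℝ H)) :
    ‖star x (vacuum q H)‖ = ‖x (vacuum q H)‖ := by
  refine le_antisymm (norm_star_vacuum_le he hx) ?_
  have := norm_star_vacuum_le he (star_mem hx)
  rwa [star_star] at this

/-- Right multiplication by `x` is bounded in the `2`-norm by `‖x‖`, since the vacuum is tracial. -/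
theorem norm_mul_vacuum_le (he : ‖e‖ = 1) {a x : FockSpace q H →L[ℂ] FockSpace q H}
    (ha : a ∈ gaussianAlgebra q (⊤ : Submodule ℝ H))
    (hx : x ∈ gaussianAlgebra q (⊤ : Submodule ℝ H)) :
    ‖a (x (vacuum q H))‖ ≤ ‖x‖ * ‖a (vacuum q H)‖ := by
  rw [← mul_apply_eq_comp, ← norm_star_vacuum he (mul_mem ha hx), ← norm_star_vacuum he ha, star_mul,
    mul_apply_eq_comp]
  refine (ContinuousLinearMap.le_opNorm _ _).trans_eq ?_
  congr 1
  exact LinearIsometryEquiv.norm_map ContinuousLinearMap.adjoint x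

/-- The vectors `u Ω` with `u` in the generator algebra lie in the closed span of the powers
`e ⊗ ⋯ ⊗ e`. -/
theorem apply_vacuum_mem_closure {u : FockSpace q H →L[ℂ] FockSpace q H}
    (hu : u ∈ gaussianAlgebra q (Submodule.span ℝ {e})) :
    u (vacuum q H) ∈ (Submodule.span ℂ
      (Set.range fun n : ℕ => tensor q (List.replicate n e))).topologicalClosure := by
  set L := (Submodule.span ℂ
      (Set.range fun n : ℕ => tensor q (List.replicate n e))).topologicalClosure with hL
  have hc : IsClosed (L : Set (FockSpace q H)) := Submodule.isClosed_topologicalClosure _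
  have : CompleteSpace L := hc.completeSpace_coe
  have hmem (n : ℕ) : tensor q (List.replicate n e) ∈ L :=
    Submodule.le_topologicalClosure _ (Submodule.subset_span ⟨n, rfl⟩)
  have ha (n : ℕ) : annihilation q e (tensor q (List.replicate n e)) ∈ L := by
    rw [tensor, ← mul_apply_eq_comp, annihilation_mul_creationProd, add_apply, smul_apply,
      mul_apply_eq_comp, annihilation_vacuum, map_zero, smul_zero, zero_add]
    have := contraction_map (q : ℝ) ((ContinuousLinearMap.apply ℂ (FockSpace q H)
      (vacuum q H)).toLinearMap) e (List.replicate n e) (creationProd q)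
    refine this.symm ▸ ?_
    refine contraction_mem _ _ _ _ _ fun v hv hve => ?_
    have : v = List.replicate v.length e :=
      List.eq_replicate_iff.2 ⟨rfl, fun k hk => List.eq_of_mem_replicate (hve k hk)⟩
    rw [this]
    exact hmem _
  have hs : ∀ x ∈ L, gaussian q e x ∈ L := by
    intro x hx
    have : L ≤ L.comap (gaussian q e).toLinearMap := by
      refine Submodule.topologicalClosure_minimal _ (Submodule.span_le.2 ?_)
        (hc.preimage (gaussian q e).continuous)
      rintro _ ⟨n, rfl⟩
      change gaussian q e _ ∈ L
      rw [gaussian, add_apply]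
      refine L.add_mem ?_ (ha n)
      rw [← tensor_cons, ← List.replicate_succ]
      exact hmem _
    exact this hx
  have hcomm := starProjection_mul_comm L (gaussian q e) hs (by rwa [star_gaussian])
  have h1 : L.starProjection * u = u * L.starProjection := by
    refine mul_comm_of_mem_gaussianAlgebra hu fun h hh => ?_
    obtain ⟨r, rfl⟩ := Submodule.mem_span_singleton.1 hh
    rw [gaussian_smul, smul_mul_assoc, ← hcomm, mul_smul_comm]
  have h2 : L.starProjection (vacuum q H) = vacuum q H :=
    Submodule.starProjection_eq_self_iff.2 (by simpa using hmem 0)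
  have h3 : L.starProjection (u (vacuum q H)) = u (vacuum q H) := by
    rw [← mul_apply_eq_comp, h1, mul_apply_eq_comp, h2]
  rw [← h3]
  exact Submodule.starProjection_apply_mem _ _

end Trace

/-! ### Rows of creation operators -/

section Row

variable {q : Set.Ioo (-1 : ℝ) 1} {H : Type*} [NormedAddCommGroup H] [InnerProductSpace ℝ H]

theorem norm_creation_le_two (hq : |(q : ℝ)| ≤ 1 / 100) {h : H} (hh : ‖h‖ = 1) :
    ‖creation q h‖ ≤ 2 := by
  refine (norm_creation_le q h).trans ?_
  rw [Real.sqrt_le_left (by norm_num), hh, div_le_iff₀ (by linarith)]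
  linarith

theorem norm_annihilation_le_two (hq : |(q : ℝ)| ≤ 1 / 100) {h : H} (hh : ‖h‖ = 1) :
    ‖annihilation q h‖ ≤ 2 := by
  rw [norm_annihilation]
  exact norm_creation_le_two hq hh

variable {n : ℕ} {f : Fin n → H}

/-- By the commutation relation, a row of creation operators of orthonormal vectors is isometric up to
a term with the factor `q`. -/
theorem norm_row_sq (hf : Orthonormal ℝ f) (w : Fin n → FockSpace q H) :
    ‖∑ i, creation q (f i) (w i)‖ ^ 2 = ∑ i, ‖w i‖ ^ 2 +
      (q : ℝ) * ∑ i, ∑ j, (⟪annihilation q (f j) (w i), annihilation q (f i) (w j)⟫_ℂ).re := by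
  have h1 (i j : Fin n) : ⟪creation q (f i) (w i), creation q (f j) (w j)⟫_ℂ =
      ((q : ℝ) : ℂ) * ⟪annihilation q (f j) (w i), annihilation q (f i) (w j)⟫_ℂ +
        if i = j then ⟪w i, w j⟫_ℂ else 0 := by
    rw [inner_creation_left, annihilation_creation_apply, inner_add_right, inner_smul_right,
      inner_smul_right, inner_annihilation_left, orthonormal_iff_ite.1 hf]
    split_ifs <;> simp
  have h2 : (‖∑ i, creation q (f i) (w i)‖ ^ 2 : ℝ) =
      (⟪∑ i, creation q (f i) (w i), ∑ i, creation q (f i) (w i)⟫_ℂ).re := by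
    rw [@norm_sq_eq_re_inner ℂ]; rfl
  rw [h2, sum_inner, Complex.re_sum, Finset.mul_sum, ← Finset.sum_add_distrib]
  refine Finset.sum_congr rfl fun i _ => ?_
  rw [inner_sum, Complex.re_sum]
  simp only [h1, Complex.add_re, Finset.sum_add_distrib, Complex.re_ofReal_mul, ← Finset.mul_sum]
  rw [add_comm]
  congr 1
  rw [← Complex.re_sum, Finset.sum_ite_eq Finset.univ i, if_pos (Finset.mem_univ i),
    @norm_sq_eq_re_inner ℂ]
  rfl

theorem abs_row_cross_le (w : Fin n → FockSpace q H) :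
    |∑ i, ∑ j, (⟪annihilation q (f j) (w i), annihilation q (f i) (w j)⟫_ℂ).re| ≤
      ∑ i, ∑ j, ‖annihilation q (f j) (w i)‖ ^ 2 := by
  have h1 (i j : Fin n) : |(⟪annihilation q (f j) (w i), annihilation q (f i) (w j)⟫_ℂ).re| ≤
      (1 / 2) * ‖annihilation q (f j) (w i)‖ ^ 2 + (1 / 2) * ‖annihilation q (f i) (w j)‖ ^ 2 := by
    refine (Complex.abs_re_le_norm _).trans ((norm_inner_le_norm _ _).trans ?_)
    nlinarith [sq_nonneg (‖annihilation q (f j) (w i)‖ - ‖annihilation q (f i) (w j)‖)]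
  calc _ ≤ ∑ i, ∑ j, |(⟪annihilation q (f j) (w i), annihilation q (f i) (w j)⟫_ℂ).re| :=
        (Finset.abs_sum_le_sum_abs _ _).trans
          (Finset.sum_le_sum fun i _ => Finset.abs_sum_le_sum_abs _ _)
    _ ≤ ∑ i, ∑ j, ((1 / 2) * ‖annihilation q (f j) (w i)‖ ^ 2 +
          (1 / 2) * ‖annihilation q (f i) (w j)‖ ^ 2) :=
        Finset.sum_le_sum fun i _ => Finset.sum_le_sum fun j _ => h1 i j
    _ = _ := by
        simp only [Finset.sum_add_distrib, ← Finset.mul_sum]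
        rw [Finset.sum_comm (f := fun i j => ‖annihilation q (f i) (w j)‖ ^ 2)]
        ring

/-- The operator `∑ c(fⱼ) a(fⱼ)` is bounded by `2`, whatever the number of the orthonormal vectors
`fⱼ`. -/
theorem sum_norm_annihilation_sq_le (hq : |(q : ℝ)| ≤ 1 / 100) (hf : Orthonormal ℝ f)
    (w : FockSpace q H) : ∑ j, ‖annihilation q (f j) w‖ ^ 2 ≤ 2 * ‖w‖ ^ 2 := by
  -- A bound `Λ` can be improved to `1 + |q| Λ`; the crude bound `4 n` starts the iteration.
  have step (Λ : ℝ) (hΛ : 0 ≤ Λ)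
      (h : ∀ w : FockSpace q H, ∑ j, ‖annihilation q (f j) w‖ ^ 2 ≤ Λ * ‖w‖ ^ 2)
      (w : FockSpace q H) :
      ∑ j, ‖annihilation q (f j) w‖ ^ 2 ≤ (1 + Λ / 100) * ‖w‖ ^ 2 := by
    set s := ∑ j, ‖annihilation q (f j) w‖ ^ 2 with hs
    have hs0 : 0 ≤ s := Finset.sum_nonneg fun _ _ => by positivity
    set v := ∑ j, creation q (f j) (annihilation q (f j) w) with hv
    have h1 : ‖v‖ ^ 2 ≤ (1 + Λ / 100) * s := by
      rw [hv, norm_row_sq hf, ← hs]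
      have h2 := abs_row_cross_le (f := f) fun j => annihilation q (f j) w
      have h3 : ∑ i, ∑ j, ‖annihilation q (f j) (annihilation q (f i) w)‖ ^ 2 ≤ Λ * s := by
        rw [hs, Finset.mul_sum]
        exact Finset.sum_le_sum fun i _ => h _
      have h4 := h2.trans h3
      have h5 := mul_le_mul hq h4 (abs_nonneg _) (by norm_num)
      rw [← abs_mul] at h5
      linarith [le_abs_self ((q : ℝ) * ∑ i, ∑ j, (⟪annihilation q (f j) (annihilation q (f i) w),
        annihilation q (f i) (annihilation q (f j) w)⟫_ℂ).re)]
    have h2 : s ≤ ‖v‖ * ‖w‖ := by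
      have h3 : ⟪v, w⟫_ℂ = (s : ℂ) := by
        rw [hv, sum_inner, hs]
        push_cast
        refine Finset.sum_congr rfl fun j _ => ?_
        rw [inner_creation_left, inner_self_eq_norm_sq_to_K]
        rfl
      have h4 := norm_inner_le_norm (𝕜 := ℂ) v w
      rwa [h3, Complex.norm_real, Real.norm_of_nonneg hs0] at h4
    rcases hs0.eq_or_lt with h3 | h3
    · rw [← h3]; positivity
    · have h4 : s * s ≤ ((1 + Λ / 100) * s) * ‖w‖ ^ 2 := by
        calc s * s ≤ (‖v‖ * ‖w‖) * (‖v‖ * ‖w‖) := by gcongr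
          _ = ‖v‖ ^ 2 * ‖w‖ ^ 2 := by ring
          _ ≤ _ := by gcongr
      refine le_of_mul_le_mul_left ?_ h3
      linarith
  have key (k : ℕ) (w : FockSpace q H) :
      ∑ j, ‖annihilation q (f j) w‖ ^ 2 ≤ (2 + 4 * n * (1 / 2) ^ k) * ‖w‖ ^ 2 := by
    induction k generalizing w with
    | zero =>
      have : ∑ j, ‖annihilation q (f j) w‖ ^ 2 ≤ ∑ _j : Fin n, 4 * ‖w‖ ^ 2 := by
        refine Finset.sum_le_sum fun j _ => ?_
        have h1 := (annihilation q (f j)).le_of_opNorm_le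
          (norm_annihilation_le_two hq (hf.1 j)) w
        calc ‖annihilation q (f j) w‖ ^ 2 ≤ (2 * ‖w‖) ^ 2 := by gcongr
          _ = _ := by ring
      refine this.trans ?_
      simp only [Finset.sum_const, Finset.card_univ, Fintype.card_fin, nsmul_eq_mul, pow_zero]
      nlinarith [sq_nonneg ‖w‖]
    | succ k ih =>
      refine (step _ (by positivity) ih w).trans ?_
      refine mul_le_mul_of_nonneg_right ?_ (by positivity)
      have : (0 : ℝ) ≤ 4 * n * (1 / 2) ^ k := by positivity
      rw [pow_succ]
      linarith
  have hlim : Tendsto (fun k : ℕ => (2 + 4 * n * (1 / 2 : ℝ) ^ k) * ‖w‖ ^ 2) atTop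
      (𝓝 ((2 + 4 * n * 0) * ‖w‖ ^ 2)) := by
    refine Tendsto.mul_const _ (tendsto_const_nhds.add (Tendsto.const_mul _ ?_))
    exact tendsto_pow_atTop_nhds_zero_of_lt_one (by norm_num) (by norm_num)
  rw [mul_zero, add_zero] at hlim
  exact ge_of_tendsto' hlim fun k => key k w

theorem abs_norm_row_sq_sub_le (hq : |(q : ℝ)| ≤ 1 / 100) (hf : Orthonormal ℝ f)
    (w : Fin n → FockSpace q H) :
    |‖∑ i, creation q (f i) (w i)‖ ^ 2 - ∑ i, ‖w i‖ ^ 2| ≤ (1 / 50) * ∑ i, ‖w i‖ ^ 2 := by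
  rw [norm_row_sq hf, add_sub_cancel_left, abs_mul]
  have h1 : ∑ i, ∑ j, ‖annihilation q (f j) (w i)‖ ^ 2 ≤ 2 * ∑ i, ‖w i‖ ^ 2 := by
    rw [Finset.mul_sum]
    exact Finset.sum_le_sum fun i _ => sum_norm_annihilation_sq_le hq hf _
  have h2 := mul_le_mul hq ((abs_row_cross_le (f := f) w).trans h1) (abs_nonneg _) (by norm_num)
  linarith

/-- The constant does not depend on the number of the orthonormal vectors. -/
theorem norm_row_sq_le (hq : |(q : ℝ)| ≤ 1 / 100) (hf : Orthonormal ℝ f)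
    (w : Fin n → FockSpace q H) :
    ‖∑ i, creation q (f i) (w i)‖ ^ 2 ≤ 2 * ∑ i, ‖w i‖ ^ 2 := by
  have h1 := (abs_le.1 (abs_norm_row_sq_sub_le hq hf w)).2
  have h2 : 0 ≤ ∑ i, ‖w i‖ ^ 2 := Finset.sum_nonneg fun _ _ => by positivity
  linarith

/-- The constant does not depend on the number of the orthonormal vectors. -/
theorem sum_norm_sq_le_norm_row_sq (hq : |(q : ℝ)| ≤ 1 / 100) (hf : Orthonormal ℝ f)
    (w : Fin n → FockSpace q H) :
    ∑ i, ‖w i‖ ^ 2 ≤ 2 * ‖∑ i, creation q (f i) (w i)‖ ^ 2 := by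
  have h1 := (abs_le.1 (abs_norm_row_sq_sub_le hq hf w)).1
  have h2 : 0 ≤ ∑ i, ‖w i‖ ^ 2 := Finset.sum_nonneg fun _ _ => by positivity
  linarith

/-- An operator acting behind the first letter of a tensor is bounded. -/
theorem norm_row_map_le (hq : |(q : ℝ)| ≤ 1 / 100) (hf : Orthonormal ℝ f)
    (T : FockSpace q H →L[ℂ] FockSpace q H) (w : Fin n → FockSpace q H) :
    ‖∑ i, creation q (f i) (T (w i))‖ ≤ 2 * ‖T‖ * ‖∑ i, creation q (f i) (w i)‖ := by
  refine le_of_sq_le_sq ?_ (by positivity)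
  calc ‖∑ i, creation q (f i) (T (w i))‖ ^ 2 ≤ 2 * ∑ i, ‖T (w i)‖ ^ 2 := norm_row_sq_le hq hf _
    _ ≤ 2 * ∑ i, (‖T‖ * ‖w i‖) ^ 2 := by
        gcongr with i
        exact T.le_opNorm _
    _ = 2 * ‖T‖ ^ 2 * ∑ i, ‖w i‖ ^ 2 := by
        simp only [mul_pow, ← Finset.mul_sum]; ring
    _ ≤ 2 * ‖T‖ ^ 2 * (2 * ‖∑ i, creation q (f i) (w i)‖ ^ 2) := by
        gcongr
        exact sum_norm_sq_le_norm_row_sq hq hf w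
    _ = _ := by ring

end Row

/-! ### Tensors which start with a letter orthogonal to the generator -/

section Start

variable (q : Set.Ioo (-1 : ℝ) 1) {H : Type*} [NormedAddCommGroup H] [InnerProductSpace ℝ H]

/-- The span of the vectors `c(f) v` with `f` orthogonal to `e`. -/
noncomputable def startSpan (e : H) : Submodule ℂ (FockSpace q H) :=
  Submodule.span ℂ {x | ∃ f : H, ∃ v : FockSpace q H, ⟪e, f⟫_ℝ = 0 ∧ creation q f v = x}

/-- The closed span of the tensors whose first letter is orthogonal to `e`. -/
noncomputable def startSpace (e : H) : Submodule ℂ (FockSpace q H) :=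
  (startSpan q e).topologicalClosure

/-- The orthogonal projection onto the closed span of the tensors whose first letter is orthogonal to
`e`. -/
noncomputable def startProj (e : H) : FockSpace q H →L[ℂ] FockSpace q H :=
  haveI : CompleteSpace (startSpace q e) :=
    (Submodule.isClosed_topologicalClosure (startSpan q e)).completeSpace_coe
  (startSpace q e).starProjection

variable {q} {e : H}

theorem isClosed_startSpace : IsClosed (startSpace q e : Set (FockSpace q H)) :=
  Submodule.isClosed_topologicalClosure _

theorem startSpan_le_startSpace : startSpan q e ≤ startSpace q e :=
  Submodule.le_topologicalClosure _

theorem creation_mem_startSpan {f : H} (hf : ⟪e, f⟫_ℝ = 0) (v : FockSpace q H) :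
    creation q f v ∈ startSpan q e :=
  Submodule.subset_span ⟨f, v, hf, rfl⟩

theorem startSpace_induction {p : FockSpace q H → Prop} (hp : IsClosed {x | p x})
    (h : ∀ x ∈ startSpan q e, p x) {x : FockSpace q H} (hx : x ∈ startSpace q e) : p x :=
  closure_minimal (s := (startSpan q e : Set (FockSpace q H))) h hp hx

theorem startProj_mem (x : FockSpace q H) : startProj q e x ∈ startSpace q e :=
  haveI : CompleteSpace (startSpace q e) := isClosed_startSpace.completeSpace_coe
  Submodule.starProjection_apply_mem _ _

theorem startProj_eq_self {x : FockSpace q H} (hx : x ∈ startSpace q e) : startProj q e x = x :=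
  haveI : CompleteSpace (startSpace q e) := isClosed_startSpace.completeSpace_coe
  Submodule.starProjection_eq_self_iff.2 hx

theorem inner_startProj (x y : FockSpace q H) :
    ⟪startProj q e x, y⟫_ℂ = ⟪x, startProj q e y⟫_ℂ :=
  haveI : CompleteSpace (startSpace q e) := isClosed_startSpace.completeSpace_coe
  Submodule.inner_starProjection_left_eq_right _ _ _

theorem norm_startProj_le (x : FockSpace q H) : ‖startProj q e x‖ ≤ ‖x‖ :=
  haveI : CompleteSpace (startSpace q e) := isClosed_startSpace.completeSpace_coe
  Submodule.norm_starProjection_apply_le _ _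

theorem startProj_mul_comm (T : FockSpace q H →L[ℂ] FockSpace q H) (hT : star T = T)
    (h : ∀ x ∈ startSpace q e, T x ∈ startSpace q e) :
    startProj q e * T = T * startProj q e :=
  haveI : CompleteSpace (startSpace q e) := isClosed_startSpace.completeSpace_coe
  starProjection_mul_comm _ _ h (by rwa [hT])

theorem creation_zero : creation q (0 : H) = 0 := by
  simpa using creation_smul q (0 : ℝ) (0 : H)

theorem creation_sum {ι : Type*} (s : Finset ι) (f : ι → H) :
    creation q (∑ i ∈ s, f i) = ∑ i ∈ s, creation q (f i) := by
  classical
  induction s using Finset.induction_on with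
  | empty => simp [creation_zero]
  | insert i s hi ih => rw [Finset.sum_insert hi, Finset.sum_insert hi, creation_add, ih]

/-- Elements of the span can be written with orthonormal first letters. -/
theorem exists_row_of_mem_startSpan {x : FockSpace q H} (hx : x ∈ startSpan q e) :
    ∃ (n : ℕ) (f : Fin n → H) (w : Fin n → FockSpace q H), Orthonormal ℝ f ∧
      (∀ i, ⟪e, f i⟫_ℝ = 0) ∧ x = ∑ i, creation q (f i) (w i) := by
  have h1 : ∃ (n : ℕ) (f : Fin n → H) (w : Fin n → FockSpace q H),
      (∀ i, ⟪e, f i⟫_ℝ = 0) ∧ x = ∑ i, creation q (f i) (w i) := by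
    induction hx using Submodule.span_induction with
    | mem x hx =>
      obtain ⟨f, v, hf, rfl⟩ := hx
      exact ⟨1, fun _ => f, fun _ => v, fun _ => hf, by simp⟩
    | zero => exact ⟨0, Fin.elim0, Fin.elim0, fun i => i.elim0, by simp⟩
    | add x y _ _ hx hy =>
      obtain ⟨n, f, w, hf, rfl⟩ := hx
      obtain ⟨m, g, v, hg, rfl⟩ := hy
      refine ⟨n + m, Fin.append f g, Fin.append w v, fun i => ?_, ?_⟩
      · refine Fin.addCases (fun i => ?_) (fun i => ?_) i
        · simpa using hf i
        · simpa using hg i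
      · simp [Fin.sum_univ_add]
    | smul a x _ hx =>
      obtain ⟨n, f, w, hf, rfl⟩ := hx
      exact ⟨n, f, fun i => a • w i, hf, by simp [Finset.smul_sum]⟩
  obtain ⟨n, f, w, hf, rfl⟩ := h1
  set E := Submodule.span ℝ (Set.range f) with hE
  have hfE (i : Fin n) : f i ∈ E := Submodule.subset_span ⟨i, rfl⟩
  have : FiniteDimensional ℝ E := FiniteDimensional.span_of_finite ℝ (Set.finite_range f)
  have horth : ∀ x ∈ E, ⟪e, x⟫_ℝ = 0 := by
    intro x hx
    induction hx using Submodule.span_induction with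
    | mem x hx => obtain ⟨i, rfl⟩ := hx; exact hf i
    | zero => simp
    | add x y _ _ hx hy => rw [inner_add_right, hx, hy, add_zero]
    | smul a x _ hx => rw [real_inner_smul_right, hx, mul_zero]
  let b := stdOrthonormalBasis ℝ E
  refine ⟨_, fun k => (b k : H), fun k => ∑ i, ((⟪(b k : H), f i⟫_ℝ : ℝ) : ℂ) • w i, ?_,
    fun k => horth _ (b k).2, ?_⟩
  · exact b.orthonormal.comp_linearIsometry E.subtypeₗᵢ
  · simp only [map_sum, map_smul]
    rw [Finset.sum_comm]
    refine Finset.sum_congr rfl fun i _ => ?_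
    have h2 : f i = ∑ k, ⟪(b k : H), f i⟫_ℝ • (b k : H) := by
      have := congrArg (E.subtype) (b.sum_repr' ⟨f i, hfE i⟩)
      simpa using this.symm
    conv_lhs => rw [h2]
    simp [creation_sum, creation_smul]

theorem orthogonal_comm {f : H} (hf : ⟪e, f⟫_ℝ = 0) : ⟪f, e⟫_ℝ = 0 := by
  rw [real_inner_comm, hf]

theorem annihilation_creation_of_orthogonal {f : H} (hf : ⟪e, f⟫_ℝ = 0) (v : FockSpace q H) :
    annihilation q e (creation q f v) = ((q : ℝ) : ℂ) • creation q f (annihilation q e v) := by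
  simp [annihilation_creation_apply, hf]

theorem map_mem_startSpace {T : FockSpace q H →L[ℂ] FockSpace q H}
    (hT : ∀ f : H, ⟪e, f⟫_ℝ = 0 → ∀ v, T (creation q f v) ∈ startSpace q e) {x : FockSpace q H}
    (hx : x ∈ startSpace q e) : T x ∈ startSpace q e := by
  refine startSpace_induction (p := fun x => T x ∈ startSpace q e)
    (isClosed_startSpace.preimage T.continuous) (fun x hx => ?_) hx
  clear * - hT hx
  induction hx using Submodule.span_induction with
  | mem x hx =>
    obtain ⟨f, v, hf, rfl⟩ := hx
    exact hT f hf v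
  | zero => simp
  | add x y _ _ hx hy => rw [map_add]; exact add_mem hx hy
  | smul a x _ hx => rw [map_smul]; exact Submodule.smul_mem _ _ hx

theorem annihilation_mem_startSpace {x : FockSpace q H} (hx : x ∈ startSpace q e) :
    annihilation q e x ∈ startSpace q e := by
  refine map_mem_startSpace (fun f hf v => ?_) hx
  rw [annihilation_creation_of_orthogonal hf]
  exact Submodule.smul_mem _ _ (startSpan_le_startSpace (creation_mem_startSpan hf _))

/-- On tensors whose first letter is orthogonal to `e` the annihilation operator `a(e)` has to pass
that letter, so that its norm is of the order of `q`. -/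
theorem norm_annihilation_le_of_mem_startSpace (hq : |(q : ℝ)| ≤ 1 / 100) (he : ‖e‖ = 1)
    {x : FockSpace q H} (hx : x ∈ startSpace q e) : ‖annihilation q e x‖ ≤ (1 / 8) * ‖x‖ := by
  refine startSpace_induction (p := fun x => ‖annihilation q e x‖ ≤ (1 / 8) * ‖x‖)
    (isClosed_le (by fun_prop) (by fun_prop)) (fun x hx => ?_) hx
  obtain ⟨n, f, w, hf, hfe, rfl⟩ := exists_row_of_mem_startSpan hx
  have h1 : annihilation q e (∑ i, creation q (f i) (w i)) =
      ((q : ℝ) : ℂ) • ∑ i, creation q (f i) (annihilation q e (w i)) := by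
    rw [map_sum, Finset.smul_sum]
    exact Finset.sum_congr rfl fun i _ => annihilation_creation_of_orthogonal (hfe i) _
  rw [h1, norm_smul, Complex.norm_real, Real.norm_eq_abs]
  have h2 := norm_row_map_le hq hf (annihilation q e) w
  have h3 := norm_annihilation_le_two hq he
  calc _ ≤ (1 / 100) * (2 * 2 * ‖∑ i, creation q (f i) (w i)‖) := by
        refine mul_le_mul hq (h2.trans ?_) (norm_nonneg _) (by norm_num)
        gcongr
    _ ≤ _ := by nlinarith [norm_nonneg (∑ i, creation q (f i) (w i))]

theorem rightGaussian_mem_startSpace (he : ‖e‖ = 1) {x : FockSpace q H}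
    (hx : x ∈ startSpace q e) : rightGaussian q e x ∈ startSpace q e := by
  refine map_mem_startSpace (fun f hf v => ?_) hx
  rw [← mul_apply_eq_comp, rightGaussian_mul_creation he, orthogonal_comm hf]
  simpa using startSpan_le_startSpace (creation_mem_startSpan hf (rightGaussian q e v))

theorem numberOp_mem_startSpace {x : FockSpace q H}
    (hx : x ∈ startSpace q e) : numberOp q e x ∈ startSpace q e := by
  refine map_mem_startSpace (fun f hf v => ?_) hx
  rw [← mul_apply_eq_comp, numberOp_mul_creation]
  exact Submodule.smul_mem _ _ (startSpan_le_startSpace (creation_mem_startSpan hf _))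

theorem startProj_rightGaussian (he : ‖e‖ = 1) :
    startProj q e * rightGaussian q e = rightGaussian q e * startProj q e :=
  startProj_mul_comm _ (star_rightGaussian q e) fun _ hx => rightGaussian_mem_startSpace he hx

theorem startProj_numberOp (he : ‖e‖ = 1) :
    startProj q e * numberOp q e = numberOp q e * startProj q e :=
  startProj_mul_comm _ (star_numberOp he) fun _ hx => numberOp_mem_startSpace hx

/-- The annihilation operator `a(e)` preserves the closed span of the tensors whose first letter is
orthogonal to `e`, so that `c(e)` preserves its orthocomplement. -/
theorem startProj_creation (x : FockSpace q H) :
    startProj q e (creation q e x) = startProj q e (creation q e (startProj q e x)) := by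
  refine ext_inner_left ℂ fun z => ?_
  rw [← inner_startProj, ← inner_startProj, ← inner_annihilation_left, ← inner_annihilation_left,
    ← inner_startProj, startProj_eq_self (annihilation_mem_startSpace (startProj_mem z))]

theorem annihilation_startProj {f : H} (hf : ⟪e, f⟫_ℝ = 0) (x : FockSpace q H) :
    annihilation q f (startProj q e x) = annihilation q f x := by
  refine ext_inner_left ℂ fun z => ?_
  rw [← inner_creation_left, ← inner_creation_left, ← inner_startProj,
    startProj_eq_self (startSpan_le_startSpace (creation_mem_startSpan hf z))]

theorem inner_le_of_mem_startSpace {x z : FockSpace q H} (hx : x ∈ startSpace q e) :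
    ‖⟪x, z⟫_ℂ‖ ≤ ‖x‖ * ‖startProj q e z‖ := by
  rw [← startProj_eq_self hx, inner_startProj, startProj_eq_self hx]
  exact norm_inner_le_norm _ _

/-- A right `q`-Gaussian element preserves, up to the number operator, the orthogonality to the
tensors whose first letter is orthogonal to `e`. -/
theorem norm_startProj_rightGaussian_le (hq : |(q : ℝ)| ≤ 1 / 100) (he : ‖e‖ = 1) (h : H)
    (z : FockSpace q H) :
    ‖startProj q e (rightGaussian q h z)‖ ≤
      2 * ‖rightGaussian q h‖ * ‖startProj q e z‖ + 2 * ‖h‖ * ‖numberOp q e z‖ := by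
  set C := 2 * ‖rightGaussian q h‖ * ‖startProj q e z‖ + 2 * ‖h‖ * ‖numberOp q e z‖ with hC
  have hC0 : 0 ≤ C := by positivity
  have key : ∀ x ∈ startSpace q e, ‖⟪x, rightGaussian q h z⟫_ℂ‖ ≤ C * ‖x‖ := by
    intro x hx
    refine startSpace_induction (p := fun x => ‖⟪x, rightGaussian q h z⟫_ℂ‖ ≤ C * ‖x‖)
      (isClosed_le (by fun_prop) (by fun_prop)) (fun x hx => ?_) hx
    obtain ⟨n, f, w, hf, hfe, rfl⟩ := exists_row_of_mem_startSpan hx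
    set x := ∑ i, creation q (f i) (w i) with hxdef
    set x₁ := ∑ i, creation q (f i) (rightGaussian q h (w i)) with hx₁
    set y := ∑ i, ((⟪f i, h⟫_ℝ : ℝ) : ℂ) • w i with hy
    have h1 : rightGaussian q h x = x₁ + numberOp q e y := by
      rw [hxdef, hx₁, hy, map_sum, map_sum, ← Finset.sum_add_distrib]
      refine Finset.sum_congr rfl fun i _ => ?_
      rw [← mul_apply_eq_comp, rightGaussian_mul_creation he]
      simp
    have h2 : ⟪x, rightGaussian q h z⟫_ℂ = ⟪x₁, z⟫_ℂ + ⟪y, numberOp q e z⟫_ℂ := by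
      rw [← ContinuousLinearMap.adjoint_inner_left, ← ContinuousLinearMap.star_eq_adjoint,
        star_rightGaussian, h1, inner_add_left, ← ContinuousLinearMap.adjoint_inner_left
          (numberOp q e), ← ContinuousLinearMap.star_eq_adjoint, star_numberOp he]
    have hx₁mem : x₁ ∈ startSpace q e := startSpan_le_startSpace
      (sum_mem fun i _ => creation_mem_startSpan (hfe i) _)
    have h3 : ‖x₁‖ ≤ 2 * ‖rightGaussian q h‖ * ‖x‖ := norm_row_map_le hq hf _ w
    have h4 : ‖y‖ ≤ 2 * ‖h‖ * ‖x‖ := by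
      refine le_of_sq_le_sq ?_ (by positivity)
      have h5 : ‖y‖ ≤ ∑ i, |⟪f i, h⟫_ℝ| * ‖w i‖ := by
        refine (norm_sum_le _ _).trans_eq (Finset.sum_congr rfl fun i _ => ?_)
        rw [norm_smul, Complex.norm_real, Real.norm_eq_abs]
      have h6 : ∑ i, |⟪f i, h⟫_ℝ| ^ 2 ≤ ‖h‖ ^ 2 := by
        have := hf.sum_inner_products_le (x := h) (s := Finset.univ)
        simpa using this
      calc ‖y‖ ^ 2 ≤ (∑ i, |⟪f i, h⟫_ℝ| * ‖w i‖) ^ 2 := by gcongr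
        _ ≤ (∑ i, |⟪f i, h⟫_ℝ| ^ 2) * ∑ i, ‖w i‖ ^ 2 := Finset.sum_mul_sq_le_sq_mul_sq _ _ _
        _ ≤ ‖h‖ ^ 2 * (2 * ‖x‖ ^ 2) := by
            gcongr
            exact sum_norm_sq_le_norm_row_sq hq hf w
        _ ≤ _ := by nlinarith [mul_nonneg (sq_nonneg ‖h‖) (sq_nonneg ‖x‖)]
    rw [h2]
    calc _ ≤ ‖⟪x₁, z⟫_ℂ‖ + ‖⟪y, numberOp q e z⟫_ℂ‖ := norm_add_le _ _
      _ ≤ ‖x₁‖ * ‖startProj q e z‖ + ‖y‖ * ‖numberOp q e z‖ :=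
          add_le_add (inner_le_of_mem_startSpace hx₁mem) (norm_inner_le_norm _ _)
      _ ≤ (2 * ‖rightGaussian q h‖ * ‖x‖) * ‖startProj q e z‖ +
            (2 * ‖h‖ * ‖x‖) * ‖numberOp q e z‖ := by gcongr
      _ = C * ‖x‖ := by rw [hC]; ring
  set p := startProj q e (rightGaussian q h z) with hp
  have h1 := key p (startProj_mem _)
  have h2 : ⟪p, rightGaussian q h z⟫_ℂ = ((‖p‖ ^ 2 : ℝ) : ℂ) := by
    have h3 : startProj q e p = p := startProj_eq_self (startProj_mem _)
    rw [← h3, inner_startProj, h3, ← hp, inner_self_eq_norm_sq_to_K]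
    simp
  rw [h2, Complex.norm_real, Real.norm_of_nonneg (by positivity)] at h1
  rcases (norm_nonneg p).eq_or_lt with h3 | h3
  · rw [← h3]; exact hC0
  · nlinarith

theorem norm_creation_sq_ge (hq : |(q : ℝ)| ≤ 1 / 100) (he : ‖e‖ = 1) (w : FockSpace q H) :
    ‖w‖ ^ 2 ≤ 2 * ‖creation q e w‖ ^ 2 := by
  have := sum_norm_sq_le_norm_row_sq (n := 1) (f := fun _ => e) hq
    (by simp [he]) (fun _ => w)
  simpa using this

/-- The vacuum, the tensors starting with `e` and the tensors starting with a letter orthogonal to `e`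
together control the norm. -/
theorem norm_le_vacuum_annihilation_startProj (hq : |(q : ℝ)| ≤ 1 / 100) (he : ‖e‖ = 1)
    (z : FockSpace q H) :
    ‖z‖ ≤ 4 * (‖⟪vacuum q H, z⟫_ℂ‖ + ‖annihilation q e z‖ + ‖startProj q e z‖) := by
  set C := ‖⟪vacuum q H, z⟫_ℂ‖ + ‖annihilation q e z‖ + ‖startProj q e z‖ with hC
  let S : Submodule ℂ (FockSpace q H) :=
    Submodule.span ℂ {vacuum q H} ⊔ (LinearMap.range (creation q e).toLinearMap ⊔ startSpan q e)
  have hS1 : vacuum q H ∈ S := Submodule.mem_sup_left (Submodule.mem_span_singleton_self _)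
  have hS2 (v : FockSpace q H) : creation q e v ∈ S :=
    Submodule.mem_sup_right (Submodule.mem_sup_left ⟨v, rfl⟩)
  have hS3 {f : H} (hf : ⟪e, f⟫_ℝ = 0) (v : FockSpace q H) : creation q f v ∈ S :=
    Submodule.mem_sup_right (Submodule.mem_sup_right (creation_mem_startSpan hf v))
  have key : ∀ v ∈ S, ‖⟪v, z⟫_ℂ‖ ≤ 4 * C * ‖v‖ := by
    intro v hv
    obtain ⟨a, ha, b, hb, rfl⟩ := Submodule.mem_sup.1 hv
    obtain ⟨α, rfl⟩ := Submodule.mem_span_singleton.1 ha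
    obtain ⟨b, ⟨w, rfl⟩, x, hx, rfl⟩ := Submodule.mem_sup.1 hb
    change ‖⟪α • vacuum q H + (creation q e w + x), z⟫_ℂ‖ ≤ 4 * C * ‖α • vacuum q H +
      (creation q e w + x)‖
    have hxX := startSpan_le_startSpace hx
    have h1 : ⟪vacuum q H, creation q e w + x⟫_ℂ = 0 := by
      rw [inner_add_right, ← inner_annihilation_left, annihilation_vacuum, inner_zero_left, zero_add]
      obtain ⟨n, f, w, hf, hfe, rfl⟩ := exists_row_of_mem_startSpan hx
      rw [inner_sum]
      refine Finset.sum_eq_zero fun i _ => ?_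
      rw [← inner_annihilation_left, annihilation_vacuum, inner_zero_left]
    have h2 : ‖α • vacuum q H + (creation q e w + x)‖ ^ 2 =
        ‖α‖ ^ 2 + ‖creation q e w + x‖ ^ 2 := by
      have := norm_add_sq_eq_norm_sq_add_norm_sq_of_inner_eq_zero (𝕜 := ℂ) (α • vacuum q H)
        (creation q e w + x) (by rw [inner_smul_left, h1, mul_zero])
      rw [pow_two, this, norm_smul, norm_vacuum]
      ring
    have h3 : ‖creation q e w + x‖ ^ 2 = ‖creation q e w‖ ^ 2 +
        2 * (⟪w, annihilation q e x⟫_ℂ).re + ‖x‖ ^ 2 := by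
      rw [@norm_add_sq ℂ, inner_creation_left]
      rfl
    have h4 : |(⟪w, annihilation q e x⟫_ℂ).re| ≤ ‖w‖ * ((1 / 8) * ‖x‖) :=
      (Complex.abs_re_le_norm _).trans ((norm_inner_le_norm _ _).trans
        (mul_le_mul_of_nonneg_left (norm_annihilation_le_of_mem_startSpace hq he hxX)
          (norm_nonneg _)))
    have h5 := (abs_le.1 h4).1
    have h6 := norm_creation_sq_ge hq he w
    set N := ‖α • vacuum q H + (creation q e w + x)‖ with hN
    have hN0 : 0 ≤ N := norm_nonneg _
    have h7 : ‖w‖ ^ 2 + ‖x‖ ^ 2 + ‖α‖ ^ 2 ≤ (2 * N) ^ 2 := by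
      nlinarith [sq_nonneg (‖w‖ - ‖x‖), sq_nonneg ‖α‖, sq_nonneg ‖w‖, sq_nonneg ‖x‖]
    have h8 : ‖w‖ ≤ 2 * N := abs_le_of_sq_le_sq' (by nlinarith [sq_nonneg ‖α‖, sq_nonneg ‖x‖])
      (by positivity) |>.2
    have h9 : ‖x‖ ≤ 2 * N := abs_le_of_sq_le_sq' (by nlinarith [sq_nonneg ‖α‖, sq_nonneg ‖w‖])
      (by positivity) |>.2
    have h10 : ‖α‖ ≤ 2 * N := abs_le_of_sq_le_sq' (by nlinarith [sq_nonneg ‖x‖, sq_nonneg ‖w‖])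
      (by positivity) |>.2
    rw [inner_add_left, inner_add_left, inner_smul_left, inner_creation_left]
    calc _ ≤ ‖α‖ * ‖⟪vacuum q H, z⟫_ℂ‖ + (‖w‖ * ‖annihilation q e z‖ + ‖x‖ * ‖startProj q e z‖) := by
          refine (norm_add_le _ _).trans (add_le_add ?_ ((norm_add_le _ _).trans (add_le_add
            (norm_inner_le_norm _ _) (inner_le_of_mem_startSpace hxX))))
          rw [norm_mul, RCLike.norm_conj]
      _ ≤ (2 * N) * ‖⟪vacuum q H, z⟫_ℂ‖ + ((2 * N) * ‖annihilation q e z‖ +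
            (2 * N) * ‖startProj q e z‖) := by gcongr
      _ = 2 * N * C := by rw [hC]; ring
      _ ≤ 4 * C * N := by
          have : 0 ≤ N * C := by positivity
          nlinarith
  have key2 : ∀ v : FockSpace q H, ‖⟪v, z⟫_ℂ‖ ≤ 4 * C * ‖v‖ := by
    intro v
    have hv : v ∈ S.topologicalClosure := by
      refine mem_of_tensor_mem q (Submodule.isClosed_topologicalClosure _) (fun l => ?_) v
      refine Submodule.le_topologicalClosure _ ?_
      cases l with
      | nil => simpa using hS1
      | cons k l =>
        have hk : k = ⟪e, k⟫_ℝ • e + (k - ⟪e, k⟫_ℝ • e) := by abel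
        rw [tensor_cons, hk, creation_add, creation_smul]
        refine S.add_mem (S.smul_mem _ (hS2 _)) (hS3 ?_ _)
        rw [inner_sub_right, real_inner_smul_right, real_inner_self_eq_norm_sq, he]
        ring
    exact closure_minimal (s := (S : Set (FockSpace q H)))
      (t := {v | ‖⟪v, z⟫_ℂ‖ ≤ 4 * C * ‖v‖}) key (isClosed_le (by fun_prop) (by fun_prop)) hv
  have h1 := key2 z
  rw [inner_self_eq_norm_sq_to_K] at h1
  simp only [norm_pow, Complex.coe_algebraMap, Complex.norm_real, norm_norm] at h1
  rcases (norm_nonneg z).eq_or_lt with h3 | h3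
  · rw [← h3]; positivity
  · nlinarith

end Start

/-! ### Partitions in diffuse von Neumann algebras -/

section Diffuse

variable {K : Type*} [NormedAddCommGroup K] [InnerProductSpace ℂ K] [CompleteSpace K]

theorem inner_proj_left {p : K →L[ℂ] K} (hp : IsStarProjection p) (x y : K) :
    ⟪p x, y⟫_ℂ = ⟪x, p y⟫_ℂ := by
  rw [← ContinuousLinearMap.adjoint_inner_right, ← ContinuousLinearMap.star_eq_adjoint,
    hp.isSelfAdjoint.star_eq]

theorem proj_apply_apply {p : K →L[ℂ] K} (hp : IsStarProjection p) (x : K) : p (p x) = p x := by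
  rw [← mul_apply_eq_comp, hp.isIdempotentElem.eq]

theorem norm_proj_sq {p : K →L[ℂ] K} (hp : IsStarProjection p) (x : K) :
    ‖p x‖ ^ 2 = (⟪x, p x⟫_ℂ).re := by
  rw [@norm_sq_eq_re_inner ℂ, inner_proj_left hp, proj_apply_apply hp]
  rfl

theorem mul_proj_eq {p r : K →L[ℂ] K} (hp : IsStarProjection p) (hr : IsStarProjection r)
    (h : p * r = r) : r * p = r := by
  have := congrArg star h
  rwa [star_mul, hp.isSelfAdjoint.star_eq, hr.isSelfAdjoint.star_eq] at this

theorem norm_sub_proj_sq {p r : K →L[ℂ] K} (hp : IsStarProjection p) (hr : IsStarProjection r)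
    (h : p * r = r) (x : K) : ‖(p - r) x‖ ^ 2 = ‖p x‖ ^ 2 - ‖r x‖ ^ 2 := by
  rw [norm_proj_sq (hr.sub_of_mul_eq_right hp h), norm_proj_sq hp, norm_proj_sq hr, sub_apply,
    inner_sub_right, Complex.sub_re]

variable {C : VonNeumannAlgebra K}

/-- In a diffuse von Neumann algebra every nonzero projection has nonzero subprojections on which a
given vector state is arbitrarily small. -/
theorem IsDiffuse.exists_small (hC : IsDiffuse C) (Ω : K) {p : K →L[ℂ] K} (hp : IsStarProjection p)
    (hpC : p ∈ C) (hp0 : p ≠ 0) {ε : ℝ} (hε : 0 < ε) :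
    ∃ r ∈ C, IsStarProjection r ∧ p * r = r ∧ r ≠ 0 ∧ ‖r Ω‖ ^ 2 ≤ ε := by
  have key : ∀ k : ℕ, ∃ r ∈ C, IsStarProjection r ∧ p * r = r ∧ r ≠ 0 ∧
      ‖r Ω‖ ^ 2 ≤ ‖p Ω‖ ^ 2 * (1 / 2) ^ k := by
    intro k
    induction k with
    | zero => exact ⟨p, hpC, hp, hp.isIdempotentElem.eq, hp0, by simp⟩
    | succ k ih =>
      obtain ⟨r, hrC, hr, hpr, hr0, hle⟩ := ih
      obtain ⟨t, htC, ht, hrt, ht0, htr⟩ := hC r hrC hr hr0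
      have h1 := norm_sub_proj_sq hr ht hrt Ω
      rcases le_total (‖t Ω‖ ^ 2) (‖(r - t) Ω‖ ^ 2) with h2 | h2
      · refine ⟨t, htC, ht, ?_, ht0, ?_⟩
        · rw [← hrt, ← mul_assoc, hpr]
        · rw [pow_succ (1 / 2 : ℝ)]; linarith
      · refine ⟨r - t, sub_mem hrC htC, ht.sub_of_mul_eq_right hr hrt, ?_, ?_, ?_⟩
        · rw [mul_sub, hpr, ← hrt, ← mul_assoc, hpr]
        · exact sub_ne_zero.2 htr.symm
        · rw [pow_succ (1 / 2 : ℝ)]; linarith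
  have hlim : Tendsto (fun k : ℕ => ‖p Ω‖ ^ 2 * (1 / 2 : ℝ) ^ k) atTop (𝓝 (‖p Ω‖ ^ 2 * 0)) :=
    Tendsto.const_mul _ (tendsto_pow_atTop_nhds_zero_of_lt_one (by norm_num) (by norm_num))
  rw [mul_zero] at hlim
  obtain ⟨k, hk⟩ := (hlim.eventually (ge_mem_nhds hε)).exists
  obtain ⟨r, hrC, hr, hpr, hr0, hle⟩ := key k
  exact ⟨r, hrC, hr, hpr, hr0, hle.trans hk⟩

/-- In a diffuse von Neumann algebra every projection which is large in a given vector state has a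
subprojection of a prescribed size. -/
theorem IsDiffuse.exists_maximal (hC : IsDiffuse C) (Ω : K) {p : K →L[ℂ] K}
    (hp : IsStarProjection p) (hpC : p ∈ C) {ε : ℝ} (hε : 0 < ε) :
    ∃ r ∈ C, IsStarProjection r ∧ p * r = r ∧ ‖r Ω‖ ^ 2 ≤ ε ∧ (r = p ∨ ε ≤ ‖r Ω‖ ^ 2) := by
  -- The ranges of the subprojections of `p` in `C` on which the state is at most `ε`.
  let S : Set (Submodule ℂ K) := {U | IsClosed (U : Set K) ∧
    (∀ T ∈ C.commutant, ∀ x ∈ U, T x ∈ U) ∧ (∀ x ∈ U, p x = x) ∧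
    ∀ x ∈ U, ‖⟪x, Ω⟫_ℂ‖ ^ 2 ≤ ε * ‖x‖ ^ 2}
  have hbot : (⊥ : Submodule ℂ K) ∈ S := by
    refine ⟨isClosed_singleton, ?_, ?_, ?_⟩ <;> simp
  obtain ⟨U, hU⟩ : ∃ U, Maximal (· ∈ S) U := by
    refine zorn_le₀ S fun c hc hchain => ?_
    rcases c.eq_empty_or_nonempty with rfl | hne
    · exact ⟨⊥, hbot, by simp⟩
    have hdir : ∀ x ∈ sSup c, ∃ U ∈ c, x ∈ U := fun x hx =>
      (Submodule.mem_sSup_of_directed hne hchain.directedOn).1 hx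
    have hcl : ∀ x ∈ (sSup c).topologicalClosure, x ∈ closure ((sSup c : Submodule ℂ K) : Set K) :=
      fun x hx => hx
    refine ⟨(sSup c).topologicalClosure,
      ⟨Submodule.isClosed_topologicalClosure _, fun T hT x hx => ?_, fun x hx => ?_, fun x hx => ?_⟩,
      fun U hU => (le_sSup hU).trans (Submodule.le_topologicalClosure _)⟩
    · refine closure_minimal (t := T ⁻¹' ((sSup c).topologicalClosure : Set K)) (fun y hy => ?_)
        ((Submodule.isClosed_topologicalClosure _).preimage T.continuous) (hcl x hx)
      obtain ⟨U, hU, hyU⟩ := hdir y hy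
      exact Submodule.le_topologicalClosure _ (le_sSup hU ((hc hU).2.1 T hT y hyU))
    · refine closure_minimal (t := {x | p x = x}) (fun y hy => ?_)
        (isClosed_eq (by fun_prop) (by fun_prop)) (hcl x hx)
      obtain ⟨U, hU, hyU⟩ := hdir y hy
      exact (hc hU).2.2.1 y hyU
    · refine closure_minimal (t := {x | ‖⟪x, Ω⟫_ℂ‖ ^ 2 ≤ ε * ‖x‖ ^ 2}) (fun y hy => ?_)
        (isClosed_le (by fun_prop) (by fun_prop)) (hcl x hx)
      obtain ⟨U, hU, hyU⟩ := hdir y hy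
      exact (hc hU).2.2.2 y hyU
  obtain ⟨hUc, hUinv, hUp, hUε⟩ := hU.prop
  have : CompleteSpace U := hUc.completeSpace_coe
  set r := U.starProjection with hr
  have hrproj : IsStarProjection r := isStarProjection_starProjection
  have hrU : ∀ x, r x ∈ U := fun x => Submodule.starProjection_apply_mem _ _
  have hrx : ∀ x ∈ U, r x = x := fun x hx => Submodule.starProjection_eq_self_iff.2 hx
  have hrC : r ∈ C := by
    refine (VonNeumannAlgebra.IsStarProjection.mem_iff hrproj C).2 fun T hT x hx => ?_
    obtain ⟨y, rfl⟩ := hx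
    exact ⟨T (r y), hrx _ (hUinv T hT _ (hrU y))⟩
  have hpr : p * r = r := by
    ext x
    exact hUp _ (hrU x)
  have hrp : r * p = r := mul_proj_eq hp hrproj hpr
  have hrε : ‖r Ω‖ ^ 2 ≤ ε := by
    have h1 := hUε (r Ω) (hrU Ω)
    have h2 : ⟪r Ω, Ω⟫_ℂ = ((‖r Ω‖ ^ 2 : ℝ) : ℂ) := by
      rw [← proj_apply_apply hrproj, inner_proj_left hrproj, inner_self_eq_norm_sq_to_K,
        proj_apply_apply hrproj]
      simp
    rw [h2, Complex.norm_real, Real.norm_of_nonneg (by positivity)] at h1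
    rcases (sq_nonneg ‖r Ω‖).eq_or_lt with h3 | h3
    · rw [← h3]; exact hε.le
    · nlinarith
  refine ⟨r, hrC, hrproj, hpr, hrε, ?_⟩
  by_contra! hcon
  obtain ⟨hne, hlt⟩ := hcon
  obtain ⟨t, htC, ht, hpt, ht0, htε⟩ := hC.exists_small Ω (hrproj.sub_of_mul_eq_right hp hpr)
    (sub_mem hpC hrC) (sub_ne_zero.2 hne.symm) (sub_pos.2 hlt)
  have hrt : r * t = 0 := by
    rw [← hpt, ← mul_assoc, mul_sub, hrp, hrproj.isIdempotentElem.eq, sub_self, zero_mul]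
  have htr : t * r = 0 := by
    have := congrArg star hrt
    rwa [star_mul, hrproj.isSelfAdjoint.star_eq, ht.isSelfAdjoint.star_eq, star_zero] at this
  have hpt' : p * t = t := by
    have h1 : p * (p - r) = p - r := by rw [mul_sub, hp.isIdempotentElem.eq, hpr]
    rw [← hpt, ← mul_assoc, h1]
  have hrt' : IsStarProjection (r + t) := by
    refine ⟨?_, hrproj.isSelfAdjoint.add ht.isSelfAdjoint⟩
    rw [IsIdempotentElem, mul_add, add_mul, add_mul, hrproj.isIdempotentElem.eq,
      ht.isIdempotentElem.eq, hrt, htr]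
    simp
  let U' : Submodule ℂ K := LinearMap.ker ((r + t - 1 : K →L[ℂ] K) : K →ₗ[ℂ] K)
  have hU' : ∀ x, x ∈ U' ↔ (r + t) x = x := by
    intro x
    change (r + t - 1) x = 0 ↔ _
    rw [sub_apply, sub_eq_zero]
    rfl
  have hU'S : U' ∈ S := by
    refine ⟨ContinuousLinearMap.isClosed_ker (r + t - 1), fun T hT x hx => ?_, fun x hx => ?_,
      fun x hx => ?_⟩
    · rw [hU'] at hx ⊢
      have h1 := VonNeumannAlgebra.mem_commutant_iff.1 hT (r + t) (add_mem hrC htC)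
      rw [← mul_apply_eq_comp, h1, mul_apply_eq_comp, hx]
    · rw [hU'] at hx
      have h1 : p * (r + t) = r + t := by rw [mul_add, hpr, hpt']
      rw [← hx, ← mul_apply_eq_comp, h1]
    · rw [hU'] at hx
      have h1 : ‖(r + t) Ω‖ ^ 2 ≤ ε := by
        have h2 := norm_proj_sq hrproj Ω
        have h3 := norm_proj_sq ht Ω
        rw [norm_proj_sq hrt', add_apply, inner_add_right, Complex.add_re]
        linarith
      have h2 : ‖⟪x, Ω⟫_ℂ‖ ≤ ‖x‖ * ‖(r + t) Ω‖ := by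
        conv_lhs => rw [← hx, inner_proj_left hrt']
        exact norm_inner_le_norm _ _
      calc ‖⟪x, Ω⟫_ℂ‖ ^ 2 ≤ (‖x‖ * ‖(r + t) Ω‖) ^ 2 := by gcongr
        _ = ‖(r + t) Ω‖ ^ 2 * ‖x‖ ^ 2 := by ring
        _ ≤ ε * ‖x‖ ^ 2 := by gcongr
  have hUU' : U ≤ U' := by
    intro x hx
    rw [hU', add_apply, hrx x hx]
    conv_lhs => rw [← hrx x hx, ← mul_apply_eq_comp t, htr, zero_apply, hrx x hx, add_zero]
  refine ht0 (ContinuousLinearMap.ext fun y => ?_)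
  have h1 : t y ∈ U' := by
    rw [hU', add_apply, ← mul_apply_eq_comp r, hrt, proj_apply_apply ht]
    simp
  have h2 := hrx _ (hU.le_of_ge hU'S hUU' h1)
  rw [← mul_apply_eq_comp, hrt] at h2
  simpa using h2.symm

/-- Maximal subprojections of size at most `ε` have size exactly `ε`, so that `m` of them exhaust a
projection of size at most `m ε`. -/
theorem IsDiffuse.exists_partition_of_le (hC : IsDiffuse C) (Ω : K) {ε : ℝ} (hε : 0 < ε) (m : ℕ) :
    ∀ p ∈ C, IsStarProjection p → ‖p Ω‖ ^ 2 ≤ m * ε → ∃ (n : ℕ) (r : Fin n → K →L[ℂ] K),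
      (∀ i, r i ∈ C ∧ IsStarProjection (r i) ∧ ‖r i Ω‖ ^ 2 ≤ ε) ∧ ∑ i, r i = p := by
  induction m with
  | zero =>
    intro p hpC hp h
    refine ⟨1, fun _ => p, fun _ => ⟨hpC, hp, h.trans ?_⟩, by simp⟩
    simpa using hε.le
  | succ m ih =>
    intro p hpC hp h
    obtain ⟨r, hrC, hr, hpr, hle, hr'⟩ := hC.exists_maximal Ω hp hpC hε
    rcases hr' with rfl | hge
    · exact ⟨1, fun _ => r, fun _ => ⟨hrC, hr, hle⟩, by simp⟩
    · obtain ⟨n, t, ht, hsum⟩ := ih (p - r) (sub_mem hpC hrC) (hr.sub_of_mul_eq_right hp hpr) (by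
        rw [norm_sub_proj_sq hp hr hpr]
        push_cast at h
        linarith)
      refine ⟨n + 1, Fin.cons r t, fun i => ?_, ?_⟩
      · refine Fin.cases ?_ (fun i => ?_) i
        · exact ⟨hrC, hr, hle⟩
        · exact ht i
      · rw [Fin.sum_univ_succ, Fin.cons_zero]
        simp only [Fin.cons_succ]
        rw [hsum, add_sub_cancel]

/-- A diffuse von Neumann algebra has finite partitions of the unit into projections on which a given
vector state is arbitrarily small. -/
theorem IsDiffuse.exists_partition (hC : IsDiffuse C) (Ω : K) {ε : ℝ} (hε : 0 < ε) :
    ∃ (n : ℕ) (r : Fin n → K →L[ℂ] K),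
      (∀ i, r i ∈ C ∧ IsStarProjection (r i) ∧ ‖r i Ω‖ ^ 2 ≤ ε) ∧ ∑ i, r i = 1 := by
  obtain ⟨m, hm⟩ := exists_nat_ge (‖Ω‖ ^ 2 / ε)
  refine hC.exists_partition_of_le Ω hε m 1 (one_mem C) (.one _) ?_
  rw [div_le_iff₀ hε] at hm
  simpa using hm

end Diffuse

/-! ### Compressions of the generator algebra -/

section Compression

variable {q : Set.Ioo (-1 : ℝ) 1} {H : Type*} [NormedAddCommGroup H] [InnerProductSpace ℝ H]
  {e : H}

theorem inner_tensor_of_length_ne {l l' : List H} (h : l.length ≠ l'.length) :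
    ⟪tensor q l, tensor q l'⟫_ℂ = 0 := by
  rw [← List.ofFn_get l, ← List.ofFn_get l', ← coe_word, ← coe_word,
    UniformSpace.Completion.inner_coe, inner_word]
  simp [kernel, h]

theorem norm_tensor_replicate_ge (hq : |(q : ℝ)| ≤ 1 / 100) (he : ‖e‖ = 1) (n : ℕ) :
    (1 / 2) ^ n ≤ ‖tensor q (List.replicate n e)‖ := by
  induction n with
  | zero => simp [norm_vacuum]
  | succ n ih =>
    have h1 := norm_creation_sq_ge hq he (tensor q (List.replicate n e))
    rw [List.replicate_succ, tensor_cons]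
    have h2 : ‖tensor q (List.replicate n e)‖ ≤ 2 * ‖creation q e (tensor q (List.replicate n e))‖ :=
      abs_le_of_sq_le_sq' (by nlinarith [sq_nonneg ‖creation q e (tensor q (List.replicate n e))‖])
        (by positivity) |>.2
    rw [pow_succ]
    linarith

theorem annihilationProd_mem_startSpace (n : ℕ) {x : FockSpace q H} (hx : x ∈ startSpace q e) :
    annihilationProd q (List.replicate n e) x ∈ startSpace q e := by
  induction n with
  | zero => simpa using hx
  | succ n ih =>
    rw [List.replicate_succ, annihilationProd_cons]
    exact annihilation_mem_startSpace ih

theorem norm_annihilationProd_le (hq : |(q : ℝ)| ≤ 1 / 100) (he : ‖e‖ = 1) (n : ℕ)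
    {x : FockSpace q H} (hx : x ∈ startSpace q e) :
    ‖annihilationProd q (List.replicate n e) x‖ ≤ (1 / 8) ^ n * ‖x‖ := by
  induction n with
  | zero => simp
  | succ n ih =>
    rw [List.replicate_succ, annihilationProd_cons, mul_apply_eq_comp, pow_succ']
    have := norm_annihilation_le_of_mem_startSpace hq he (annihilationProd_mem_startSpace n hx)
    linarith

theorem annihilationProd_append (l l' : List H) :
    annihilationProd q (l ++ l') = annihilationProd q l * annihilationProd q l' := by
  simp [annihilationProd]

theorem star_creationProd (l : List H) :
    star (creationProd q l) = annihilationProd q l.reverse := by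
  induction l with
  | nil => simp
  | cons k l ih =>
    rw [creationProd_cons, star_mul, ih, star_creation, List.reverse_cons, annihilationProd_append]
    simp

theorem inner_creationProd (l : List H) (x y : FockSpace q H) :
    ⟪x, creationProd q l y⟫_ℂ = ⟪annihilationProd q l.reverse x, y⟫_ℂ := by
  rw [← star_creationProd, ContinuousLinearMap.star_eq_adjoint,
    ContinuousLinearMap.adjoint_inner_left]

/-- Between tensors whose first letter is orthogonal to `e` the Wick words of `e` decay
exponentially. -/
theorem norm_inner_wick_le (hq : |(q : ℝ)| ≤ 1 / 100) (he : ‖e‖ = 1) (n : ℕ)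
    {x y : FockSpace q H} (hx : x ∈ startSpace q e) (hy : y ∈ startSpace q e) :
    ‖⟪x, wick q (List.replicate n e) y⟫_ℂ‖ ≤ (1 / 4) ^ n * (‖x‖ * ‖y‖) := by
  have h1 : ⟪x, wick q (List.replicate n e) y⟫_ℂ = wickSum (q : ℝ) (List.replicate n e)
      fun I J => ⟪x, creationProd q I (annihilationProd q J y)⟫_ℂ := by
    rw [wick_apply]
    exact wickSum_map (q : ℝ) (innerSL ℂ x).toLinearMap _ _
  rw [h1]
  have hq1 : |(q : ℝ)| ≤ 1 := hq.trans (by norm_num)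
  refine (norm_wickSum_le hq1 _ _ (B := (1 / 8) ^ n * (‖x‖ * ‖y‖)) fun I J hI hJ hl => ?_).trans_eq ?_
  · have hI' : I = List.replicate I.length e :=
      List.eq_replicate_iff.2 ⟨rfl, fun k hk => List.eq_of_mem_replicate (hI k hk)⟩
    have hJ' : J = List.replicate J.length e :=
      List.eq_replicate_iff.2 ⟨rfl, fun k hk => List.eq_of_mem_replicate (hJ k hk)⟩
    rw [List.length_replicate] at hl
    rw [inner_creationProd, hI', hJ', List.reverse_replicate]
    refine (norm_inner_le_norm _ _).trans ?_
    calc _ ≤ ((1 / 8) ^ I.length * ‖x‖) * ((1 / 8) ^ J.length * ‖y‖) :=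
          mul_le_mul (norm_annihilationProd_le hq he _ hx) (norm_annihilationProd_le hq he _ hy)
            (norm_nonneg _) (by positivity)
      _ = _ := by rw [← hl, pow_add]; ring
  · rw [List.length_replicate, ← mul_assoc, ← mul_pow]
    norm_num

variable (q e) in
/-- The span of the Wick words of `e ⊗ ⋯ ⊗ e`. -/
noncomputable def wickSpan : Submodule ℂ (FockSpace q H →L[ℂ] FockSpace q H) :=
  Submodule.span ℂ (Set.range fun n : ℕ => wick q (List.replicate n e))

theorem mem_polynomials_of_mem_wickSpan {P : FockSpace q H →L[ℂ] FockSpace q H}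
    (hP : P ∈ wickSpan q e) : P ∈ polynomials q (Submodule.span ℝ {e}) := by
  have : wickSpan q e ≤ Subalgebra.toSubmodule (polynomials q (Submodule.span ℝ {e})) := by
    refine Submodule.span_le.2 ?_
    rintro _ ⟨n, rfl⟩
    refine wick_mem_polynomials q _ _ fun k hk => ?_
    rw [List.eq_of_mem_replicate hk]
    exact Submodule.mem_span_singleton_self e
  exact this hP

/-- The elements of the generator algebra are `2`-norm limits of combinations of the Wick words of `e`;
no bound on the operator norms is claimed. -/
theorem exists_wickSpan_tendsto {u : FockSpace q H →L[ℂ] FockSpace q H}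
    (hu : u ∈ gaussianAlgebra q (Submodule.span ℝ {e})) :
    ∃ P : ℕ → FockSpace q H →L[ℂ] FockSpace q H, (∀ k, P k ∈ wickSpan q e) ∧
      Tendsto (fun k => P k (vacuum q H)) atTop (𝓝 (u (vacuum q H))) := by
  have h1 := apply_vacuum_mem_closure hu
  obtain ⟨y, hy, hlim⟩ := mem_closure_iff_seq_limit.1 h1
  have h2 (k : ℕ) : ∃ P ∈ wickSpan q e, P (vacuum q H) = y k := by
    have h3 : Submodule.span ℂ (Set.range fun n : ℕ => tensor q (List.replicate n e)) ≤
        (wickSpan q e).map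
          (ContinuousLinearMap.apply ℂ (FockSpace q H) (vacuum q H)).toLinearMap := by
      refine Submodule.span_le.2 ?_
      rintro _ ⟨n, rfl⟩
      exact ⟨wick q (List.replicate n e), Submodule.subset_span ⟨n, rfl⟩, wick_vacuum q _⟩
    exact h3 (hy k)
  choose P hP hPy using h2
  exact ⟨P, hP, by simpa only [hPy] using hlim⟩

/-- The coefficient of the `n`-th Wick word is at most `2 ^ n` times the `2`-norm, and the compression of
that word is at most `4⁻¹ ^ n`. -/
theorem norm_inner_le_of_mem_wickSpan (hq : |(q : ℝ)| ≤ 1 / 100) (he : ‖e‖ = 1)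
    {P : FockSpace q H →L[ℂ] FockSpace q H} (hP : P ∈ wickSpan q e)
    {x y : FockSpace q H} (hx : x ∈ startSpace q e) (hy : y ∈ startSpace q e) :
    ‖⟪x, P y⟫_ℂ‖ ≤ 2 * ‖P (vacuum q H)‖ * (‖x‖ * ‖y‖) := by
  obtain ⟨c, rfl⟩ := Finsupp.mem_span_range_iff_exists_finsupp.1 hP
  set v := (c.sum fun n a => a • wick q (List.replicate n e)) (vacuum q H) with hv
  have hv' : v = ∑ n ∈ c.support, c n • tensor q (List.replicate n e) := by
    rw [hv, Finsupp.sum, sum_apply]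
    simp only [smul_apply, wick_vacuum]
  have h1 : ∀ n ∈ c.support, ‖c n‖ ≤ 2 ^ n * ‖v‖ := by
    intro n hn
    set t := tensor q (List.replicate n e) with ht
    have h2 : ⟪t, v⟫_ℂ = c n * ⟪t, t⟫_ℂ := by
      rw [hv', inner_sum, Finset.sum_eq_single n]
      · rw [inner_smul_right]
      · intro m _ hm
        rw [inner_smul_right, ht, inner_tensor_of_length_ne (by simpa using hm.symm), mul_zero]
      · exact fun h => absurd hn h
    have h3 := norm_inner_le_norm (𝕜 := ℂ) t v
    rw [h2, inner_self_eq_norm_sq_to_K, norm_mul] at h3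
    simp only [norm_pow, Complex.coe_algebraMap, Complex.norm_real, norm_norm] at h3
    have h4 := norm_tensor_replicate_ge hq he n
    rw [← ht] at h4
    have h5 : 0 < ‖t‖ := lt_of_lt_of_le (by positivity) h4
    have h6 : ‖c n‖ * ‖t‖ ≤ ‖v‖ := by
      refine le_of_mul_le_mul_right ?_ h5
      linarith
    calc ‖c n‖ = 2 ^ n * (‖c n‖ * (1 / 2) ^ n) := by
          rw [mul_left_comm, ← mul_pow]; norm_num
      _ ≤ 2 ^ n * ‖v‖ := by
          gcongr
          exact (mul_le_mul_of_nonneg_left h4 (norm_nonneg _)).trans h6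
  calc ‖⟪x, (c.sum fun n a => a • wick q (List.replicate n e)) y⟫_ℂ‖
      = ‖∑ n ∈ c.support, c n * ⟪x, wick q (List.replicate n e) y⟫_ℂ‖ := by
        rw [Finsupp.sum, sum_apply, inner_sum]
        simp only [smul_apply, inner_smul_right]
    _ ≤ ∑ n ∈ c.support, (1 / 2) ^ n * (‖v‖ * (‖x‖ * ‖y‖)) := by
        refine (norm_sum_le _ _).trans (Finset.sum_le_sum fun n hn => ?_)
        rw [norm_mul]
        calc _ ≤ (2 ^ n * ‖v‖) * ((1 / 4) ^ n * (‖x‖ * ‖y‖)) :=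
              mul_le_mul (h1 n hn) (norm_inner_wick_le hq he n hx hy) (norm_nonneg _)
                (by positivity)
          _ = (2 * (1 / 4)) ^ n * (‖v‖ * (‖x‖ * ‖y‖)) := by rw [mul_pow]; ring
          _ = _ := by norm_num
    _ ≤ 2 * (‖v‖ * (‖x‖ * ‖y‖)) := by
        rw [← Finset.sum_mul]
        refine mul_le_mul_of_nonneg_right ?_ (by positivity)
        exact (summable_geometric_two.sum_le_tsum _ fun n _ => by positivity).trans_eq
          tsum_geometric_two
    _ = _ := by ring

theorem exists_flipConj_vacuum {z : FockSpace q H}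
    (hz : z ∈ Submodule.span ℂ (Set.range (tensor q : List H → FockSpace q H))) :
    ∃ L ∈ polynomials q (⊤ : Submodule ℝ H), flipConj q H L (vacuum q H) = z := by
  have h3 : Submodule.span ℂ (Set.range (tensor q : List H → FockSpace q H)) ≤
      (Subalgebra.toSubmodule (polynomials q (⊤ : Submodule ℝ H))).map
        ((ContinuousLinearMap.apply ℂ (FockSpace q H) (vacuum q H)).toLinearMap ∘ₗ
          (flipConj q H).toLinearMap) := by
    refine Submodule.span_le.2 ?_
    rintro _ ⟨l, rfl⟩
    refine ⟨wick q l.reverse, wick_mem_polynomials q _ _ fun _ _ => Submodule.mem_top, ?_⟩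
    change flipConj q H (wick q l.reverse) (vacuum q H) = _
    rw [flipConj_vacuum, wick_vacuum, flip_tensor, List.reverse_reverse]
  exact h3 hz

theorem startSpace_le_closure_tensor :
    startSpace q e ≤ (Submodule.span ℂ {x : FockSpace q H | ∃ (f : H) (l : List H),
      ⟪e, f⟫_ℝ = 0 ∧ tensor q (f :: l) = x}).topologicalClosure := by
  refine Submodule.topologicalClosure_minimal _ (Submodule.span_le.2 ?_)
    (Submodule.isClosed_topologicalClosure _)
  rintro _ ⟨f, v, hf, rfl⟩
  refine mem_of_tensor_mem q (S := (Submodule.topologicalClosure _).comap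
    (creation q f).toLinearMap)
    ((Submodule.isClosed_topologicalClosure _).preimage (creation q f).continuous) (fun l => ?_) v
  exact Submodule.le_topologicalClosure _ (Submodule.subset_span ⟨f, l, hf, tensor_cons q f l⟩)

/-- The compression of an element `u` of the generator algebra to the tensors whose first letter is
orthogonal to `e` is bounded by the `2`-norm of `u`. -/
theorem norm_inner_le_of_mem_gaussianAlgebra (hq : |(q : ℝ)| ≤ 1 / 100) (he : ‖e‖ = 1)
    {u : FockSpace q H →L[ℂ] FockSpace q H} (hu : u ∈ gaussianAlgebra q (Submodule.span ℝ {e}))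
    {x y : FockSpace q H} (hx : x ∈ startSpace q e) (hy : y ∈ startSpace q e) :
    ‖⟪x, u y⟫_ℂ‖ ≤ 2 * ‖u (vacuum q H)‖ * (‖x‖ * ‖y‖) := by
  obtain ⟨P, hP, hlim⟩ := exists_wickSpan_tendsto hu
  have huM := gaussianAlgebra_mono (le_top : _ ≤ (⊤ : Submodule ℝ H)) hu
  have hPM (k : ℕ) : P k ∈ gaussianAlgebra q (⊤ : Submodule ℝ H) :=
    gaussianAlgebra_mono le_top (mem_gaussianAlgebra_of_mem_polynomials
      (mem_polynomials_of_mem_wickSpan (hP k)))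
  refine closure_minimal (t := {y | ‖⟪x, u y⟫_ℂ‖ ≤ 2 * ‖u (vacuum q H)‖ * (‖x‖ * ‖y‖)}) ?_
    (isClosed_le (by fun_prop) (by fun_prop)) (startSpace_le_closure_tensor hy)
  intro z hz
  have hz1 : z ∈ startSpace q e := by
    refine (Submodule.span_le.2 ?_ : _ ≤ startSpace q e) hz
    rintro _ ⟨f, l, hf, rfl⟩
    rw [tensor_cons]
    exact startSpan_le_startSpace (creation_mem_startSpan hf _)
  have hz2 : z ∈ Submodule.span ℂ (Set.range (tensor q : List H → FockSpace q H)) := by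
    refine Submodule.span_mono ?_ hz
    rintro _ ⟨f, l, -, rfl⟩
    exact ⟨_, rfl⟩
  obtain ⟨L, hL, rfl⟩ := exists_flipConj_vacuum hz2
  have hcomm {v : FockSpace q H →L[ℂ] FockSpace q H}
      (hv : v ∈ gaussianAlgebra q (⊤ : Submodule ℝ H)) :
      v (flipConj q H L (vacuum q H)) = flipConj q H L (v (vacuum q H)) := by
    rw [← mul_apply_eq_comp, ← flipConj_mul_comm he hv hL, mul_apply_eq_comp]
  have hlim2 : Tendsto (fun k => P k (flipConj q H L (vacuum q H))) atTop
      (𝓝 (u (flipConj q H L (vacuum q H)))) := by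
    simp only [hcomm huM, hcomm (hPM _)]
    exact ((flipConj q H L).continuous.tendsto _).comp hlim
  have h1 : Tendsto (fun k => ‖⟪x, P k (flipConj q H L (vacuum q H))⟫_ℂ‖) atTop
      (𝓝 ‖⟪x, u (flipConj q H L (vacuum q H))⟫_ℂ‖) :=
    (tendsto_const_nhds.inner hlim2).norm
  have h2 := ((hlim.norm.const_mul 2).mul_const (‖x‖ * ‖flipConj q H L (vacuum q H)‖))
  exact le_of_tendsto_of_tendsto' h1 h2 fun k => norm_inner_le_of_mem_wickSpan hq he (hP k) hx hz1

/-- A projection of small trace in the generator algebra maps almost nothing into the tensors whose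
first letter is orthogonal to `e`. -/
theorem norm_startProj_proj_sq_le (hq : |(q : ℝ)| ≤ 1 / 100) (he : ‖e‖ = 1)
    {p : FockSpace q H →L[ℂ] FockSpace q H} (hp : IsStarProjection p)
    (hpA : p ∈ gaussianAlgebra q (Submodule.span ℝ {e})) (x : FockSpace q H) :
    ‖startProj q e (p x)‖ ^ 2 ≤ 2 * ‖p (vacuum q H)‖ * ‖p x‖ ^ 2 := by
  set z := startProj q e (p x) with hz
  have hzmem : z ∈ startSpace q e := startProj_mem _
  have h1 : ‖p z‖ ^ 2 ≤ 2 * ‖p (vacuum q H)‖ * (‖z‖ * ‖z‖) := by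
    rw [norm_proj_sq hp]
    exact (Complex.re_le_norm _).trans (norm_inner_le_of_mem_gaussianAlgebra hq he hpA hzmem hzmem)
  have h2 : ‖z‖ ^ 2 ≤ ‖p z‖ * ‖p x‖ := by
    have h3 : ⟪p z, p x⟫_ℂ = ((‖z‖ ^ 2 : ℝ) : ℂ) := by
      have h5 : startProj q e z = z := startProj_eq_self hzmem
      rw [inner_proj_left hp, proj_apply_apply hp, ← h5, inner_startProj, h5, ← hz,
        inner_self_eq_norm_sq_to_K]
      simp
    have h4 := norm_inner_le_norm (𝕜 := ℂ) (p z) (p x)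
    rwa [h3, Complex.norm_real, Real.norm_of_nonneg (by positivity)] at h4
  rcases (sq_nonneg ‖z‖).eq_or_lt with h3 | h3
  · rw [← h3]; positivity
  · refine le_of_mul_le_mul_left ?_ h3
    calc ‖z‖ ^ 2 * ‖z‖ ^ 2 ≤ (‖p z‖ * ‖p x‖) * (‖p z‖ * ‖p x‖) := by gcongr
      _ = ‖p z‖ ^ 2 * ‖p x‖ ^ 2 := by ring
      _ ≤ (2 * ‖p (vacuum q H)‖ * (‖z‖ * ‖z‖)) * ‖p x‖ ^ 2 := by gcongr
      _ = _ := by ring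

/-- On the vacuum the left and the right action of the generator algebra agree, because the powers of
`e` are palindromes. -/
theorem flipConj_vacuum_of_mem_gaussianAlgebra {u : FockSpace q H →L[ℂ] FockSpace q H}
    (hu : u ∈ gaussianAlgebra q (Submodule.span ℝ {e})) :
    flipConj q H u (vacuum q H) = u (vacuum q H) := by
  rw [flipConj_vacuum]
  refine closure_minimal (t := {y | flip q H y = y}) ?_ (isClosed_eq (by fun_prop) (by fun_prop))
    (apply_vacuum_mem_closure hu)
  intro y hy
  change flip q H y = y
  induction hy using Submodule.span_induction with
  | mem y hy => obtain ⟨n, rfl⟩ := hy; rw [flip_tensor, List.reverse_replicate]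
  | zero => simp
  | add y z _ _ hy hz => rw [map_add, hy, hz]
  | smul a y _ hy => rw [map_smul, hy]

theorem startProj_flipConj (he : ‖e‖ = 1) {L : FockSpace q H →L[ℂ] FockSpace q H}
    (hL : L ∈ polynomials q (Submodule.span ℝ {e})) :
    startProj q e * flipConj q H L = flipConj q H L * startProj q e := by
  induction hL using Algebra.adjoin_induction with
  | mem L hL =>
    obtain ⟨h, hh, rfl⟩ := hL
    obtain ⟨r, rfl⟩ := Submodule.mem_span_singleton.1 hh
    have h : flipConj q H (gaussian q (r • e)) = (r : ℂ) • rightGaussian q e := by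
      simp only [rightGaussian, flipConj_apply, gaussian_smul, mul_smul_comm, smul_mul_assoc]
    rw [h, smul_mul_assoc, mul_smul_comm, startProj_rightGaussian he]
  | algebraMap r => rw [AlgHom.commutes, Algebra.commutes]
  | add L M _ _ hL hM =>
    have h : flipConj q H (L + M) = flipConj q H L + flipConj q H M := by
      simp only [flipConj_apply, mul_add, add_mul]
    rw [h, add_mul, mul_add, hL, hM]
  | mul L M _ _ hL hM => rw [map_mul, ← mul_assoc, hL, mul_assoc, hM, mul_assoc]

/-- The projection onto the tensors whose first letter is orthogonal to `e` commutes with the right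
action of the generator algebra. -/
theorem inner_startProj_mul (he : ‖e‖ = 1) {x u v : FockSpace q H →L[ℂ] FockSpace q H}
    (hx : x ∈ gaussianAlgebra q (⊤ : Submodule ℝ H))
    (hu : u ∈ gaussianAlgebra q (Submodule.span ℝ {e}))
    (hv : v ∈ gaussianAlgebra q (Submodule.span ℝ {e})) :
    ⟪startProj q e (x (u (vacuum q H))), startProj q e (x (v (vacuum q H)))⟫_ℂ =
      ⟪startProj q e (x (vacuum q H)), startProj q e (x (star u (v (vacuum q H))))⟫_ℂ := by
  have hvM := gaussianAlgebra_mono (le_top : _ ≤ (⊤ : Submodule ℝ H)) hv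
  have huM := gaussianAlgebra_mono (le_top : _ ≤ (⊤ : Submodule ℝ H)) hu
  have hpoly : ∀ L ∈ polynomials q (Submodule.span ℝ {e}),
      ⟪startProj q e (x (L (vacuum q H))), startProj q e (x (v (vacuum q H)))⟫_ℂ =
      ⟪startProj q e (x (vacuum q H)), startProj q e (x (v (star L (vacuum q H))))⟫_ℂ := by
    intro L hL
    have hL' : L ∈ polynomials q (⊤ : Submodule ℝ H) :=
      Algebra.adjoin_mono (Set.image_mono (by simp)) hL
    have hsL := star_mem_polynomials hL
    have h1 : startProj q e (x (L (vacuum q H))) =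
        flipConj q H L (startProj q e (x (vacuum q H))) := by
      rw [← flipConj_vacuum_of_mem_gaussianAlgebra (mem_gaussianAlgebra_of_mem_polynomials hL),
        ← mul_apply_eq_comp x, ← flipConj_mul_comm he hx hL', mul_apply_eq_comp,
        ← mul_apply_eq_comp (startProj q e), startProj_flipConj he hL, mul_apply_eq_comp]
    have h2 : flipConj q H (star L) (startProj q e (x (v (vacuum q H)))) =
        startProj q e (x (v (star L (vacuum q H)))) := by
      rw [← mul_apply_eq_comp, ← startProj_flipConj he hsL, mul_apply_eq_comp,
        ← mul_apply_eq_comp x v, ← mul_apply_eq_comp (flipConj q H (star L)),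
        flipConj_mul_comm he (mul_mem hx hvM) (star_mem_polynomials hL'), mul_apply_eq_comp,
        flipConj_vacuum_of_mem_gaussianAlgebra (mem_gaussianAlgebra_of_mem_polynomials hsL),
        mul_apply_eq_comp]
    rw [h1, ← ContinuousLinearMap.adjoint_inner_right, ← ContinuousLinearMap.star_eq_adjoint,
      star_flipConj, h2]
  obtain ⟨P, hP, hlim⟩ := exists_wickSpan_tendsto hu
  have hPM (k : ℕ) : P k ∈ gaussianAlgebra q (⊤ : Submodule ℝ H) :=
    gaussianAlgebra_mono le_top (mem_gaussianAlgebra_of_mem_polynomials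
      (mem_polynomials_of_mem_wickSpan (hP k)))
  have hlim' : Tendsto (fun k => star (P k) (vacuum q H)) atTop (𝓝 (star u (vacuum q H))) := by
    rw [tendsto_iff_norm_sub_tendsto_zero] at hlim ⊢
    refine hlim.congr fun k => ?_
    have := norm_star_vacuum he (sub_mem (hPM k) huM)
    rw [star_sub] at this
    exact this.symm
  have hQ : Continuous fun y => startProj q e (x y) := by fun_prop
  have hQ' : Continuous fun y => startProj q e (x (v y)) := by fun_prop
  have h1 := ((hQ.tendsto _).comp hlim).inner (𝕜 := ℂ)
    (tendsto_const_nhds (x := startProj q e (x (v (vacuum q H)))))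
  have h2 := (tendsto_const_nhds (x := startProj q e (x (vacuum q H)))).inner (𝕜 := ℂ)
    ((hQ'.tendsto _).comp hlim')
  have h3 : v (star u (vacuum q H)) = star u (v (vacuum q H)) := by
    rw [← mul_apply_eq_comp, gaussianAlgebra_span_mul_comm hv (star_mem hu), mul_apply_eq_comp]
  rw [← h3]
  refine tendsto_nhds_unique h1 (h2.congr fun k => ?_)
  exact (hpoly _ (mem_polynomials_of_mem_wickSpan (hP k))).symm

/-- A bounded sequence which asymptotically commutes with a diffuse subalgebra of the generator
algebra is asymptotically orthogonal to the tensors whose first letter is orthogonal to `e`,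
uniformly. -/
theorem tendsto_startProj (hq : |(q : ℝ)| ≤ 1 / 100) (he : ‖e‖ = 1) {l : Filter ℕ}
    {C : VonNeumannAlgebra (FockSpace q H)}
    (hCA : C ≤ gaussianAlgebra q (Submodule.span ℝ {e})) (hC : IsDiffuse C)
    {x : ℕ → FockSpace q H →L[ℂ] FockSpace q H}
    (hxM : ∀ n, x n ∈ gaussianAlgebra q (⊤ : Submodule ℝ H)) {R : ℝ} (hxR : ∀ n, ‖x n‖ ≤ R)
    (hcomm : ∀ c ∈ C, Tendsto (fun n => ‖(c * x n - x n * c) (vacuum q H)‖) l (𝓝 0)) :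
    Tendsto (fun n => startProj q e (x n (vacuum q H))) l (𝓝 0) := by
  have key : ∀ ε > 0, ∀ᶠ n in l, ‖startProj q e (x n (vacuum q H))‖ ^ 2 < ε := by
    intro ε hε
    set δ := ε / (4 * R ^ 2 + 1) / 2 with hδ
    have hδ0 : 0 < δ := by positivity
    obtain ⟨m, p, hp, hsum⟩ := hC.exists_partition (vacuum q H) (pow_pos hδ0 2)
    have hpA (i : Fin m) := hCA (hp i).1
    have h1 (n : ℕ) : ‖startProj q e (x n (vacuum q H))‖ ^ 2 =
        ∑ i, ‖startProj q e (x n (p i (vacuum q H)))‖ ^ 2 := by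
      have h2 (i : Fin m) : ‖startProj q e (x n (p i (vacuum q H)))‖ ^ 2 =
          (⟪startProj q e (x n (vacuum q H)), startProj q e (x n (p i (vacuum q H)))⟫_ℂ).re := by
        rw [@norm_sq_eq_re_inner ℂ, inner_startProj_mul he (hxM n) (hpA i) (hpA i),
          (hp i).2.1.isSelfAdjoint.star_eq, proj_apply_apply (hp i).2.1]
        rfl
      simp only [h2]
      rw [← Complex.re_sum, ← inner_sum, ← map_sum, ← map_sum, ← sum_apply, hsum, one_apply_eq_self,
        @norm_sq_eq_re_inner ℂ]
      rfl
    have h2 (n : ℕ) : ‖startProj q e (x n (vacuum q H))‖ ^ 2 ≤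
        4 * δ * R ^ 2 + ∑ i, 2 * ‖(p i * x n - x n * p i) (vacuum q H)‖ ^ 2 := by
      set ξ := x n (vacuum q H) with hξ
      have hξR : ‖ξ‖ ≤ R := by
        have := (x n).le_of_opNorm_le (hxR n) (vacuum q H)
        rwa [norm_vacuum, mul_one] at this
      have h3 (i : Fin m) : ‖startProj q e (x n (p i (vacuum q H)))‖ ^ 2 ≤
          4 * δ * ‖p i ξ‖ ^ 2 + 2 * ‖(p i * x n - x n * p i) (vacuum q H)‖ ^ 2 := by
        have h4 : startProj q e (x n (p i (vacuum q H))) = startProj q e (p i ξ) -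
            startProj q e ((p i * x n - x n * p i) (vacuum q H)) := by
          rw [← map_sub]
          congr 1
          simp [hξ]
        have h5 := norm_startProj_proj_sq_le hq he (hp i).2.1 (hpA i) ξ
        have h6 := norm_startProj_le (q := q) (e := e) ((p i * x n - x n * p i) (vacuum q H))
        have h7 : ‖p i (vacuum q H)‖ ≤ δ := le_of_sq_le_sq (hp i).2.2 hδ0.le
        have h8 := norm_sub_le (startProj q e (p i ξ))
          (startProj q e ((p i * x n - x n * p i) (vacuum q H)))
        rw [← h4] at h8
        have h9 : ‖startProj q e (p i ξ)‖ ^ 2 ≤ 2 * δ * ‖p i ξ‖ ^ 2 := by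
          refine h5.trans ?_
          gcongr
        have h10 := pow_le_pow_left₀ (norm_nonneg _) h8 2
        have h11 := pow_le_pow_left₀ (norm_nonneg _) h6 2
        nlinarith [sq_nonneg (‖startProj q e (p i ξ)‖ -
          ‖startProj q e ((p i * x n - x n * p i) (vacuum q H))‖)]
      have h4 : ∑ i, ‖p i ξ‖ ^ 2 = ‖ξ‖ ^ 2 := by
        simp only [fun i => norm_proj_sq (hp i).2.1 ξ]
        rw [← Complex.re_sum, ← inner_sum, ← sum_apply, hsum, one_apply_eq_self,
          @norm_sq_eq_re_inner ℂ]
        rfl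
      rw [h1 n]
      refine (Finset.sum_le_sum fun i _ => h3 i).trans ?_
      rw [Finset.sum_add_distrib, ← Finset.mul_sum, h4]
      gcongr
    have h3 : Tendsto (fun n => 4 * δ * R ^ 2 +
        ∑ i, 2 * ‖(p i * x n - x n * p i) (vacuum q H)‖ ^ 2) l
        (𝓝 (4 * δ * R ^ 2 + ∑ _i : Fin m, 2 * 0 ^ 2)) :=
      tendsto_const_nhds.add (tendsto_finsetSum _ fun i _ =>
        ((hcomm _ (hp i).1).pow 2).const_mul 2)
    have h4 : 4 * δ * R ^ 2 + ∑ _i : Fin m, 2 * (0 : ℝ) ^ 2 < ε := by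
      have h5 : 4 * R ^ 2 / (4 * R ^ 2 + 1) ≤ 1 := by
        rw [div_le_one (by positivity)]; linarith
      have h6 : 4 * δ * R ^ 2 = ε / 2 * (4 * R ^ 2 / (4 * R ^ 2 + 1)) := by
        rw [hδ]; field_simp
      simp only [ne_eq, OfNat.ofNat_ne_zero, not_false_eq_true, zero_pow, mul_zero,
        Finset.sum_const_zero, add_zero, h6]
      nlinarith
    filter_upwards [h3.eventually (gt_mem_nhds h4)] with n hn
    exact (h2 n).trans_lt hn
  rw [tendsto_zero_iff_norm_tendsto_zero]
  rw [Metric.tendsto_nhds]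
  intro ε hε
  filter_upwards [key (ε ^ 2) (pow_pos hε 2)] with n hn
  rw [dist_zero_right, norm_norm]
  exact lt_of_pow_lt_pow_left₀ 2 hε.le hn

end Compression

/-! ### Sequences of tensors with long initial powers of the generator -/

section Deep

variable {q : Set.Ioo (-1 : ℝ) 1} {H : Type*} [NormedAddCommGroup H] [InnerProductSpace ℝ H]
  {e : H} {l : Filter ℕ}

variable (q e l) in
/-- Bounded sequences of vectors which along `l` have asymptotically no component in the tensors
`e ⊗ ⋯ ⊗ e` and `e ⊗ ⋯ ⊗ e ⊗ f ⊗ ⋯`, with `f` orthogonal to `e`, for any number of initial letters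
`e`. -/
structure IsDeep (η : ℕ → FockSpace q H) : Prop where
  bounded : ∃ B, ∀ n, ‖η n‖ ≤ B
  startProj (j : ℕ) : Tendsto (fun n => startProj q e ((annihilation q e ^ j) (η n))) l (𝓝 0)
  vacuum (j : ℕ) : Tendsto (fun n => ⟪vacuum q H, (annihilation q e ^ j) (η n)⟫_ℂ) l (𝓝 0)

theorem tendsto_map {T : FockSpace q H →L[ℂ] FockSpace q H} {η : ℕ → FockSpace q H}
    (h : Tendsto η l (𝓝 0)) : Tendsto (fun n => T (η n)) l (𝓝 0) := by
  have := (T.continuous.tendsto 0).comp h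
  rwa [map_zero] at this

theorem IsDeep.bounded_map {η : ℕ → FockSpace q H} (h : IsDeep q e l η)
    (T : FockSpace q H →L[ℂ] FockSpace q H) : ∃ B, ∀ n, ‖T (η n)‖ ≤ B := by
  obtain ⟨B, hB⟩ := h.bounded
  exact ⟨‖T‖ * B, fun n => (T.le_opNorm _).trans (by gcongr; exact hB n)⟩

theorem IsDeep.annihilation {η : ℕ → FockSpace q H} (h : IsDeep q e l η) :
    IsDeep q e l fun n => annihilation q e (η n) := by
  refine ⟨h.bounded_map _, fun j => ?_, fun j => ?_⟩
  · simpa only [pow_succ, mul_apply_eq_comp] using h.startProj (j + 1)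
  · simpa only [pow_succ, mul_apply_eq_comp] using h.vacuum (j + 1)

theorem IsDeep.annihilation_pow {η : ℕ → FockSpace q H} (h : IsDeep q e l η) (j : ℕ) :
    IsDeep q e l fun n => (QGaussian.annihilation q e ^ j) (η n) := by
  induction j with
  | zero => simpa using h
  | succ j ih =>
    simp only [pow_succ', mul_apply_eq_comp]
    exact ih.annihilation

/-- On deep sequences the number operator vanishes asymptotically: their components in tensors of
bounded length tend to zero. -/
theorem IsDeep.numberOp (hq : |(q : ℝ)| ≤ 1 / 100) (he : ‖e‖ = 1) {η : ℕ → FockSpace q H}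
    (h : IsDeep q e l η) : Tendsto (fun n => numberOp q e (η n)) l (𝓝 0) := by
  -- The norm inequality, with `a K = q K a` and `|q| ‖a‖` small, reduces `K η` to `K a η`.
  have key (J : ℕ) : ∀ (η : ℕ → FockSpace q H) (B : ℝ), IsDeep q e l η → (∀ n, ‖η n‖ ≤ B) →
      ∃ t : ℕ → ℝ, Tendsto t l (𝓝 0) ∧
        ∀ n, ‖QGaussian.numberOp q e (η n)‖ ≤ t n + (1 / 2) ^ J * (‖QGaussian.numberOp q e‖ * B) := by
    induction J with
    | zero =>
      intro η B _ hB
      refine ⟨fun _ => 0, tendsto_const_nhds, fun n => ?_⟩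
      rw [pow_zero, one_mul, zero_add]
      exact (ContinuousLinearMap.le_opNorm _ _).trans (by gcongr; exact hB n)
    | succ J ih =>
      intro η B hη hB
      obtain ⟨t, ht, hle⟩ := ih _ (2 * B) hη.annihilation fun n =>
        ((QGaussian.annihilation q e).le_of_opNorm_le (norm_annihilation_le_two hq he) _).trans
          (by gcongr; exact hB n)
      refine ⟨fun n => 4 * (‖⟪QGaussian.vacuum q H, η n⟫_ℂ‖ +
        ‖QGaussian.numberOp q e (QGaussian.startProj q e (η n))‖) + (1 / 25) * t n, ?_, fun n => ?_⟩
      · have h1 := (hη.vacuum 0).norm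
        have h2 := (tendsto_map (T := QGaussian.numberOp q e) (hη.startProj 0)).norm
        have h3 := ((h1.add h2).const_mul 4).add (ht.const_mul (1 / 25))
        simpa only [pow_zero, one_apply_eq_self, norm_zero, add_zero, mul_zero] using h3
      · have h1 := norm_le_vacuum_annihilation_startProj hq he (QGaussian.numberOp q e (η n))
        have h2 : ⟪QGaussian.vacuum q H, QGaussian.numberOp q e (η n)⟫_ℂ =
            ⟪QGaussian.vacuum q H, η n⟫_ℂ := by
          rw [← ContinuousLinearMap.adjoint_inner_left, ← ContinuousLinearMap.star_eq_adjoint,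
            star_numberOp he, numberOp_vacuum he]
        have h3 : QGaussian.annihilation q e (QGaussian.numberOp q e (η n)) =
            ((q : ℝ) : ℂ) • QGaussian.numberOp q e (QGaussian.annihilation q e (η n)) := by
          rw [← mul_apply_eq_comp, annihilation_mul_numberOp he]
          rfl
        have h4 : QGaussian.startProj q e (QGaussian.numberOp q e (η n)) =
            QGaussian.numberOp q e (QGaussian.startProj q e (η n)) := by
          rw [← mul_apply_eq_comp, startProj_numberOp he, mul_apply_eq_comp]
        rw [h2, h3, h4, norm_smul, Complex.norm_real, Real.norm_eq_abs] at h1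
        have h5 := hle n
        have h6 := mul_le_mul hq h5 (norm_nonneg _) (by norm_num)
        have hB0 : 0 ≤ B := (norm_nonneg _).trans (hB n)
        have h7 : 0 ≤ (1 / 2 : ℝ) ^ J * (‖QGaussian.numberOp q e‖ * B) := by positivity
        rw [pow_succ]
        linarith
  obtain ⟨B, hB⟩ := h.bounded
  rw [tendsto_zero_iff_norm_tendsto_zero, Metric.tendsto_nhds]
  intro ε hε
  have hlim : Tendsto (fun J : ℕ => (1 / 2 : ℝ) ^ J * (‖QGaussian.numberOp q e‖ * B)) atTop
      (𝓝 (0 * (‖QGaussian.numberOp q e‖ * B))) :=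
    (tendsto_pow_atTop_nhds_zero_of_lt_one (by norm_num) (by norm_num)).mul_const _
  rw [zero_mul] at hlim
  obtain ⟨J, hJ⟩ := (hlim.eventually (gt_mem_nhds (half_pos hε))).exists
  obtain ⟨t, ht, hle⟩ := key J η B h hB
  filter_upwards [ht.eventually (gt_mem_nhds (half_pos hε))] with n hn
  rw [dist_zero_right, norm_norm]
  linarith [hle n]

theorem IsDeep.annihilation_orthogonal {η : ℕ → FockSpace q H} (h : IsDeep q e l η) {f : H}
    (hf : ⟪e, f⟫_ℝ = 0) (j : ℕ) :
    Tendsto (fun n => QGaussian.annihilation q f ((QGaussian.annihilation q e ^ j) (η n))) l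
      (𝓝 0) := by
  have := tendsto_map (T := QGaussian.annihilation q f) (h.startProj j)
  simpa only [annihilation_startProj hf] using this

theorem tendsto_of_sub {E : Type*} [NormedAddCommGroup E] {u v : ℕ → E}
    (h : Tendsto (fun n => u n - v n) l (𝓝 0)) (hv : Tendsto v l (𝓝 0)) : Tendsto u l (𝓝 0) := by
  simpa using h.add hv

/-- The commutator of `a(e) ^ j` with a right `q`-Gaussian element consists of terms with the number
operator, which vanishes asymptotically on deep sequences. -/
theorem IsDeep.rightGaussian (hq : |(q : ℝ)| ≤ 1 / 100) (he : ‖e‖ = 1) {η : ℕ → FockSpace q H}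
    (h : IsDeep q e l η) (k : H) : IsDeep q e l fun n => rightGaussian q k (η n) := by
  have hdiff (j : ℕ) : Tendsto (fun n =>
      (QGaussian.annihilation q e ^ j) (QGaussian.rightGaussian q k (η n)) -
        QGaussian.rightGaussian q k ((QGaussian.annihilation q e ^ j) (η n))) l (𝓝 0) := by
    induction j with
    | zero => simpa using tendsto_const_nhds
    | succ j ih =>
      have h1 := tendsto_map (T := QGaussian.annihilation q e) ih
      have h2 := ((h.annihilation_pow j).numberOp hq he).const_smul ((⟪e, k⟫_ℝ : ℝ) : ℂ)
      have h3 := h1.add h2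
      rw [smul_zero, add_zero] at h3
      refine h3.congr fun n => ?_
      have h4 (y : FockSpace q H) : QGaussian.annihilation q e (QGaussian.rightGaussian q k y) =
          QGaussian.rightGaussian q k (QGaussian.annihilation q e y) +
            ((⟪e, k⟫_ℝ : ℝ) : ℂ) • QGaussian.numberOp q e y := by
        rw [← mul_apply_eq_comp, annihilation_mul_rightGaussian he]
        rfl
      rw [pow_succ', mul_apply_eq_comp, mul_apply_eq_comp, map_sub, h4]
      abel
  refine ⟨h.bounded_map _, fun j => ?_, fun j => ?_⟩
  · have h1 := tendsto_map (T := QGaussian.startProj q e) (hdiff j)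
    simp only [map_sub] at h1
    refine tendsto_of_sub h1 ?_
    refine squeeze_zero_norm (fun n => norm_startProj_rightGaussian_le hq he k _) ?_
    have h2 := (h.startProj j).norm
    have h3 := ((h.annihilation_pow j).numberOp hq he).norm
    simpa using (h2.const_mul (2 * ‖QGaussian.rightGaussian q k‖)).add (h3.const_mul (2 * ‖k‖))
  · have h1 := (tendsto_const_nhds (x := QGaussian.vacuum q H)).inner (𝕜 := ℂ) (hdiff j)
    simp only [inner_sub_right, inner_zero_right] at h1
    refine tendsto_of_sub h1 ?_
    set f := k - ⟪e, k⟫_ℝ • e with hf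
    have hfe : ⟪e, f⟫_ℝ = 0 := by
      rw [hf, inner_sub_right, real_inner_smul_right, real_inner_self_eq_norm_sq, he]
      ring
    have hk : k = ⟪e, k⟫_ℝ • e + f := by rw [hf]; abel
    have h2 := (h.vacuum (j + 1)).const_mul ((⟪e, k⟫_ℝ : ℝ) : ℂ)
    have h3 := (tendsto_const_nhds (x := QGaussian.vacuum q H)).inner (𝕜 := ℂ)
      (h.annihilation_orthogonal hfe j)
    have h4 := h2.add h3
    rw [mul_zero, inner_zero_right, add_zero] at h4
    refine h4.congr fun n => ?_
    conv_rhs =>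
      rw [← ContinuousLinearMap.adjoint_inner_left, ← ContinuousLinearMap.star_eq_adjoint,
        star_rightGaussian, rightGaussian_vacuum, gaussian_vacuum, inner_creation_left]
      rw [hk, annihilation_add, annihilation_smul]
    rw [add_apply, smul_apply, inner_add_right, inner_smul_right, pow_succ', mul_apply_eq_comp]

theorem IsDeep.add {η ζ : ℕ → FockSpace q H} (hη : IsDeep q e l η) (hζ : IsDeep q e l ζ) :
    IsDeep q e l fun n => η n + ζ n := by
  obtain ⟨B, hB⟩ := hη.bounded
  obtain ⟨D, hD⟩ := hζ.bounded
  refine ⟨⟨B + D, fun n => (norm_add_le _ _).trans (add_le_add (hB n) (hD n))⟩, fun j => ?_,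
    fun j => ?_⟩
  · simpa using (hη.startProj j).add (hζ.startProj j)
  · simpa [inner_add_right] using (hη.vacuum j).add (hζ.vacuum j)

theorem IsDeep.smul {η : ℕ → FockSpace q H} (hη : IsDeep q e l η) (r : ℂ) :
    IsDeep q e l fun n => r • η n := by
  obtain ⟨B, hB⟩ := hη.bounded
  refine ⟨⟨‖r‖ * B, fun n => ?_⟩, fun j => ?_, fun j => ?_⟩
  · rw [norm_smul]
    gcongr
    exact hB n
  · simpa using (hη.startProj j).const_smul r
  · simpa [inner_smul_right] using (hη.vacuum j).const_mul r

/-- Deep sequences form a right module over the polynomials in the `q`-Gaussian elements. -/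
theorem IsDeep.flipConj (hq : |(q : ℝ)| ≤ 1 / 100) (he : ‖e‖ = 1)
    {L : FockSpace q H →L[ℂ] FockSpace q H} (hL : L ∈ polynomials q (⊤ : Submodule ℝ H))
    {η : ℕ → FockSpace q H} (hη : IsDeep q e l η) :
    IsDeep q e l fun n => flipConj q H L (η n) := by
  induction hL using Algebra.adjoin_induction generalizing η with
  | mem L hL => obtain ⟨k, -, rfl⟩ := hL; exact hη.rightGaussian hq he k
  | algebraMap r =>
    have h : QGaussian.flipConj q H (algebraMap ℂ _ r) = r • 1 := by
      rw [AlgHom.commutes, Algebra.algebraMap_eq_smul_one]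
    simp only [h, smul_apply, one_apply_eq_self]
    exact hη.smul r
  | add L M _ _ hL hM =>
    have h : QGaussian.flipConj q H (L + M) = QGaussian.flipConj q H L + QGaussian.flipConj q H M := by
      simp only [flipConj_apply, mul_add, add_mul]
    simp only [h, add_apply]
    exact (hL hη).add (hM hη)
  | mul L M _ _ hL hM =>
    simp only [map_mul, mul_apply_eq_comp]
    exact hL (hM hη)

theorem annihilationProd_replicate (n : ℕ) :
    annihilationProd q (List.replicate n e) = annihilation q e ^ n := by
  simp [annihilationProd]

/-- The last letter of `J` orthogonal to `e` is preceded, in the order of action, by a power of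
`a(e)`. -/
theorem IsDeep.annihilationProd {η : ℕ → FockSpace q H} (hη : IsDeep q e l η) (J : List H)
    (hJ : ∀ k ∈ J, k = e ∨ ⟪e, k⟫_ℝ = 0) (hJ' : ∃ k ∈ J, ⟪e, k⟫_ℝ = 0) :
    Tendsto (fun n => annihilationProd q J (η n)) l (𝓝 0) := by
  induction J with
  | nil => simp at hJ'
  | cons k J ih =>
    simp only [annihilationProd_cons, mul_apply_eq_comp]
    by_cases h : ∃ k ∈ J, ⟪e, k⟫_ℝ = 0
    · exact tendsto_map (ih (fun k hk => hJ k (List.mem_cons_of_mem _ hk)) h)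
    · push Not at h
      have h1 : J = List.replicate J.length e := List.eq_replicate_iff.2 ⟨rfl, fun k hk =>
        (hJ k (List.mem_cons_of_mem _ hk)).resolve_right (h k hk)⟩
      have h2 : ⟪e, k⟫_ℝ = 0 := by
        obtain ⟨k', hk', h3⟩ := hJ'
        rcases List.mem_cons.1 hk' with rfl | hk'
        · exact h3
        · exact absurd h3 (h k' hk')
      rw [h1, annihilationProd_replicate]
      exact hη.annihilation_orthogonal h2 _

variable (e) in
/-- The words all of whose letters are `e` or orthogonal to `e`, and which have at least one letter of
the second kind. -/
def IsMixed (w : List H) : Prop :=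
  (∀ k ∈ w, k = e ∨ ⟪e, k⟫_ℝ = 0) ∧ ∃ k ∈ w, ⟪e, k⟫_ℝ = 0

/-- In each term of the normally ordered Wick word, the letter orthogonal to `e` annihilates one of the
two sequences asymptotically. -/
theorem IsDeep.inner_wick {ξ ζ : ℕ → FockSpace q H} (hξ : IsDeep q e l ξ) (hζ : IsDeep q e l ζ)
    {w : List H} (hw : IsMixed e w) :
    Tendsto (fun n => ⟪ζ n, wick q w (ξ n)⟫_ℂ) l (𝓝 0) := by
  have h1 (n : ℕ) : ⟪ζ n, wick q w (ξ n)⟫_ℂ = wickSum (q : ℝ) w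
      fun I J => ⟪QGaussian.annihilationProd q I.reverse (ζ n),
        QGaussian.annihilationProd q J (ξ n)⟫_ℂ := by
    rw [wick_apply]
    simp only [← inner_creationProd]
    exact wickSum_map (q : ℝ) (innerSL ℂ (ζ n)).toLinearMap _ _
  simp only [h1]
  refine tendsto_wickSum (q : ℝ) w _ fun I J hIJ => ?_
  obtain ⟨B, hB⟩ := hζ.bounded_map (QGaussian.annihilationProd q I.reverse)
  obtain ⟨D, hD⟩ := hξ.bounded_map (QGaussian.annihilationProd q J)
  obtain ⟨hw1, k, hk, hke⟩ := hw
  rcases (hIJ k).1 hk with hkI | hkJ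
  · have h2 := hζ.annihilationProd I.reverse
      (fun k hk => hw1 k ((hIJ k).2 (Or.inl (List.mem_reverse.1 hk))))
      ⟨k, List.mem_reverse.2 hkI, hke⟩
    refine squeeze_zero_norm (a := fun n =>
      ‖QGaussian.annihilationProd q I.reverse (ζ n)‖ * D) (fun n => ?_) ?_
    · exact (norm_inner_le_norm _ _).trans (by gcongr; exact hD n)
    · simpa using h2.norm.mul_const D
  · have h2 := hξ.annihilationProd J (fun k hk => hw1 k ((hIJ k).2 (Or.inr hk))) ⟨k, hkJ, hke⟩
    refine squeeze_zero_norm (a := fun n =>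
      B * ‖QGaussian.annihilationProd q J (ξ n)‖) (fun n => ?_) ?_
    · exact (norm_inner_le_norm _ _).trans (by gcongr; exact hB n)
    · simpa using h2.norm.const_mul B

theorem annihilation_pow_mul_creation (he : ‖e‖ = 1) (j : ℕ) :
    ∃ β : ℂ, annihilation q e ^ (j + 1) * creation q e =
      ((q : ℝ) : ℂ) ^ (j + 1) • (creation q e * annihilation q e ^ (j + 1)) +
        β • annihilation q e ^ j := by
  have hac : annihilation q e * creation q e =
      ((q : ℝ) : ℂ) • (creation q e * annihilation q e) + 1 := by
    rw [annihilation_mul_creation, real_inner_self_eq_norm_sq, he]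
    simp
  induction j with
  | zero => exact ⟨1, by simpa using hac⟩
  | succ j ih =>
    obtain ⟨β, hβ⟩ := ih
    refine ⟨((q : ℝ) : ℂ) ^ (j + 1) + β, ?_⟩
    rw [pow_succ' _ (j + 1), mul_assoc, hβ, mul_add, mul_smul_comm, ← mul_assoc, hac, add_mul,
      smul_mul_assoc, smul_add, smul_smul, mul_smul_comm, ← pow_succ', one_mul, add_smul,
      mul_assoc, ← pow_succ', ← pow_succ]
    abel

/-- The sequences `s(e) ^ i * x n` also commute asymptotically with the diffuse subalgebra, which is
contained in the commutative algebra of `s(e)`. Replacing powers of `s(e)` by powers of `a(e)` leads to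
the components behind an initial power of `e`. -/
theorem isDeep_of_commute (hq : |(q : ℝ)| ≤ 1 / 100) (he : ‖e‖ = 1)
    {C : VonNeumannAlgebra (FockSpace q H)}
    (hCA : C ≤ gaussianAlgebra q (Submodule.span ℝ {e})) (hC : IsDiffuse C)
    {x : ℕ → FockSpace q H →L[ℂ] FockSpace q H}
    (hxM : ∀ n, x n ∈ gaussianAlgebra q (⊤ : Submodule ℝ H)) {R : ℝ} (hxR : ∀ n, ‖x n‖ ≤ R)
    (hcomm : ∀ c ∈ C, Tendsto (fun n => ‖(c * x n - x n * c) (vacuum q H)‖) l (𝓝 0))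
    (horth : ∀ y ∈ gaussianAlgebra q (Submodule.span ℝ {e}),
      Tendsto (fun n => ⟪y (vacuum q H), x n (vacuum q H)⟫_ℂ) l (𝓝 0)) :
    IsDeep q e l fun n => x n (vacuum q H) := by
  have hsA : gaussian q e ∈ gaussianAlgebra q (Submodule.span ℝ {e}) :=
    mem_generatedBy ⟨e, Submodule.mem_span_singleton_self e, rfl⟩
  have hsM := gaussianAlgebra_mono (le_top : _ ≤ (⊤ : Submodule ℝ H)) hsA
  have h1 (i : ℕ) : Tendsto (fun n => startProj q e ((gaussian q e ^ i) (x n (vacuum q H)))) l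
      (𝓝 0) := by
    refine tendsto_startProj hq he hCA hC (x := fun n => gaussian q e ^ i * x n)
      (fun n => mul_mem (pow_mem hsM i) (hxM n)) (R := ‖gaussian q e ^ i‖ * R)
      (fun n => (norm_mul_le _ _).trans (by gcongr; exact hxR n)) fun c hc => ?_
    have h2 : c * gaussian q e ^ i = gaussian q e ^ i * c :=
      gaussianAlgebra_span_mul_comm (hCA hc) (pow_mem hsA i)
    have h3 (n : ℕ) : c * (gaussian q e ^ i * x n) - gaussian q e ^ i * x n * c =
        gaussian q e ^ i * (c * x n - x n * c) := by
      rw [← mul_assoc, h2, mul_sub, mul_assoc, mul_assoc]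
    simp only [h3, mul_apply_eq_comp (gaussian q e ^ i)]
    exact tendsto_zero_iff_norm_tendsto_zero.1
      (tendsto_map (tendsto_zero_iff_norm_tendsto_zero.2 (hcomm c hc)))
  have h2 (j i : ℕ) : Tendsto (fun n =>
      startProj q e ((annihilation q e ^ j) ((gaussian q e ^ i) (x n (vacuum q H))))) l (𝓝 0) := by
    have hstep (T : FockSpace q H →L[ℂ] FockSpace q H) (η : ℕ → FockSpace q H)
        (hη : Tendsto (fun n => startProj q e (T (η n))) l (𝓝 0)) :
        Tendsto (fun n => startProj q e (creation q e (T (η n)))) l (𝓝 0) := by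
      simp only [fun n => startProj_creation (q := q) (e := e) (T (η n))]
      exact tendsto_map (T := startProj q e) (tendsto_map (T := creation q e) hη)
    induction j using Nat.strong_induction_on generalizing i with
    | _ j ih =>
      cases j with
      | zero => simpa using h1 i
      | succ j =>
        have h3 (n : ℕ) : (annihilation q e ^ (j + 1)) ((gaussian q e ^ i) (x n (vacuum q H))) =
            (annihilation q e ^ j) ((gaussian q e ^ (i + 1)) (x n (vacuum q H))) -
            (annihilation q e ^ j) (creation q e ((gaussian q e ^ i) (x n (vacuum q H)))) := by
          rw [← map_sub, pow_succ' (gaussian q e), pow_succ (annihilation q e), mul_apply_eq_comp,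
            mul_apply_eq_comp (gaussian q e)]
          conv_rhs => rw [gaussian, add_apply, add_sub_cancel_left, ← gaussian]
        have h4 : Tendsto (fun n => startProj q e ((annihilation q e ^ j)
            (creation q e ((gaussian q e ^ i) (x n (vacuum q H)))))) l (𝓝 0) := by
          cases j with
          | zero =>
            simpa using hstep 1 _ (by simpa using h1 i)
          | succ j =>
            obtain ⟨β, hβ⟩ := annihilation_pow_mul_creation (q := q) he j
            have h5 := (hstep _ _ (ih (j + 1) (by omega) i)).const_smul (((q : ℝ) : ℂ) ^ (j + 1))
            have h6 := (ih j (by omega) i).const_smul β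
            have h7 := h5.add h6
            rw [smul_zero, smul_zero, add_zero] at h7
            refine h7.congr fun n => ?_
            rw [← mul_apply_eq_comp (annihilation q e ^ (j + 1)) (creation q e), hβ]
            simp only [add_apply, smul_apply, mul_apply_eq_comp, map_add, map_smul]
        have h5 := (ih j (by omega) (i + 1)).sub h4
        rw [sub_zero] at h5
        refine h5.congr fun n => ?_
        rw [h3, map_sub]
  refine ⟨⟨R, fun n => ?_⟩, fun j => by simpa using h2 j 0, fun j => ?_⟩
  · have := (x n).le_of_opNorm_le (hxR n) (vacuum q H)
    rwa [norm_vacuum, mul_one] at this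
  · have h3 : wick q (List.replicate j e) ∈ gaussianAlgebra q (Submodule.span ℝ {e}) :=
      mem_gaussianAlgebra_of_mem_polynomials
        (mem_polynomials_of_mem_wickSpan (Submodule.subset_span ⟨j, rfl⟩))
    refine (horth _ h3).congr fun n => ?_
    rw [wick_vacuum, ← annihilationProd_replicate, ← List.reverse_replicate, ← star_creationProd,
      ContinuousLinearMap.star_eq_adjoint, ContinuousLinearMap.adjoint_inner_right, tensor,
      List.reverse_replicate]

end Deep

/-! ### The orthocomplement of the generator algebra -/

section Mixed

variable {q : Set.Ioo (-1 : ℝ) 1} {H : Type*} [NormedAddCommGroup H] [InnerProductSpace ℝ H]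
  {e : H}

/-- Annihilation by `k` shortens a power of `e`, with a coefficient divisible by `⟪k, e⟫`. -/
theorem annihilation_tensor_replicate (k : H) (n : ℕ) :
    ∃ β : ℂ, annihilation q k (tensor q (List.replicate n e)) =
      (β * (⟪k, e⟫_ℝ : ℝ)) • tensor q (List.replicate (n - 1) e) := by
  induction n with
  | zero => exact ⟨0, by simp [annihilation_vacuum]⟩
  | succ n ih =>
    obtain ⟨β, hβ⟩ := ih
    rw [List.replicate_succ, tensor_cons, annihilation_creation_apply, hβ, map_smul, ← tensor_cons,
      ← List.replicate_succ]
    cases n with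
    | zero =>
      refine ⟨1, ?_⟩
      have h : annihilation q k (tensor q (List.replicate 0 e)) = 0 := by
        simp [annihilation_vacuum]
      rw [hβ, smul_eq_zero] at h
      rcases h with h | h
      · simp [h]
      · have := norm_vacuum (q := q) (H := H)
        simp at h
        simp [h] at this
    | succ n =>
      refine ⟨q * β + 1, ?_⟩
      simp only [Nat.add_sub_cancel, smul_smul, ← add_smul]
      congr 1
      ring

theorem IsMixed.inner_tensor_replicate {w : List H} (hw : IsMixed e w) (n : ℕ) :
    ⟪tensor q w, tensor q (List.replicate n e)⟫_ℂ = 0 := by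
  obtain ⟨hw, k, hk, hke⟩ := hw
  induction w generalizing n with
  | nil => simp at hk
  | cons j w ih =>
    obtain ⟨β, hβ⟩ := annihilation_tensor_replicate (q := q) (e := e) j n
    rw [tensor_cons, inner_creation_left, hβ, inner_smul_right]
    rcases List.mem_cons.1 hk with rfl | hk
    · rw [orthogonal_comm hke]; simp
    · rw [ih _ (fun k hk => hw k (List.mem_cons_of_mem _ hk)) hk, mul_zero]

/-- The vectors orthogonal to the generator algebra are limits of combinations of mixed tensors. -/
theorem mem_closure_mixed (he : ‖e‖ = 1) {v : FockSpace q H}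
    (hv : ∀ n, ⟪tensor q (List.replicate n e), v⟫_ℂ = 0) :
    v ∈ (Submodule.span ℂ {x : FockSpace q H | ∃ w, IsMixed e w ∧
      tensor q w = x}).topologicalClosure := by
  set G := (Submodule.span ℂ {x : FockSpace q H | ∃ w, IsMixed e w ∧
      tensor q w = x}).topologicalClosure with hG
  have : CompleteSpace G := (Submodule.isClosed_topologicalClosure _).completeSpace_coe
  have hGmem {w : List H} (hw : IsMixed e w) : tensor q w ∈ G :=
    Submodule.le_topologicalClosure _ (Submodule.subset_span ⟨w, hw, rfl⟩)
  set y := v - G.starProjection v with hy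
  have hyG : ∀ g ∈ G, ⟪g, y⟫_ℂ = 0 := fun g hg => by
    rw [← inner_conj_symm, hy, Submodule.starProjection_inner_eq_zero _ _ hg, map_zero]
  have hGe : ∀ g ∈ G, ∀ n, ⟪g, tensor q (List.replicate n e)⟫_ℂ = 0 := by
    intro g hg n
    refine closure_minimal (t := {g | ⟪g, tensor q (List.replicate n e)⟫_ℂ = 0}) (fun g hg => ?_)
      (isClosed_eq (by fun_prop) (by fun_prop)) hg
    change ⟪g, tensor q (List.replicate n e)⟫_ℂ = 0
    induction hg using Submodule.span_induction with
    | mem g hg => obtain ⟨w, hw, rfl⟩ := hg; exact hw.inner_tensor_replicate n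
    | zero => simp
    | add g g' _ _ hg hg' => rw [inner_add_left, hg, hg', add_zero]
    | smul a g _ hg => rw [inner_smul_left, hg, mul_zero]
  have hye (n : ℕ) : ⟪tensor q (List.replicate n e), y⟫_ℂ = 0 := by
    rw [hy, inner_sub_right, hv, ← inner_conj_symm,
      hGe _ (Submodule.starProjection_apply_mem _ _), map_zero, sub_zero]
  let T := (Submodule.span ℂ {x : FockSpace q H | ∃ w : List H,
    (∀ k ∈ w, k = e ∨ ⟪e, k⟫_ℝ = 0) ∧ tensor q w = x}).topologicalClosure
  have hTc : IsClosed (T : Set (FockSpace q H)) := Submodule.isClosed_topologicalClosure _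
  have hTmap (k : H) (hk : k = e ∨ ⟪e, k⟫_ℝ = 0) : ∀ z ∈ T, creation q k z ∈ T := by
    have : T ≤ T.comap (creation q k).toLinearMap := by
      refine Submodule.topologicalClosure_minimal _ (Submodule.span_le.2 ?_)
        (hTc.preimage (creation q k).continuous)
      rintro _ ⟨w, hw, rfl⟩
      refine Submodule.le_topologicalClosure _ (Submodule.subset_span ⟨k :: w, ?_, tensor_cons q k w⟩)
      intro j hj
      rcases List.mem_cons.1 hj with rfl | hj
      · exact hk
      · exact hw j hj
    exact fun z hz => this hz
  have hT : ∀ w : List H, tensor q w ∈ T := by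
    intro w
    induction w with
    | nil => exact Submodule.le_topologicalClosure _ (Submodule.subset_span ⟨[], by simp, rfl⟩)
    | cons k w ih =>
      have hk : k = ⟪e, k⟫_ℝ • e + (k - ⟪e, k⟫_ℝ • e) := by abel
      rw [tensor_cons, hk, creation_add, creation_smul]
      refine T.add_mem (T.smul_mem _ (hTmap e (Or.inl rfl) _ ih)) (hTmap _ (Or.inr ?_) _ ih)
      rw [inner_sub_right, real_inner_smul_right, real_inner_self_eq_norm_sq, he]
      ring
  have hTy : ∀ z ∈ T, ⟪z, y⟫_ℂ = 0 := by
    intro z hz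
    refine closure_minimal (t := {z | ⟪z, y⟫_ℂ = 0}) (fun z hz => ?_)
      (isClosed_eq (by fun_prop) (by fun_prop)) hz
    change ⟪z, y⟫_ℂ = 0
    induction hz using Submodule.span_induction with
    | mem z hz =>
      obtain ⟨w, hw, rfl⟩ := hz
      by_cases h : ∃ k ∈ w, ⟪e, k⟫_ℝ = 0
      · exact hyG _ (hGmem ⟨hw, h⟩)
      · push Not at h
        have h1 : w = List.replicate w.length e := List.eq_replicate_iff.2 ⟨rfl, fun k hk =>
          (hw k hk).resolve_right (h k hk)⟩
        rw [h1]
        exact hye _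
    | zero => simp
    | add g g' _ _ hg hg' => rw [inner_add_left, hg, hg', add_zero]
    | smul a g _ hg => rw [inner_smul_left, hg, mul_zero]
  have hy0 : y = 0 := by
    rw [← inner_self_eq_zero (𝕜 := ℂ)]
    exact hTy y (mem_of_tensor_mem q hTc hT y)
  rw [sub_eq_zero.1 hy0]
  exact Submodule.starProjection_apply_mem _ _

end Mixed

/-! ### Strong asymptotic orthogonality -/

section Main

variable {q : Set.Ioo (-1 : ℝ) 1} {H : Type*} [NormedAddCommGroup H] [InnerProductSpace ℝ H]
  {e : H}

theorem tendsto_zero_of_forall_approx {l : Filter ℕ} {f : ℕ → ℂ} (M : ℝ)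
    (h : ∀ δ > 0, ∃ g : ℕ → ℂ, Tendsto g l (𝓝 0) ∧ ∀ n, ‖f n - g n‖ ≤ M * δ) :
    Tendsto f l (𝓝 0) := by
  rw [tendsto_zero_iff_norm_tendsto_zero, Metric.tendsto_nhds]
  intro ε hε
  obtain ⟨g, hg, hfg⟩ := h (ε / (|M| + 1) / 2) (by positivity)
  have h1 : M * (ε / (|M| + 1) / 2) ≤ ε / 2 := by
    have h2 : M / (|M| + 1) ≤ 1 := by
      rw [div_le_one (by positivity)]
      linarith [le_abs_self M]
    calc M * (ε / (|M| + 1) / 2) = ε / 2 * (M / (|M| + 1)) := by ring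
      _ ≤ ε / 2 * 1 := by gcongr
      _ = _ := mul_one _
  have h3 := tendsto_zero_iff_norm_tendsto_zero.1 hg
  filter_upwards [h3.eventually (gt_mem_nhds (half_pos hε))] with n hn
  rw [dist_zero_right, norm_norm]
  have h4 : ‖f n‖ ≤ ‖f n - g n‖ + ‖g n‖ := by
    simpa using norm_add_le (f n - g n) (g n)
  linarith [hfg n]

/-- The inclusion of the generator algebra in the `q`-Gaussian algebra has the strong asymptotic
orthogonality property for `|q| ≤ 1 / 100`. -/
theorem strongAOP_of_abs_le (hq : |(q : ℝ)| ≤ 1 / 100) (he : ‖e‖ = 1) (ω : Ultrafilter ℕ) :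
    StrongAOP ω (vacuum q H) (gaussianAlgebra q (⊤ : Submodule ℝ H))
      (gaussianAlgebra q (Submodule.span ℝ {e})) := by
  rintro C hCA hC a ⟨haM, haA⟩ b ⟨hbM, -⟩ x ⟨⟨⟨hxM, R, hxR⟩, hxorth⟩, -, hxcomm⟩
  set ξ : ℕ → FockSpace q H := fun n => x n (vacuum q H) with hξ
  have hdeep : IsDeep q e ω ξ := by
    refine isDeep_of_commute hq he hCA hC hxM hxR hxcomm fun y hy => ?_
    exact hxorth (fun _ => y) ⟨fun _ => hy, ‖y‖, fun _ => le_rfl⟩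
  have hR : 0 ≤ R := (norm_nonneg _).trans (hxR 0)
  have hξR (n : ℕ) : ‖ξ n‖ ≤ R := by
    have := (x n).le_of_opNorm_le (hxR n) (vacuum q H)
    rwa [norm_vacuum, mul_one] at this
  -- The right factor is a polynomial first.
  have h1 : ∀ L ∈ polynomials q (⊤ : Submodule ℝ H),
      Tendsto (fun n => ⟪a (ξ n), flipConj q H L (ξ n)⟫_ℂ) ω (𝓝 0) := by
    intro L hL
    have hLdeep := hdeep.flipConj hq he hL
    refine tendsto_zero_of_forall_approx (R * (‖flipConj q H L‖ * R)) fun δ hδ => ?_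
    have h2 : a (vacuum q H) ∈ (Submodule.span ℂ {x : FockSpace q H | ∃ w, IsMixed e w ∧
        tensor q w = x}).topologicalClosure := by
      refine mem_closure_mixed he fun n => ?_
      rw [← wick_vacuum]
      exact haA _ (mem_gaussianAlgebra_of_mem_polynomials
        (mem_polynomials_of_mem_wickSpan (Submodule.subset_span ⟨n, rfl⟩)))
    obtain ⟨y, hy, hyδ⟩ := Metric.mem_closure_iff.1 h2 δ hδ
    have h3 : ∃ P ∈ gaussianAlgebra q (⊤ : Submodule ℝ H), P (vacuum q H) = y ∧
        Tendsto (fun n => ⟪flipConj q H L (ξ n), P (ξ n)⟫_ℂ) ω (𝓝 0) := by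
      clear hyδ
      induction hy using Submodule.span_induction with
      | mem y hy =>
        obtain ⟨w, hw, rfl⟩ := hy
        exact ⟨wick q w, mem_gaussianAlgebra_of_mem_polynomials
          (wick_mem_polynomials q _ w fun _ _ => Submodule.mem_top), wick_vacuum q w,
          hdeep.inner_wick hLdeep hw⟩
      | zero => exact ⟨0, zero_mem _, by simp, by simp⟩
      | add y z _ _ hy hz =>
        obtain ⟨P, hP, rfl, hPt⟩ := hy
        obtain ⟨S, hS, rfl, hSt⟩ := hz
        refine ⟨P + S, add_mem hP hS, rfl, ?_⟩
        simpa [inner_add_right] using hPt.add hSt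
      | smul r y _ hy =>
        obtain ⟨P, hP, rfl, hPt⟩ := hy
        refine ⟨r • P, (gaussianAlgebra q ⊤).toStarSubalgebra.smul_mem hP r, rfl, ?_⟩
        simpa [inner_smul_right] using hPt.const_mul r
    obtain ⟨P, hP, rfl, hPt⟩ := h3
    refine ⟨fun n => ⟪P (ξ n), flipConj q H L (ξ n)⟫_ℂ, ?_, fun n => ?_⟩
    · have h4 := (Complex.continuous_conj.tendsto 0).comp hPt
      rw [map_zero] at h4
      refine h4.congr fun n => ?_
      exact inner_conj_symm _ _
    · rw [← inner_sub_left, ← sub_apply]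
      have h4 := norm_mul_vacuum_le he (sub_mem haM hP) (hxM n)
      rw [dist_eq_norm, ← sub_apply] at hyδ
      calc _ ≤ ‖(a - P) (ξ n)‖ * ‖flipConj q H L (ξ n)‖ := norm_inner_le_norm _ _
        _ ≤ (R * δ) * (‖flipConj q H L‖ * R) := by
            refine mul_le_mul (h4.trans (mul_le_mul (hxR n) hyδ.le (norm_nonneg _) hR))
              ((ContinuousLinearMap.le_opNorm _ _).trans ?_) (norm_nonneg _) (by positivity)
            gcongr
            exact hξR n
        _ = _ := by ring
  refine tendsto_zero_of_forall_approx (‖a‖ * R * R) fun δ hδ => ?_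
  obtain ⟨y, hy, hyδ⟩ := Metric.mem_closure_iff.1 (dense_span_tensor q (b (vacuum q H))) δ hδ
  obtain ⟨L, hL, rfl⟩ := exists_flipConj_vacuum hy
  refine ⟨_, h1 L hL, fun n => ?_⟩
  have h2 : flipConj q H L (ξ n) = x n (flipConj q H L (vacuum q H)) := by
    rw [hξ, ← mul_apply_eq_comp, flipConj_mul_comm he (hxM n) hL, mul_apply_eq_comp]
  rw [h2, mul_apply_eq_comp, mul_apply_eq_comp, ← inner_sub_right, ← map_sub]
  rw [dist_eq_norm] at hyδ
  calc _ ≤ ‖a (ξ n)‖ * ‖x n (b (vacuum q H) - flipConj q H L (vacuum q H))‖ :=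
        norm_inner_le_norm _ _
    _ ≤ (‖a‖ * R) * (R * δ) := by
        refine mul_le_mul ((a.le_opNorm _).trans (by gcongr; exact hξR n))
          (((x n).le_of_opNorm_le (hxR n) _).trans (by gcongr)) (norm_nonneg _) (by positivity)
    _ = _ := by ring

end Main

end QGaussian

theorem theorem5p2 :
    ∃ q₀ : ℝ, 0 < q₀ ∧
      ∀ q : Set.Ioo (-1 : ℝ) 1, |(q : ℝ)| < q₀ →
        ∀ (H : Type*) [NormedAddCommGroup H] [InnerProductSpace ℝ H] [CompleteSpace H],
          2 ≤ Module.rank ℝ H →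
          ∀ e : H, ‖e‖ = 1 →
            ∀ ω : Ultrafilter ℕ, (ω : Filter ℕ) ≤ Filter.cofinite →
              QGaussian.StrongAOP ω (QGaussian.vacuum q H)
                (QGaussian.gaussianAlgebra q (⊤ : Submodule ℝ H))
                (QGaussian.gaussianAlgebra q (Submodule.span ℝ {e})) := by
  refine ⟨1 / 100, by norm_num, fun q hq H _ _ _ _ e he ω _ => ?_⟩
  exact QGaussian.strongAOP_of_abs_le hq.le he ω
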